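/- **Setting.** Let $d\in\mathbb N$, $0\le\eta<1/2$, $\gamma>0$, $0<\varepsilon\le 1$, $w^*\in\mathbb R^d$ with $\|w^*\|_2=1$, and let $\operatorname{sign}(u)=+1$ if $u\ge 0$ and $-1$ otherwise. Let $\mathcal D$ be a probability distribution on $\mathbb R^d\times\{\pm1\}$ with marginal $\mathcal D_x$ on $\mathbb R^d$, such that $\|x\|_2\le 1$ and $|\langle w^*,x\rangle|\ge\gamma$ for $\mathcal D_x$-almost every $x$, and such that for some measurable $\eta(\cdot):\mathbb R^d\to[0,\eta]$, conditionally on $x$, $y=\operatorname{sign}(\langle w^*,x\rangle)$ with probability $1-\eta(x)$ and $y=-\operatorname{sign}(\langle w^*,x\rangle)$ with probability $\eta(x)$ (Massart noise at rate $\eta$). **Algorithm** (inputs $d$, $\eta$, $\gamma$, accuracy parameter $\epsilon'$, and integers $N,n,m$; access to i.i.d. examples from $\mathcal D$). Put $\lambda=\eta+\epsilon'$ and $\mathrm{LeakyReLU}_\lambda(z)=(1-\lambda)z$ for $z\ge 0$, $\lambda z$ for $z<0$. Draw $N$ points from $\mathcal D_x$. Start with the empty list of rules and the unclassified region $S=\mathbb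 R^d$. While at least an $\epsilon'$ fraction of the $N$ points lies in $S$: (1) run SGD projected to the unit ball on $w\mapsto \mathbf E_{\mathcal D|_S}[\mathrm{LeakyReLU}_\lambda(-y\langle w,x\rangle)]$, from $0$, for $n$ iterations with step size $1/\sqrt n$, using one fresh example from $\mathcal D|_S$ per iteration, and let $w$ be the average of the iterates, normalized to $\|w\|_2=1$ (left as is if it is $0$); (2) draw $m$ fresh examples from $\mathcal D|_S$ and find $T$ that minimizes the empirical error of $\operatorname{sign}(\langle w,x\rangle)$ conditioned on $|\langle w,x\rangle|\ge T$ among those $T$ for which this event has empirical probability at least $\gamma\epsilon'$; (3) append $(w,T)$ to the list and remove $\{x:|\langle w,x\rangle|\ge T\}$ from $S$. Return the list. Examples from $\mathcal D|_S$ are obtained by rejection from examples of $\mathcal D$, and every example of $\mathcal D$ that is drawn counts as a sample. The returned decision list $[(w_1,T_1),(w_2,T_2),\dots]$ classifies $x$ as $\operatorname{sign}(\langle w_i,x\rangle)$ for the first $i$ with $|\langle w_i,x\rangle|\ge T_i$, and arbitrarily if there is no such $i$. Running time is counted in a unit-cost model of real arithmetic, where each arithmetic operation (including square root and absolute value), comparison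 or memory write costs one step and drawing an example costs $d+1$ steps. **Theorem 2.1.** There are absolute constants $c\in(0,1]$, $C$, $k$ and functions $N,n,m$ of $(\gamma,\epsilon')\in(0,1]^2$ with values in $\mathbb N$ and $$N\le \frac{C\log\frac{2}{\gamma\epsilon'}}{\epsilon'^2},\qquad n\le \frac{C\log^k\frac{2}{\gamma\epsilon'}}{\gamma^2\epsilon'^2},\qquad m\le\frac{C\log^k\frac{2}{\gamma\epsilon'}}{\gamma^2\epsilon'^4},$$ such that the following holds for all $d,\eta,\gamma,\varepsilon,w^*,\mathcal D$ as above for which $\eta+c\varepsilon\le 1/2$. With probability at least $2/3$ over the examples, the algorithm run with accuracy parameter $\epsilon'=c\varepsilon$ and the integers $N,n,m$ at $(\gamma,\epsilon')$ terminates, uses at most $C\log^k\!\big(\tfrac{2}{\gamma\varepsilon}\big)/(\gamma^3\varepsilon^5)=\tilde O(1/(\gamma^3\varepsilon^5))$ samples from $\mathcal D$, makes at most $C\,\big(d\cdot\tfrac1\varepsilon\cdot\tfrac1\gamma\big)^k=\mathrm{poly}(d,1/\varepsilon,1/\gamma)$ steps, and returns a decision list of halfspaces such that, whatever the arbitrary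 predictions are, the resulting classifier $h$ has misclassification error $\Pr_{(x,y)\sim\mathcal D}[h(x)\ne y]\le\eta+\varepsilon$. -/

import Mathlib

open MeasureTheory

noncomputable section

namespace MassartMargin

/-! ### Data, hypotheses and noise -/

/-- Points of `ℝ^d` with the Euclidean norm. -/
abbrev Vec (d : ℕ) : Type := EuclideanSpace ℝ (Fin d)

/-- A labelled example `(x, y)`; the label `true` stands for `+1` and `false` for `-1`. -/
abbrev Example (d : ℕ) : Type := Vec d × Bool

/-- The numerical value `±1` of a label. -/
def labelValue (y : Bool) : ℝ := if y then 1 else -1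

/-- The halfspace `h_w(x) = sign ⟨w, x⟩`, where `sign u = +1` iff `u ≥ 0`. -/
def halfspace {d : ℕ} (w x : Vec d) : Bool := decide (0 ≤ inner ℝ w x)

/-- `D` is generated by the target `f` corrupted with Massart noise at rate `η`: a point `x` is drawn
from the marginal of `D`; then `y = f x` with probability `1 - flip x` and `y = - f x` with
probability `flip x`, for some measurable `flip` with values in `[0, η]`. -/
def IsMassart {d : ℕ} (D : Measure (Example d)) (f : Vec d → Bool) (η : ℝ) : Prop :=
  ∃ flip : Vec d → ℝ, Measurable flip ∧ (∀ x, 0 ≤ flip x ∧ flip x ≤ η) ∧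
    D = (D.fst.withDensity fun x => ENNReal.ofReal (1 - flip x)).map (fun x => (x, f x))
      + (D.fst.withDensity fun x => ENNReal.ofReal (flip x)).map (fun x => (x, !f x))

/-- `D` lives on the unit ball times `{±1}` and has margin `γ` with respect to `w`. -/
def HasMargin {d : ℕ} (D : Measure (Example d)) (w : Vec d) (γ : ℝ) : Prop :=
  ∀ᵐ p ∂D, ‖p.1‖ ≤ 1 ∧ γ ≤ |inner ℝ w p.1|

/-- A decision list of halfspaces `[(w₁, T₁), (w₂, T₂), …]`. -/
abbrev DecisionList (d : ℕ) : Type := List (Vec d × ℝ)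

/-- The classifier of a decision list: `sign ⟨wᵢ, x⟩` for the first `i` with `|⟨wᵢ, x⟩| ≥ Tᵢ`.
If there is no such `i`, the arbitrary prediction `g x` is returned. -/
def DecisionList.classify {d : ℕ} (g : Vec d → Bool) : DecisionList d → Vec d → Bool
  | [], x => g x
  | (w, T) :: L, x => if T ≤ |inner ℝ w x| then halfspace w x else DecisionList.classify g L x

/-- Misclassification error `Pr_{(x,y) ∼ D}[h(x) ≠ y]`. -/
def err {d : ℕ} (D : Measure (Example d)) (h : Vec d → Bool) : ℝ :=
  D.real {p | h p.1 ≠ p.2}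

/-! ### The loss -/

/-- `LeakyRelu_lam(z)`. -/
def leakyReLU (lam z : ℝ) : ℝ := if 0 ≤ z then (1 - lam) * z else lam * z

/-- A subderivative of `leakyReLU lam` at `z` (see `leakyReLU_subgradient`). -/
def leakySlope (lam z : ℝ) : ℝ := if 0 ≤ z then 1 - lam else lam

/-- `- leakySlope · y x` is a subgradient at `w` of the loss `w ↦ LeakyRelu_lam(- y ⟨w, x⟩)`. -/
theorem leakyReLU_subgradient {d : ℕ} {lam : ℝ} (hlam : lam ≤ 1 / 2) (y : ℝ) (w w' x : Vec d) :
    leakyReLU lam (-y * inner ℝ w x)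
        + inner ℝ (-(leakySlope lam (-y * inner ℝ w x) * y) • x) (w' - w)
      ≤ leakyReLU lam (-y * inner ℝ w' x) := by
  rw [inner_smul_left, inner_sub_right, real_inner_comm x w', real_inner_comm x w]
  generalize inner ℝ x w' = a
  generalize inner ℝ x w = b
  simp only [leakyReLU, leakySlope, conj_trivial]
  split_ifs with h1 h2 h2 <;> nlinarith

/-! ### Cost model

Programs run on a unit-cost real machine with access to an infinite stream of examples. One step pays
for one arithmetic operation (`+`, `-`, `*`, `/`, `√`, `|·|`), one comparison, one update of a counter
or one write to memory. Drawing an example costs `d + 1` steps and is counted as one sample.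
A run may diverge, in which case its result is `none`. -/

/-- Number of examples drawn and of steps made so far. -/
structure Usage where
  samples : ℕ
  steps : ℕ

/-- Programs: they read the stream of examples, keep track of the usage, and may diverge. -/
abbrev Comp (d : ℕ) : Type → Type := ReaderT (ℕ → Example d) (StateT Usage Option)

/-- Run a program on a stream of examples, from the beginning of the stream. -/
def Comp.exec {d : ℕ} {α : Type} (p : Comp d α) (ω : ℕ → Example d) : Option (α × Usage) :=
  (p.run ω).run ⟨0, 0⟩

/-- Pay for `k` steps. -/
def tick {d : ℕ} (k : ℕ) : Comp d Unit :=
  modify fun u => ⟨u.samples, u.steps + k⟩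

/-- One elementary operation with result `a`. -/
def step {d : ℕ} {α : Type} (a : α) : Comp d α := do
  tick 1
  pure a

/-- Draw the next example of the stream. -/
def draw {d : ℕ} : Comp d (Example d) := do
  let ω ← read
  let u ← get
  set (⟨u.samples + 1, u.steps + (d + 1)⟩ : Usage)
  pure (ω u.samples)

/-- The first `fuel` rounds of the loop that starts in state `s` and in each round runs `body`, which
either returns a new state (`inl`) or exits with a result (`inr`); `none` if there was no exit. -/
def Comp.loopFuel {d : ℕ} {σ α : Type} (body : σ → Comp d (σ ⊕ α)) : ℕ → σ → Comp d α
  | 0, _ => fun _ _ => none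
  | fuel + 1, s => do
    match ← body s with
    | Sum.inl s' => Comp.loopFuel body fuel s'
    | Sum.inr a => pure a

open Classical in
/-- The unbounded loop: its result is that of sufficiently many rounds, and `none` if it does not
exit. It satisfies the expected recursion `Comp.loop_eq`. -/
def Comp.loop {d : ℕ} {σ α : Type} (body : σ → Comp d (σ ⊕ α)) (s : σ) : Comp d α :=
  fun ω u =>
    if h : ∃ fuel, (Comp.loopFuel body fuel s ω u).isSome then
      Comp.loopFuel body (Nat.find h) s ω u
    else none

theorem Comp.loopFuel_succ {d : ℕ} {σ α : Type} (body : σ → Comp d (σ ⊕ α)) (fuel : ℕ) (s : σ)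
    (ω : ℕ → Example d) (u : Usage) :
    Comp.loopFuel body (fuel + 1) s ω u = (body s ω u).bind fun r =>
      match r.1 with
      | Sum.inl s' => Comp.loopFuel body fuel s' ω r.2
      | Sum.inr a => some (a, r.2) := by
  simp only [Comp.loopFuel]
  change (body s ω u).bind _ = _
  congr 1
  funext r
  rcases r with ⟨_ | _, _⟩ <;> rfl

theorem Comp.loopFuel_mono {d : ℕ} {σ α : Type} (body : σ → Comp d (σ ⊕ α)) (ω : ℕ → Example d)
    (v : α × Usage) (fuel : ℕ) : ∀ (s : σ) (u : Usage),
    Comp.loopFuel body fuel s ω u = some v → Comp.loopFuel body (fuel + 1) s ω u = some v := by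
  induction fuel with
  | zero => intro s u h; exact absurd h (by change none ≠ _; simp)
  | succ n ih =>
    intro s u h
    rw [Comp.loopFuel_succ] at h ⊢
    rcases hb : body s ω u with _ | ⟨_ | _, _⟩
    · simp [hb] at h
    · simp only [hb, Option.bind_some] at h ⊢
      exact ih _ _ h
    · simpa [hb] using h

theorem Comp.loop_eq_some {d : ℕ} {σ α : Type} (body : σ → Comp d (σ ⊕ α)) (s : σ)
    (ω : ℕ → Example d) (u : Usage) (v : α × Usage) :
    Comp.loop body s ω u = some v ↔ ∃ fuel, Comp.loopFuel body fuel s ω u = some v := by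
  classical
  have mono : ∀ (i j : ℕ) (w : α × Usage), i ≤ j →
      Comp.loopFuel body i s ω u = some w → Comp.loopFuel body j s ω u = some w := by
    intro i j w hij h
    induction hij with
    | refl => exact h
    | step _ ih => exact Comp.loopFuel_mono body ω w _ s u ih
  constructor
  · intro h
    unfold Comp.loop at h
    split_ifs at h with hex
    exact ⟨_, h⟩
  · rintro ⟨fuel, h⟩
    have hex : ∃ fuel, (Comp.loopFuel body fuel s ω u).isSome := ⟨fuel, by simp [h]⟩
    have h2 : Comp.loop body s ω u = Comp.loopFuel body (Nat.find hex) s ω u := by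
      unfold Comp.loop
      rw [dif_pos hex]
    rw [h2]
    obtain ⟨w, hw⟩ := Option.isSome_iff_exists.mp (Nat.find_spec hex)
    have hle : Nat.find hex ≤ fuel := Nat.find_min' hex (by rw [h]; rfl)
    rw [hw, ← mono _ _ w hle hw, h]

theorem Comp.loop_eq {d : ℕ} {σ α : Type} (body : σ → Comp d (σ ⊕ α)) (s : σ) :
    Comp.loop body s = (do
      match ← body s with
      | Sum.inl s' => Comp.loop body s'
      | Sum.inr a => pure a) := by
  funext ω u
  have h : ∀ r : Option (α × Usage), (∀ v, Comp.loop body s ω u = some v ↔ r = some v) →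
      Comp.loop body s ω u = r := fun r hr => Option.ext fun v => hr v
  apply h
  intro v
  rw [Comp.loop_eq_some]
  change _ ↔ (body s ω u).bind _ = some v
  have h0 : (∃ fuel, Comp.loopFuel body fuel s ω u = some v) ↔
      ∃ fuel, Comp.loopFuel body (fuel + 1) s ω u = some v :=
    ⟨fun ⟨f, hf⟩ => ⟨f, Comp.loopFuel_mono body ω v f s u hf⟩, fun ⟨f, hf⟩ => ⟨f + 1, hf⟩⟩
  rw [h0]
  simp only [Comp.loopFuel_succ]
  rcases hb : body s ω u with _ | ⟨s' | a, u'⟩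
  · simp
  · simp only [Option.bind_some]
    exact (Comp.loop_eq_some body s' ω u' v).symm
  · simp only [Option.bind_some]
    exact ⟨fun ⟨_, hf⟩ => hf, fun hf => ⟨0, hf⟩⟩

/-! ### Vector operations -/

/-- The inner product `⟨w, x⟩`. -/
def dot {d : ℕ} (w x : Vec d) : Comp d ℝ :=
  (List.finRange d).foldlM (fun s i => do
    let p ← step (w i * x i)
    step (s + p)) 0

/-- Compute and write the coordinates of a vector one by one. -/
def build {d : ℕ} (f : Fin d → Comp d ℝ) : Comp d (Vec d) :=
  (List.finRange d).foldlM (fun v i => do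
    let a ← f i
    step (WithLp.toLp 2 (Function.update v.ofLp i a))) 0

/-- The vector `w + a x`. -/
def addScaled {d : ℕ} (w : Vec d) (a : ℝ) (x : Vec d) : Comp d (Vec d) :=
  build fun i => do
    let p ← step (a * x i)
    step (w i + p)

/-- The Euclidean norm. -/
def norm2 {d : ℕ} (w : Vec d) : Comp d ℝ := do
  let s ← dot w w
  step (√s)

/-- `w / ‖w‖`; the zero vector is left as it is. -/
def normalize {d : ℕ} (w : Vec d) : Comp d (Vec d) := do
  let r ← norm2 w
  let pos ← step (decide (0 < r))
  if pos then build fun i => step (w i / r) else pure w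

/-- Projection to the unit ball. -/
def project {d : ℕ} (w : Vec d) : Comp d (Vec d) := do
  let r ← norm2 w
  let inside ← step (decide (r ≤ 1))
  if inside then pure w else build fun i => step (w i / r)

/-! ### The algorithm -/

/-- Is `x` classified by some rule of the list, i.e. outside the unclassified region `S`? -/
def isCovered {d : ℕ} : DecisionList d → Vec d → Comp d Bool
  | [], _ => step false
  | (w, T) :: L, x => do
    let s ← dot w x
    let a ← step |s|
    let b ← step (decide (T ≤ a))
    if b then pure true else isCovered L x

/-- Draw an example from `D` conditioned on the unclassified region, by rejection. -/
def drawUnclassified {d : ℕ} (L : DecisionList d) : Comp d (Example d) :=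
  Comp.loop (fun (_ : Unit) => do
    let e ← draw
    let b ← isCovered L e.1
    pure (if b then Sum.inl () else Sum.inr e)) ()

/-- One step of projected SGD with step size `ρ` on the example `(x, y)`. -/
def sgdStep {d : ℕ} (lam ρ : ℝ) (w : Vec d) (e : Example d) : Comp d (Vec d) := do
  let s ← dot w e.1
  let z ← step (-labelValue e.2 * s)
  let c ← step (leakySlope lam z)
  let a ← step (ρ * c)
  let a ← step (a * labelValue e.2)
  let w ← addScaled w a e.1
  project w

/-- Projected SGD on the loss `E[LeakyRelu_lam(- y ⟨w, x⟩)]` of the conditional distribution: start at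
`0`, make `n` iterations with step size `1 / √n`, average the iterates and normalize. -/
def sgd {d : ℕ} (lam : ℝ) (n : ℕ) (L : DecisionList d) : Comp d (Vec d) := do
  let r ← step (√(n : ℝ))
  let ρ ← step (1 / r)
  let zero ← build fun _ => step 0
  let out ← (List.range n).foldlM (fun (st : Vec d × Vec d) _ => do
    let e ← drawUnclassified L
    let w ← sgdStep lam ρ st.1 e
    let total ← addScaled st.2 1 w
    step (w, total)) (zero, zero)
  let avg ← build fun i => step (out.2 i / n)
  normalize avg

/-- Draw `m` examples `(x, y)` from the conditional distribution, and record for each of them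
`|⟨w, x⟩|` and whether `h_w(x) ≠ y`. -/
def collect {d : ℕ} (m : ℕ) (L : DecisionList d) (w : Vec d) : Comp d (List (ℝ × Bool)) :=
  (List.range m).foldlM (fun out _ => do
    let e ← drawUnclassified L
    let s ← dot w e.1
    let a ← step |s|
    let h ← step (decide (0 ≤ s))
    let wrong ← step (h != e.2)
    step ((a, wrong) :: out)) []

/-- The number of records with `|⟨w, x⟩| ≥ T`, and the number of misclassified ones among them. -/
def tally {d : ℕ} (S : List (ℝ × Bool)) (T : ℝ) : Comp d (ℕ × ℕ) :=
  S.foldlM (fun (c : ℕ × ℕ) (p : ℝ × Bool) => do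
    let b ← step (decide (T ≤ p.1))
    if b then
      let k ← step (c.1 + 1)
      let e ← step (if p.2 then c.2 + 1 else c.2)
      pure (k, e)
    else pure c) (0, 0)

/-- A threshold `T` that minimizes the empirical error conditioned on `|⟨w, x⟩| ≥ T` among those for
which this event has empirical probability at least `q`. As the event depends on `T` only through
which records satisfy it, it is enough to try the recorded values of `|⟨w, x⟩|`. -/
def bestThreshold {d : ℕ} (q : ℝ) (S : List (ℝ × Bool)) : Comp d ℝ := do
  let best ← S.foldlM (fun (best : Option (ℝ × ℝ)) (p : ℝ × Bool) => do
    let c ← tally S p.1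
    let mass ← step ((c.1 : ℝ) / S.length)
    let feasible ← step (decide (q ≤ mass))
    if feasible then
      let r ← step ((c.2 : ℝ) / c.1)
      let better ← step (best.elim true fun b => decide (r < b.2))
      if better then pure (some (p.1, r)) else pure best
    else pure best) none
  step (best.elim 0 Prod.fst)

/-- The number of points of a list that are still unclassified. -/
def countUnclassified {d : ℕ} (X : List (Vec d)) (L : DecisionList d) : Comp d ℕ :=
  X.foldlM (fun k x => do
    let b ← isCovered L x
    step (if b then k else k + 1)) 0

/-- The while loop: as long as at least an `ε` fraction of the fixed points `X` is unclassified, find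
`w` by SGD and a threshold `T` from `m` fresh conditional examples, and append `(w, T)` to the list,
which is empty at first. -/
def mainLoop {d : ℕ} (lam q ε : ℝ) (n m : ℕ) (X : List (Vec d)) : Comp d (DecisionList d) :=
  Comp.loop (fun (L : DecisionList d) => do
    let k ← countUnclassified X L
    let frac ← step ((k : ℝ) / X.length)
    let go ← step (decide (ε ≤ frac))
    if go then
      let w ← sgd lam n L
      let S ← collect m L w
      let T ← bestThreshold q S
      tick (L.length + 1)
      pure (Sum.inl (L ++ [(w, T)]))
    else pure (Sum.inr L)) []

/-- The algorithm with noise rate `η`, margin `γ` and accuracy `ε`, where `N` examples serve for the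
stopping rule, each SGD makes `n` iterations, and each threshold is found from `m` examples. -/
def learner (d : ℕ) (η γ ε : ℝ) (N n m : ℕ) : Comp d (DecisionList d) := do
  let lam ← step (η + ε)
  let q ← step (γ * ε)
  let X ← (List.range N).foldlM (fun out _ => do
    let e ← draw
    step (e.1 :: out)) []
  mainLoop lam q ε n m X

end MassartMargin

end

open MeasureTheory

noncomputable section

namespace MassartMargin

open scoped ENNReal

/-! Write `δ` for the accuracy parameter, `lam = η + δ`, `q = γ * δ`. By `loss_eq` the loss of `w`
at `(x, y)` is (1[`w` errs] - `lam`) · |⟨w, x⟩|. Given `x`, the target errs with probability at most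
`η`, and its margin is at least `γ`, so its risk is at most `-q` on every region described by `x`
alone (`risk_cond_le`). Hence the target remains a good competitor on the unclassified region,
whatever rules were removed before.

SGD therefore finds `w` of risk at most `-(4/5) q` (`sgdState_risk_bound`, `risk_sgdVec_le`). By the
layer-cake formula the risk is the average over `T ∈ (0, 1]` of the expected excess of the error
over `lam` on {|⟨w, x⟩| ≥ T}. So some `T` has error below `lam` on a set of mass at least `(3/2) q`
(`exists_threshold`). Empirical minimization finds such a threshold up to constants: the candidates
are the recorded margins, each candidate is independent of the other examples, and a union bound
over the records suffices (`threshold_bad_le`). The rule obtained has conditional mass at least `q /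
2` and error at most `η + 4δ`.

Each good rule shrinks the unclassified region by a factor `1 - q / 2`, so about `log (1/q) / q`
rounds bring its mass below `δ / 2`. The stopping sample detects the mass up to a factor two
(`misjudged_le`), so the loop stops with at most `2δ` left over and total error at most `η + 6δ`.

Probability enters through one functional, `failCost`. It adds the indicators of all misjudgments
and bad rules and a charge `β` for every draw. Its mean is bounded round by round
(`lintegral_failCost_le`): accepted examples are independent with the conditional law and leave a
fresh stream behind (`lintegral_fetch`), and an accepted example takes at most `2 / δ` draws on
average. The lists in `failCost` are built without the stopping sample, so Chernoff's bound applies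
to each of them. If the cost is below `1`, the program terminates, uses at most `β⁻¹` draws in the
loop and returns an accurate list (`loopGood_of_failCost_lt_one`); Markov's inequality does the rest
(`learner_guarantee`). `Yields` and `Pays` link the monadic program to these functions of the
stream. -/

/-! ### Streams of independent examples -/

section Stream

variable {E : Type} [MeasurableSpace E]

/-- The stream without its first `t` entries. -/
def dropStream (t : ℕ) (ω : ℕ → E) : ℕ → E := fun i => ω (t + i)

/-- The stream with `x` put in front. -/
def consStream (x : E) (ω : ℕ → E) : ℕ → E := fun i => Nat.casesOn i x ω

omit [MeasurableSpace E] in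
@[simp] theorem consStream_zero (x : E) (ω : ℕ → E) : consStream x ω 0 = x := rfl

omit [MeasurableSpace E] in
@[simp] theorem consStream_succ (x : E) (ω : ℕ → E) (i : ℕ) : consStream x ω (i + 1) = ω i := rfl

omit [MeasurableSpace E] in
theorem dropStream_dropStream (s t : ℕ) (ω : ℕ → E) :
    dropStream t (dropStream s ω) = dropStream (s + t) ω := by
  funext i; simp only [dropStream, Nat.add_assoc]

omit [MeasurableSpace E] in
@[simp] theorem dropStream_zero (ω : ℕ → E) : dropStream 0 ω = ω := by
  funext i; simp [dropStream]

omit [MeasurableSpace E] in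
theorem dropStream_succ_consStream (x : E) (ω : ℕ → E) (t : ℕ) :
    dropStream (t + 1) (consStream x ω) = dropStream t ω := by
  funext i; simp [dropStream, Nat.add_right_comm t 1 i]

theorem measurable_consStream : Measurable fun p : E × (ℕ → E) => consStream p.1 p.2 := by
  rw [measurable_pi_iff]
  rintro (_ | i)
  · exact measurable_fst
  · exact (measurable_pi_apply i).comp measurable_snd

theorem measurable_dropStream (t : ℕ) : Measurable (dropStream (E := E) t) :=
  measurable_pi_iff.2 fun i => measurable_pi_apply (t + i)

/-- The law of a stream of independent examples from `D`. -/
abbrev streamLaw (D : Measure E) : Measure (ℕ → E) := Measure.infinitePi fun _ => D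

variable (D : Measure E) [IsProbabilityMeasure D]

/-- The two laws agree on finite cylinders, which determine an infinite product: coordinate `0` is
split off and the others are shifted down by one. This is what permits reading the stream one
example at a time. -/
theorem map_consStream :
    (D.prod (streamLaw D)).map (fun p => consStream p.1 p.2) = streamLaw D := by
  refine Measure.eq_infinitePi (μ := fun _ : ℕ => D) fun s t ht => ?_
  classical
  have hpre : (fun p : E × (ℕ → E) => consStream p.1 p.2) ⁻¹' (Set.pi s t)
      = (if 0 ∈ s then t 0 else Set.univ) ×ˢ
        Set.pi ((s.erase 0).image Nat.pred) (fun i => t (i + 1)) := by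
    ext ⟨x, ω⟩
    simp only [Set.mem_preimage, Set.mem_pi, Set.mem_prod, Finset.mem_coe, Finset.mem_image,
      Finset.mem_erase]
    constructor
    · intro h
      refine ⟨?_, ?_⟩
      · split_ifs with h0
        · exact h 0 h0
        · trivial
      · rintro i ⟨j, ⟨hj0, hj⟩, rfl⟩
        obtain ⟨j, rfl⟩ := Nat.exists_eq_succ_of_ne_zero hj0
        exact h _ hj
    · rintro ⟨h1, h2⟩ (_ | i) hi
      · simpa [hi] using h1
      · exact h2 i ⟨i + 1, ⟨by simp, hi⟩, rfl⟩
  have hmeas : ∀ i, MeasurableSet (t (i + 1)) := fun i => ht _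
  rw [Measure.map_apply measurable_consStream
    (MeasurableSet.pi s.countable_toSet fun i _ => ht i), hpre, Measure.prod_prod,
    Measure.infinitePi_pi (μ := fun _ : ℕ => D) (fun i _ => hmeas i), Finset.prod_image]
  · have : ∏ i ∈ s.erase 0, D (t (Nat.pred i + 1)) = ∏ i ∈ s.erase 0, D (t i) :=
      Finset.prod_congr rfl fun i hi => by
        rw [Nat.pred_eq_sub_one,
          Nat.sub_add_cancel (Nat.pos_of_ne_zero (Finset.ne_of_mem_erase hi))]
    rw [this]
    split_ifs with h0
    · exact Finset.mul_prod_erase s (fun i => D (t i)) h0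
    · rw [measure_univ, one_mul, Finset.erase_eq_of_notMem h0]
  · intro i hi j hj hij
    have hi0 := Finset.ne_of_mem_erase hi
    have hj0 := Finset.ne_of_mem_erase hj
    simp only [Nat.pred_eq_sub_one] at hij
    omega

theorem lintegral_streamLaw {f : (ℕ → E) → ℝ≥0∞} (hf : Measurable f) :
    ∫⁻ ω, f ω ∂(streamLaw D) = ∫⁻ x, ∫⁻ ω, f (consStream x ω) ∂(streamLaw D) ∂D := by
  conv_lhs => rw [← map_consStream D]
  rw [lintegral_map hf measurable_consStream, lintegral_prod]
  exact (hf.comp measurable_consStream).aemeasurable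

/-! ### Rejection sampling -/

open Classical in
/-- The first time at which the stream visits `A` (and `0` if it never does). -/
def hitTime (A : Set E) (ω : ℕ → E) : ℕ :=
  Nat.find (p := fun t => ω t ∈ A ∨ ∀ s, ω s ∉ A) <| by
    by_cases h : ∃ t, ω t ∈ A
    · exact ⟨h.choose, Or.inl h.choose_spec⟩
    · exact ⟨0, Or.inr (not_exists.1 h)⟩

omit [MeasurableSpace E] in
theorem hitTime_mem {A : Set E} {ω : ℕ → E} (h : ∃ t, ω t ∈ A) : ω (hitTime A ω) ∈ A := by
  classical
  obtain ⟨t, ht⟩ := h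
  have := Nat.find_spec (p := fun t => ω t ∈ A ∨ ∀ s, ω s ∉ A) ⟨t, Or.inl ht⟩
  exact this.resolve_right fun h => h t ht

omit [MeasurableSpace E] in
theorem notMem_of_lt_hitTime {A : Set E} {ω : ℕ → E} {t : ℕ} (h : t < hitTime A ω) : ω t ∉ A := by
  classical
  exact fun ht => Nat.find_min _ h (Or.inl ht)

omit [MeasurableSpace E] in
theorem hitTime_eq {A : Set E} {ω : ℕ → E} {t : ℕ} (h : ω t ∈ A) (h' : ∀ s < t, ω s ∉ A) :
    hitTime A ω = t := by
  rcases lt_trichotomy (hitTime A ω) t with hlt | heq | hgt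
  · exact absurd (hitTime_mem ⟨t, h⟩) (h' _ hlt)
  · exact heq
  · exact absurd h (notMem_of_lt_hitTime hgt)

/-- The streams that do not visit `A` before time `t`. -/
def avoid (A : Set E) (t : ℕ) : Set (ℕ → E) := {ω | ∀ s < t, ω s ∉ A}

/-- The number of entries that are read until the first visit to `A`, as a sum of indicators. -/
def drawCount (A : Set E) (ω : ℕ → E) : ℝ≥0∞ :=
  ∑' t, (avoid A t).indicator 1 ω

omit [MeasurableSpace E] in
-- A stream that never meets `A` avoids it up to every time, so all indicators are `1` and the count
-- is infinite. Finite cost thus certifies that rejection sampling terminates.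
theorem hit_of_drawCount_lt_top {A : Set E} {ω : ℕ → E} (h : drawCount A ω < ∞) :
    ∃ t, ω t ∈ A := by
  by_contra hne
  push Not at hne
  refine h.ne ?_
  have : ∀ t, (avoid A t).indicator (1 : (ℕ → E) → ℝ≥0∞) ω = 1 := fun t =>
    Set.indicator_of_mem (show ω ∈ avoid A t from fun s _ => hne s) _
  simp [drawCount, this]

omit [MeasurableSpace E] in
theorem hitTime_add_one_le_drawCount (A : Set E) (ω : ℕ → E) :
    ((hitTime A ω + 1 : ℕ) : ℝ≥0∞) ≤ drawCount A ω := by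
  refine le_trans ?_ (ENNReal.sum_le_tsum (f := fun t => (avoid A t).indicator 1 ω)
    (Finset.range (hitTime A ω + 1)))
  rw [Finset.sum_congr rfl (g := fun _ => 1)]
  · simp
  · intro t ht
    refine Set.indicator_of_mem (show ω ∈ avoid A t from fun s hs => ?_) _
    exact notMem_of_lt_hitTime (lt_of_lt_of_le hs (Nat.le_of_lt_succ (Finset.mem_range.1 ht)))

/-- The first entry in `A`, and what follows it. -/
def fetchOne (A : Set E) (ω : ℕ → E) : E × (ℕ → E) :=
  (ω (hitTime A ω), dropStream (hitTime A ω + 1) ω)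

/-- The first `k` entries in `A`, and what follows them. -/
def fetch (A : Set E) : (k : ℕ) → (ℕ → E) → (Fin k → E) × (ℕ → E)
  | 0, ω => (Fin.elim0, ω)
  | k + 1, ω =>
    (Fin.cons (fetchOne A ω).1 (fetch A k (fetchOne A ω).2).1, (fetch A k (fetchOne A ω).2).2)

/-- The number of entries that are read until the `k`-th visit to `A`. -/
def fetchCost (A : Set E) : ℕ → (ℕ → E) → ℝ≥0∞
  | 0, _ => 0
  | k + 1, ω => drawCount A ω + fetchCost A k (fetchOne A ω).2

/-! ### Joint measurability of hitting times and fetched samples in a parameter and the stream. -/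

section Measurability

variable {Θ : Type} [MeasurableSpace Θ] {A : Θ → Set E}

theorem measurableSet_entry (hA : MeasurableSet {p : Θ × E | p.2 ∈ A p.1}) (t : ℕ) :
    MeasurableSet {p : Θ × (ℕ → E) | p.2 t ∈ A p.1} := by
  have hm : Measurable fun p : Θ × (ℕ → E) => (p.1, p.2 t) :=
    measurable_fst.prodMk ((measurable_pi_apply t).comp measurable_snd)
  exact hm hA

theorem measurable_hitTime (hA : MeasurableSet {p : Θ × E | p.2 ∈ A p.1}) :
    Measurable fun p : Θ × (ℕ → E) => hitTime (A p.1) p.2 := by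
  classical
  refine measurable_find (p := fun (p : Θ × (ℕ → E)) t => p.2 t ∈ A p.1 ∨ ∀ s, p.2 s ∉ A p.1) _
    fun k => ?_
  refine (measurableSet_entry hA k).union ?_
  have : {p : Θ × (ℕ → E) | ∀ s, p.2 s ∉ A p.1} = ⋂ s, {p : Θ × (ℕ → E) | p.2 s ∈ A p.1}ᶜ := by
    ext; simp
  change MeasurableSet {p : Θ × (ℕ → E) | ∀ s, p.2 s ∉ A p.1}
  rw [this]
  exact MeasurableSet.iInter fun s => (measurableSet_entry hA s).compl

theorem measurable_drawCount (hA : MeasurableSet {p : Θ × E | p.2 ∈ A p.1}) :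
    Measurable fun p : Θ × (ℕ → E) => drawCount (A p.1) p.2 := by
  unfold drawCount
  refine Measurable.tsum fun t => ?_
  have h : MeasurableSet {p : Θ × (ℕ → E) | ∀ s < t, p.2 s ∉ A p.1} := by
    have : {p : Θ × (ℕ → E) | ∀ s < t, p.2 s ∉ A p.1}
        = ⋂ s, ⋂ _ : s < t, {p : Θ × (ℕ → E) | p.2 s ∈ A p.1}ᶜ := by
      ext; simp
    rw [this]
    exact MeasurableSet.iInter fun s =>
      MeasurableSet.iInter fun _ => (measurableSet_entry hA s).compl
  exact (measurable_const (a := (1 : ℝ≥0∞))).indicator h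

theorem measurable_fetchOne (hA : MeasurableSet {p : Θ × E | p.2 ∈ A p.1}) :
    Measurable fun p : Θ × (ℕ → E) => fetchOne (A p.1) p.2 := by
  have h1 : Measurable fun q : (ℕ → E) × ℕ => q.1 q.2 :=
    measurable_from_prod_countable_left fun t => measurable_pi_apply t
  have h2 : Measurable fun q : (ℕ → E) × ℕ => dropStream (q.2 + 1) q.1 :=
    measurable_from_prod_countable_left fun t => measurable_dropStream (t + 1)
  have h3 : Measurable fun p : Θ × (ℕ → E) => (p.2, hitTime (A p.1) p.2) :=
    measurable_snd.prodMk (measurable_hitTime hA)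
  exact (h1.comp h3).prodMk (h2.comp h3)

theorem measurable_finCons (k : ℕ) :
    Measurable fun p : E × (Fin k → E) => (Fin.cons p.1 p.2 : Fin (k + 1) → E) := by
  rw [measurable_pi_iff]
  intro i
  refine Fin.cases ?_ (fun i => ?_) i
  · simpa using measurable_fst
  · simp only [Fin.cons_succ]
    fun_prop

theorem measurable_fetch (hA : MeasurableSet {p : Θ × E | p.2 ∈ A p.1}) (k : ℕ) :
    Measurable fun p : Θ × (ℕ → E) => fetch (A p.1) k p.2 := by
  induction k with
  | zero => exact measurable_const.prodMk measurable_snd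
  | succ k ih =>
    have h1 := measurable_fetchOne hA
    have h2 : Measurable fun p : Θ × (ℕ → E) => (p.1, (fetchOne (A p.1) p.2).2) :=
      measurable_fst.prodMk h1.snd
    have h3 := ih.comp h2
    exact ((measurable_finCons k).comp (h1.fst.prodMk h3.fst)).prodMk h3.snd

theorem measurable_fetchCost (hA : MeasurableSet {p : Θ × E | p.2 ∈ A p.1}) (k : ℕ) :
    Measurable fun p : Θ × (ℕ → E) => fetchCost (A p.1) k p.2 := by
  induction k with
  | zero => exact measurable_const
  | succ k ih =>
    have h2 : Measurable fun p : Θ × (ℕ → E) => (p.1, (fetchOne (A p.1) p.2).2) :=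
      measurable_fst.prodMk (measurable_fetchOne hA).snd
    exact (measurable_drawCount hA).add (ih.comp h2)

end Measurability

/-! ### Law and expected cost of the samples obtained by rejection. -/

section Law

variable {A : Set E}

theorem measurableSet_uncurry_const (hA : MeasurableSet A) :
    MeasurableSet {p : Unit × E | p.2 ∈ A} := measurable_snd hA

theorem measurable_fetchOne_const (hA : MeasurableSet A) : Measurable (fetchOne A) :=
  (measurable_fetchOne (A := fun _ : Unit => A) (measurableSet_uncurry_const hA)).comp
    (measurable_const (a := ()) |>.prodMk measurable_id)

theorem measurable_fetch_const (hA : MeasurableSet A) (k : ℕ) : Measurable (fetch A k) :=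
  (measurable_fetch (A := fun _ : Unit => A) (measurableSet_uncurry_const hA) k).comp
    (measurable_const (a := ()) |>.prodMk measurable_id)

theorem measurable_fetchCost_const (hA : MeasurableSet A) (k : ℕ) : Measurable (fetchCost A k) :=
  (measurable_fetchCost (A := fun _ : Unit => A) (measurableSet_uncurry_const hA) k).comp
    (measurable_const (a := ()) |>.prodMk measurable_id)

theorem measurableSet_avoid (hA : MeasurableSet A) (t : ℕ) : MeasurableSet (avoid A t) := by
  have : avoid A t = ⋂ s, ⋂ _ : s < t, (fun ω : ℕ → E => ω s) ⁻¹' Aᶜ := by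
    ext; simp [avoid]
  rw [this]
  exact MeasurableSet.iInter fun s => MeasurableSet.iInter fun _ => measurable_pi_apply s hA.compl

/-- One entry is read at a time: it must lie outside `A`, which costs a factor `D Aᶜ`, and what
follows is again a fresh stream. -/
theorem lintegral_avoid (hA : MeasurableSet A) (t : ℕ) {f : (ℕ → E) → ℝ≥0∞} (hf : Measurable f) :
    ∫⁻ ω, (avoid A t).indicator (fun ω => f (dropStream t ω)) ω ∂(streamLaw D)
      = D Aᶜ ^ t * ∫⁻ ω, f ω ∂(streamLaw D) := by
  induction t with
  | zero => simp [avoid, Set.indicator]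
  | succ t ih =>
    have hm : Measurable ((avoid A (t + 1)).indicator
        (fun ω => f (dropStream (t + 1) ω))) :=
      (hf.comp (measurable_dropStream _)).indicator (measurableSet_avoid hA _)
    rw [lintegral_streamLaw D hm]
    have hstep : ∀ x, ∫⁻ ω, (avoid A (t + 1)).indicator
          (fun ω => f (dropStream (t + 1) ω)) (consStream x ω) ∂(streamLaw D)
        = Aᶜ.indicator (fun _ => D Aᶜ ^ t * ∫⁻ ω, f ω ∂(streamLaw D)) x := by
      intro x
      by_cases hx : x ∈ A
      · rw [Set.indicator_of_notMem (by simpa using hx)]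
        refine (lintegral_congr fun ω => Set.indicator_of_notMem (fun h => ?_) _).trans
          lintegral_zero
        exact h 0 (Nat.succ_pos t) hx
      · rw [Set.indicator_of_mem (by simpa using hx), ← ih]
        refine lintegral_congr fun ω => ?_
        simp only [Set.indicator, dropStream_succ_consStream]
        congr 1
        refine propext ⟨fun h s hs => h (s + 1) (Nat.succ_lt_succ hs), ?_⟩
        rintro h (_ | s) hs
        · exact hx
        · exact h s (Nat.lt_of_succ_lt_succ hs)
    simp only [hstep]
    rw [lintegral_indicator hA.compl, setLIntegral_const]
    ring

theorem tsum_compl_pow (hA : MeasurableSet A) : ∑' t, D Aᶜ ^ t = (D A)⁻¹ := by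
  rw [ENNReal.tsum_geometric]
  congr 1
  rw [prob_compl_eq_one_sub hA, ENNReal.sub_sub_cancel ENNReal.one_ne_top prob_le_one]

theorem lintegral_drawCount (hA : MeasurableSet A) :
    ∫⁻ ω, drawCount A ω ∂(streamLaw D) = (D A)⁻¹ := by
  unfold drawCount
  rw [lintegral_tsum fun t => (measurable_one.indicator (measurableSet_avoid hA t)).aemeasurable,
    ← tsum_compl_pow D hA]
  refine tsum_congr fun t => ?_
  have := lintegral_avoid D hA t (f := fun _ => 1) measurable_const
  rwa [lintegral_const, measure_univ, mul_one, mul_one] at this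

theorem ae_hit (hA : MeasurableSet A) (h0 : D A ≠ 0) : ∀ᵐ ω ∂(streamLaw D), ∃ t, ω t ∈ A := by
  have hm : Measurable (drawCount A) :=
    (measurable_drawCount (A := fun _ : Unit => A) (measurableSet_uncurry_const hA)).comp
      (measurable_const (a := ()) |>.prodMk measurable_id)
  have := ae_lt_top hm (μ := streamLaw D) (by rw [lintegral_drawCount D hA]; simpa using h0)
  filter_upwards [this] with ω h using hit_of_drawCount_lt_top h

/-- A strong Markov property. A first visit at time `t` contributes `D Aᶜ ^ t` times the integral
over `A` with a fresh remainder, and the geometric series adds up to `(D A)⁻¹`, the normalization of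
the conditional law. -/
theorem lintegral_fetchOne (hA : MeasurableSet A) (h0 : D A ≠ 0) {f : E × (ℕ → E) → ℝ≥0∞}
    (hf : Measurable f) :
    ∫⁻ ω, f (fetchOne A ω) ∂(streamLaw D)
      = ∫⁻ x, ∫⁻ ω, f (x, ω) ∂(streamLaw D) ∂(ProbabilityTheory.cond D A) := by
  -- `g` is the contribution of a visit at time `0`; a first visit at time `t` is avoidance up to
  -- `t` followed by `g` of the shifted stream.
  let g : (ℕ → E) → ℝ≥0∞ := fun ω => ({ω : ℕ → E | ω 0 ∈ A}).indicator
    (fun ω => f (ω 0, dropStream 1 ω)) ω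
  have hfm : Measurable fun ω : ℕ → E => f (ω 0, dropStream 1 ω) :=
    hf.comp ((measurable_pi_apply 0).prodMk (measurable_dropStream 1))
  have hg : Measurable g := hfm.indicator (measurable_pi_apply 0 hA)
  have hsplit : ∀ᵐ ω ∂(streamLaw D), f (fetchOne A ω)
      = ∑' t, (avoid A t).indicator (fun ω => g (dropStream t ω)) ω := by
    filter_upwards [ae_hit D hA h0] with ω h
    rw [tsum_eq_single (hitTime A ω)]
    · rw [Set.indicator_of_mem
        (show ω ∈ avoid A (hitTime A ω) from fun s => notMem_of_lt_hitTime)]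
      simp only [g]
      rw [Set.indicator_of_mem
        (show dropStream (hitTime A ω) ω ∈ {ω : ℕ → E | ω 0 ∈ A} from hitTime_mem h)]
      simp only [fetchOne, dropStream_dropStream]
      rfl
    · intro t ht
      by_cases h1 : ∀ s < t, ω s ∉ A
      · rw [Set.indicator_of_mem (show ω ∈ avoid A t from h1)]
        refine Set.indicator_of_notMem
          (show dropStream t ω ∉ {ω : ℕ → E | ω 0 ∈ A} from fun h2 => ht ?_) _
        exact (hitTime_eq (A := A) (ω := ω) h2 h1).symm
      · exact Set.indicator_of_notMem (show ω ∉ avoid A t from h1) _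
  have hgint : ∫⁻ ω, g ω ∂(streamLaw D) = ∫⁻ x in A, ∫⁻ ω, f (x, ω) ∂(streamLaw D) ∂D := by
    rw [lintegral_streamLaw D hg, ← lintegral_indicator hA]
    refine lintegral_congr fun x => ?_
    by_cases hx : x ∈ A
    · rw [Set.indicator_of_mem hx]
      refine lintegral_congr fun ω => ?_
      simp only [g]
      rw [Set.indicator_of_mem (show consStream x ω ∈ {ω : ℕ → E | ω 0 ∈ A} from hx),
        dropStream_succ_consStream]
      simp
    · rw [Set.indicator_of_notMem hx]
      refine (lintegral_congr fun ω => ?_).trans lintegral_zero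
      exact Set.indicator_of_notMem
        (show consStream x ω ∉ {ω : ℕ → E | ω 0 ∈ A} from fun h => hx h) _
  have hgm : ∀ t, Measurable ((avoid A t).indicator fun ω => g (dropStream t ω)) := fun t =>
    (hg.comp (measurable_dropStream t)).indicator (measurableSet_avoid hA t)
  rw [lintegral_congr_ae hsplit, lintegral_tsum fun t => (hgm t).aemeasurable]
  simp only [lintegral_avoid D hA _ hg]
  rw [ENNReal.tsum_mul_right, tsum_compl_pow D hA, hgint, ProbabilityTheory.cond,
    lintegral_smul_measure, smul_eq_mul]

/-- Integration over `k + 1` independent examples, one by one. -/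
theorem lintegral_pi_cons (Q : Measure E) [IsProbabilityMeasure Q] (k : ℕ)
    {f : (Fin (k + 1) → E) → ℝ≥0∞} (hf : Measurable f) :
    ∫⁻ e, f e ∂(Measure.pi fun _ => Q)
      = ∫⁻ x, ∫⁻ e, f (Fin.cons x e) ∂(Measure.pi fun _ => Q) ∂Q := by
  have h := (measurePreserving_piFinSuccAbove (fun _ : Fin (k + 1) => Q) 0).symm
  rw [← h.lintegral_comp hf, lintegral_prod]
  · refine lintegral_congr fun x => lintegral_congr fun e => congrArg f ?_
    exact Fin.insertNth_zero' x e
  · exact (hf.comp h.measurable).aemeasurable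

/-- Iterates the strong Markov property. Both halves matter: the accepted examples are independent
with the conditional law, and the unread stream is fresh, so that later rounds can be analysed in
the same way. -/
theorem lintegral_fetch (hA : MeasurableSet A) (h0 : D A ≠ 0) (k : ℕ)
    {f : (Fin k → E) × (ℕ → E) → ℝ≥0∞} (hf : Measurable f) :
    ∫⁻ ω, f (fetch A k ω) ∂(streamLaw D)
      = ∫⁻ e, ∫⁻ ω, f (e, ω) ∂(streamLaw D)
          ∂(Measure.pi fun _ => ProbabilityTheory.cond D A) := by
  have := ProbabilityTheory.cond_isProbabilityMeasure h0
  induction k with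
  | zero =>
    rw [Measure.pi_of_empty (fun _ : Fin 0 => ProbabilityTheory.cond D A) Fin.elim0,
      lintegral_dirac' _ hf.lintegral_prod_right']
    rfl
  | succ k ih =>
    have hc : Measurable fun p : E × (Fin k → E) × (ℕ → E) =>
        f ((Fin.cons p.1 p.2.1 : Fin (k + 1) → E), p.2.2) :=
      hf.comp (((measurable_finCons k).comp
        (measurable_fst.prodMk measurable_snd.fst)).prodMk measurable_snd.snd)
    have hc' : ∀ x : E, Measurable fun p : (Fin k → E) × (ℕ → E) =>
        f ((Fin.cons x p.1 : Fin (k + 1) → E), p.2) :=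
      fun x => hc.comp (measurable_const.prodMk measurable_id)
    have hF : Measurable fun p : E × (ℕ → E) =>
        f ((Fin.cons p.1 (fetch A k p.2).1 : Fin (k + 1) → E), (fetch A k p.2).2) :=
      hc.comp (measurable_fst.prodMk ((measurable_fetch_const hA k).comp measurable_snd))
    rw [lintegral_pi_cons _ _ hf.lintegral_prod_right']
    refine (lintegral_fetchOne D hA h0 hF).trans (lintegral_congr fun x => ?_)
    exact ih (hc' x)

theorem lintegral_fetchCost (hA : MeasurableSet A) (h0 : D A ≠ 0) (k : ℕ) :
    ∫⁻ ω, fetchCost A k ω ∂(streamLaw D) = k * (D A)⁻¹ := by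
  have := ProbabilityTheory.cond_isProbabilityMeasure h0
  induction k with
  | zero => simp [fetchCost]
  | succ k ih =>
    have hm := measurable_fetchCost_const hA k
    have h1 := lintegral_fetchOne D hA h0 (f := fun p => fetchCost A k p.2)
      (hm.comp measurable_snd)
    simp only [lintegral_const, measure_univ, mul_one] at h1
    have hm2 : Measurable fun ω => fetchCost A k (fetchOne A ω).2 :=
      hm.comp (measurable_fetchOne_const hA).snd
    simp only [fetchCost]
    rw [lintegral_add_right _ hm2, h1, ih, lintegral_drawCount D hA, Nat.cast_succ]
    ring

end Law

end Stream

/-! ### Semantics of programs -/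

section Semantics

variable {d : ℕ} {α β σ : Type}

/-- Whenever the rest of the stream is `ω`, the program `p` returns `a`, draws exactly `j` examples
and makes at most `K` steps. -/
def Yields (p : Comp d α) (ω : ℕ → Example d) (a : α) (j K : ℕ) : Prop :=
  ∀ (ω₀ : ℕ → Example d) (s t : ℕ), dropStream s ω₀ = ω →
    ∃ t' ≤ t + K, p ω₀ ⟨s, t⟩ = some (a, ⟨s + j, t'⟩)

/-- The program `p` returns `a` in at most `K` steps without drawing examples. -/
def Pays (p : Comp d α) (a : α) (K : ℕ) : Prop := ∀ ω, Yields p ω a 0 K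

theorem bind_apply (p : Comp d α) (q : α → Comp d β) (ω : ℕ → Example d) (u : Usage) :
    (p >>= q) ω u = (p ω u).bind fun r => q r.1 ω r.2 := rfl

theorem Yields.mono {p : Comp d α} {ω : ℕ → Example d} {a : α} {j K K' : ℕ}
    (h : Yields p ω a j K) (hK : K ≤ K') : Yields p ω a j K' := fun ω₀ s t hs => by
  obtain ⟨t', ht, e⟩ := h ω₀ s t hs
  exact ⟨t', by omega, e⟩

theorem Yields.bind {p : Comp d α} {q : α → Comp d β} {ω : ℕ → Example d} {a : α} {b : β}
    {j j' K K' : ℕ} (hp : Yields p ω a j K) (hq : Yields (q a) (dropStream j ω) b j' K') :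
    Yields (p >>= q) ω b (j + j') (K + K') := fun ω₀ s t hs => by
  obtain ⟨t₁, ht₁, e₁⟩ := hp ω₀ s t hs
  obtain ⟨t₂, ht₂, e₂⟩ := hq ω₀ (s + j) t₁ (by rw [← hs, dropStream_dropStream])
  refine ⟨t₂, by omega, ?_⟩
  rw [bind_apply, e₁, Option.bind_some, e₂, Nat.add_assoc]

theorem Pays.mono {p : Comp d α} {a : α} {K K' : ℕ} (h : Pays p a K) (hK : K ≤ K') :
    Pays p a K' := fun ω => (h ω).mono hK

theorem Pays.bind {p : Comp d α} {q : α → Comp d β} {a : α} {b : β} {K K' : ℕ}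
    (hp : Pays p a K) (hq : Pays (q a) b K') : Pays (p >>= q) b (K + K') :=
  fun ω => (hp ω).bind (hq _)

theorem Pays.bind_yields {p : Comp d α} {q : α → Comp d β} {ω : ℕ → Example d} {a : α} {b : β}
    {j K K' : ℕ} (hp : Pays p a K) (hq : Yields (q a) ω b j K') :
    Yields (p >>= q) ω b j (K + K') := by
  have := (hp ω).bind (q := q) (b := b) (j' := j) (K' := K') (by rwa [dropStream_zero])
  rwa [Nat.zero_add] at this

theorem Yields.bind_pays {p : Comp d α} {q : α → Comp d β} {ω : ℕ → Example d} {a : α} {b : β}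
    {j K K' : ℕ} (hp : Yields p ω a j K) (hq : Pays (q a) b K') :
    Yields (p >>= q) ω b j (K + K') := hp.bind (hq _)

theorem pays_pure (a : α) : Pays (d := d) (pure a) a 0 := fun _ _ _ t _ => ⟨t, le_rfl, rfl⟩

theorem pays_tick (k : ℕ) : Pays (d := d) (tick k) () k := fun _ _ _ t _ => ⟨t + k, le_rfl, rfl⟩

theorem pays_step (a : α) : Pays (d := d) (step a) a 1 :=
  (pays_tick 1).bind (q := fun _ => pure a) (pays_pure a)

theorem yields_draw (ω : ℕ → Example d) : Yields draw ω (ω 0) 1 (d + 1) :=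
  fun ω₀ s t hs => ⟨t + (d + 1), le_rfl, by subst hs; rfl⟩

theorem pays_foldlM {f : σ → β → Comp d σ} {g : σ → β → σ} {K : ℕ} (l : List β)
    (h : ∀ s, ∀ b ∈ l, Pays (f s b) (g s b) K) (s : σ) :
    Pays (l.foldlM f s) (l.foldl g s) (l.length * K) := by
  induction l generalizing s with
  | nil => exact (pays_pure s).mono (by simp)
  | cons b l ih =>
    rw [List.foldlM_cons, List.foldl_cons]
    exact ((h s b (by simp)).bind (ih (fun s b hb => h s b (by simp [hb])) _)).mono
      (by rw [List.length_cons]; ring_nf; rfl)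

theorem yields_loop_exit {body : σ → Comp d (σ ⊕ α)} {s : σ} {ω : ℕ → Example d} {a : α} {j K : ℕ}
    (h : Yields (body s) ω (Sum.inr a) j K) : Yields (Comp.loop body s) ω a j K := by
  rw [Comp.loop_eq]
  refine Yields.bind_pays (K' := 0) h ?_
  exact pays_pure a

theorem yields_loop_next {body : σ → Comp d (σ ⊕ α)} {s s' : σ} {ω : ℕ → Example d} {a : α}
    {j j' K K' : ℕ} (h : Yields (body s) ω (Sum.inl s') j K)
    (h' : Yields (Comp.loop body s') (dropStream j ω) a j' K') :
    Yields (Comp.loop body s) ω a (j + j') (K + K') := by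
  rw [Comp.loop_eq]
  exact h.bind h'

/-! ### Vector operations -/

theorem inner_eq_sum (w x : Vec d) : inner ℝ w x = ∑ i, w i * x i := by
  rw [PiLp.inner_apply]
  exact Finset.sum_congr rfl fun i _ => by simp [mul_comm]

theorem foldl_add_eq_sum (f : Fin d → ℝ) (s : ℝ) :
    (List.finRange d).foldl (fun s i => s + f i) s = s + ∑ i, f i := by
  have : ∀ (l : List (Fin d)) (s : ℝ), l.foldl (fun s i => s + f i) s = s + (l.map f).sum := by
    intro l
    induction l with
    | nil => simp
    | cons i l ih => intro s; simp [ih, add_assoc]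
  rw [this, ← List.ofFn_eq_map, List.sum_ofFn]

theorem pays_dot (w x : Vec d) : Pays (dot w x) (inner ℝ w x) (2 * d) := by
  have h : Pays (dot w x) ((List.finRange d).foldl (fun s i => s + w i * x i) 0) _ :=
    pays_foldlM (List.finRange d) (K := 2) (fun s i _ => (pays_step _).bind (pays_step _)) 0
  rw [foldl_add_eq_sum (fun i => w i * x i), zero_add, ← inner_eq_sum, List.length_finRange] at h
  exact h.mono (by omega)

theorem foldl_update_eq (a : Fin d → ℝ) (v : Vec d) :
    (List.finRange d).foldl (fun v i => WithLp.toLp 2 (Function.update v.ofLp i (a i))) v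
      = WithLp.toLp 2 a := by
  have : ∀ (l : List (Fin d)) (v : Vec d) (i : Fin d),
      l.foldl (fun v i => WithLp.toLp 2 (Function.update v.ofLp i (a i))) v i
        = if i ∈ l then a i else v i := by
    intro l
    induction l with
    | nil => simp
    | cons k l ih =>
      intro v i
      rw [List.foldl_cons, ih]
      by_cases hi : i ∈ l
      · simp [hi]
      · by_cases hk : i = k
        · subst hk; simp
        · simp [hi, hk]
  ext i
  rw [this]
  simp

theorem pays_build {f : Fin d → Comp d ℝ} {a : Fin d → ℝ} {K : ℕ} (h : ∀ i, Pays (f i) (a i) K) :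
    Pays (build f) (WithLp.toLp 2 a) (d * (K + 1)) := by
  have := pays_foldlM (List.finRange d) (K := K + 1)
    (f := fun (v : Vec d) i => do
      let a ← f i
      step (WithLp.toLp 2 (Function.update v.ofLp i a)))
    (g := fun v i => WithLp.toLp 2 (Function.update v.ofLp i (a i)))
    (fun v i _ => (h i).bind (pays_step _)) (0 : Vec d)
  rw [foldl_update_eq, List.length_finRange] at this
  exact this

theorem pays_addScaled (w : Vec d) (a : ℝ) (x : Vec d) :
    Pays (addScaled w a x) (w + a • x) (d * 3) :=
  pays_build (a := fun i => w i + a * x i) fun _ => (pays_step _).bind (pays_step _)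

theorem pays_norm2 (w : Vec d) : Pays (norm2 w) ‖w‖ (2 * d + 1) := by
  have : ‖w‖ = √(inner ℝ w w) := by
    rw [real_inner_self_eq_norm_sq, Real.sqrt_sq (norm_nonneg w)]
  rw [this]
  exact (pays_dot w w).bind (pays_step _)

/-- `w / ‖w‖`, which is `0` for `w = 0`. -/
def normalized (w : Vec d) : Vec d := ‖w‖⁻¹ • w

/-- The nearest point of the unit ball. -/
def ballProj (w : Vec d) : Vec d := if ‖w‖ ≤ 1 then w else ‖w‖⁻¹ • w

theorem pays_build_div (w : Vec d) (r : ℝ) :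
    Pays (build fun i => step (w i / r)) (r⁻¹ • w) (d * 2) := by
  have h := pays_build (d := d) (K := 1) (a := fun i => w i / r) fun i => pays_step (w i / r)
  convert h using 1
  ext i
  simp [div_eq_inv_mul]

theorem pays_normalize (w : Vec d) : Pays (normalize w) (normalized w) (4 * d + 2) := by
  have h : Pays (if decide (0 < ‖w‖) = true then build fun i => step (w i / ‖w‖) else pure w)
      (normalized w) (d * 2) := by
    by_cases h0 : 0 < ‖w‖
    · rw [if_pos (by simpa using h0)]
      exact pays_build_div w ‖w‖
    · rw [if_neg (by simpa using h0)]
      have : w = 0 := by simpa using h0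
      subst this
      have h1 : normalized (0 : Vec d) = 0 := smul_zero _
      rw [h1]
      exact (pays_pure _).mono (Nat.zero_le _)
  exact ((pays_norm2 w).bind ((pays_step _).bind h)).mono (by omega)

theorem pays_project (w : Vec d) : Pays (project w) (ballProj w) (4 * d + 2) := by
  have h : Pays (if decide (‖w‖ ≤ 1) = true then pure w else build fun i => step (w i / ‖w‖))
      (ballProj w) (d * 2) := by
    unfold ballProj
    by_cases h0 : ‖w‖ ≤ 1
    · rw [if_pos (by simpa using h0), if_pos h0]
      exact (pays_pure _).mono (Nat.zero_le _)
    · rw [if_neg (by simpa using h0), if_neg h0]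
      exact pays_build_div w ‖w‖
  exact ((pays_norm2 w).bind ((pays_step _).bind h)).mono (by omega)

/-! ### Rejection sampling by programs -/

/-- `x` is classified by some rule of the list. -/
def Covered (L : DecisionList d) (x : Vec d) : Prop := ∃ r ∈ L, r.2 ≤ |inner ℝ r.1 x|

/-- The examples in the unclassified region. -/
def unclassified (L : DecisionList d) : Set (Example d) := {e | ¬ Covered L e.1}

open Classical in
theorem pays_isCovered (L : DecisionList d) (x : Vec d) :
    Pays (isCovered L x) (decide (Covered L x)) (L.length * (2 * d + 2) + 1) := by
  induction L with
  | nil =>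
    have : decide (Covered ([] : DecisionList d) x) = false := by simp [Covered]
    rw [this]
    exact (pays_step false).mono (by simp)
  | cons r L ih =>
    obtain ⟨w, T⟩ := r
    have h : Pays (if decide (T ≤ |inner ℝ w x|) = true then pure true else isCovered L x)
        (decide (Covered ((w, T) :: L) x)) (L.length * (2 * d + 2) + 1) := by
      by_cases h0 : T ≤ |inner ℝ w x|
      · have : decide (Covered ((w, T) :: L) x) = true :=
          decide_eq_true ⟨(w, T), by simp, h0⟩
        rw [this, if_pos (by simpa using h0)]
        exact (pays_pure _).mono (Nat.zero_le _)
      · have : Covered ((w, T) :: L) x ↔ Covered L x := by simp [Covered, h0]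
        simp only [this]
        rw [if_neg (by simpa using h0)]
        exact ih
    exact ((pays_dot w x).bind ((pays_step _).bind ((pays_step _).bind h))).mono
      (by rw [List.length_cons]; ring_nf; omega)

/-- The number of steps for one round of rejection sampling. -/
def drawSteps (d l : ℕ) : ℕ := d + 1 + (l * (2 * d + 2) + 1)

theorem yields_drawUnclassified (L : DecisionList d) (ω : ℕ → Example d)
    (h : ∃ t, ω t ∈ unclassified L) :
    Yields (drawUnclassified L) ω (fetchOne (unclassified L) ω).1
      (hitTime (unclassified L) ω + 1)
      ((hitTime (unclassified L) ω + 1) * drawSteps d L.length) := by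
  classical
  have hbody : ∀ ω' : ℕ → Example d, Yields (do
      let e ← draw
      let b ← isCovered L e.1
      pure (if b then Sum.inl () else Sum.inr e)) ω'
      (if decide (Covered L (ω' 0).1) = true then Sum.inl () else Sum.inr (ω' 0)) 1
      (drawSteps d L.length) := fun ω' =>
    (yields_draw ω').bind_pays ((pays_isCovered L _).bind
      (q := fun b => pure (if b = true then Sum.inl () else Sum.inr (ω' 0))) (pays_pure _))
  -- Induction on the time of the first visit: a rejected example is one round of the loop, after
  -- which the shifted stream has its visit one step earlier.
  have key : ∀ (t : ℕ) (ω' : ℕ → Example d), ω' t ∈ unclassified L →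
      (∀ s < t, ω' s ∉ unclassified L) →
      Yields (drawUnclassified L) ω' (ω' t) (t + 1) ((t + 1) * drawSteps d L.length) := by
    intro t
    induction t with
    | zero =>
      intro ω' h0 _
      have hb := hbody ω'
      rw [if_neg (by simpa [unclassified] using h0)] at hb
      exact (yields_loop_exit hb).mono (by omega)
    | succ t ih =>
      intro ω' h0 h1
      have hb := hbody ω'
      have hc : Covered L (ω' 0).1 := not_not.1 (h1 0 (Nat.succ_pos t))
      rw [if_pos (by simpa using hc)] at hb
      have hrec := ih (dropStream 1 ω') (by rwa [dropStream, Nat.add_comm 1 t]) (fun s hs => by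
        have := h1 (s + 1) (by omega)
        rwa [dropStream, Nat.add_comm 1 s])
      have := yields_loop_next (s := ()) hb hrec
      rw [Nat.add_comm 1 (t + 1), dropStream, Nat.add_comm 1 t] at this
      exact this.mono (by ring_nf; rfl)
  exact key _ ω (hitTime_mem h) fun s hs => notMem_of_lt_hitTime hs

/-- The fold of `g` over the entries of `e`. -/
def foldFin {E : Type} (g : σ → E → σ) : (k : ℕ) → σ → (Fin k → E) → σ
  | 0, s, _ => s
  | k + 1, s, e => foldFin g k (g s (e 0)) fun i => e i.succ

/-- Folds over freshly drawn examples from `A`. -/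
theorem yields_foldlM_draw {A : Set (Example d)} {dr : Comp d (Example d)} {c K : ℕ}
    (hdr : ∀ ω : ℕ → Example d, (∃ t, ω t ∈ A) →
      Yields dr ω (fetchOne A ω).1 (hitTime A ω + 1) ((hitTime A ω + 1) * c))
    {h : σ → Example d → Comp d σ} {g : σ → Example d → σ} (hg : ∀ s e, Pays (h s e) (g s e) K)
    (l : List β) (s : σ) (ω : ℕ → Example d) (hω : fetchCost A l.length ω < ∞) :
    ∃ j : ℕ, (j : ℝ≥0∞) ≤ fetchCost A l.length ω ∧
      dropStream j ω = (fetch A l.length ω).2 ∧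
      Yields (l.foldlM (fun s _ => dr >>= h s) s) ω
        (foldFin g l.length s (fetch A l.length ω).1) j (l.length * K + j * c) := by
  induction l generalizing s ω with
  | nil => exact ⟨0, by simp, by simp [fetch], (pays_pure s ω).mono (Nat.zero_le _)⟩
  | cons b l ih =>
    rw [List.length_cons, fetchCost, ENNReal.add_lt_top] at hω
    have hhit := hit_of_drawCount_lt_top hω.1
    obtain ⟨j, hj, hdrop, hy⟩ := ih (g s (fetchOne A ω).1) (fetchOne A ω).2 hω.2
    refine ⟨hitTime A ω + 1 + j, ?_, ?_, ?_⟩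
    · rw [Nat.cast_add]
      exact add_le_add (hitTime_add_one_le_drawCount A ω) hj
    · rw [← dropStream_dropStream]
      exact hdrop
    · rw [List.foldlM_cons]
      refine (((hdr ω hhit).bind_pays (hg s _)).bind (q := fun s => l.foldlM _ s) hy).mono ?_
      rw [List.length_cons]
      ring_nf
      omega

end Semantics

/-! ### The algorithm as a function of the examples -/

section Refinement

variable {d : ℕ}

/-- The iterate of projected SGD after `w` on the example `e`. -/
def sgdPoint (lam ρ : ℝ) (w : Vec d) (e : Example d) : Vec d :=
  ballProj (w + (ρ * leakySlope lam (-labelValue e.2 * inner ℝ w e.1) * labelValue e.2) • e.1)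

/-- One iteration on the pair of the current iterate and the sum of the iterates. -/
def sgdUpdate (lam ρ : ℝ) (st : Vec d × Vec d) (e : Example d) : Vec d × Vec d :=
  (sgdPoint lam ρ st.1 e, st.2 + (1 : ℝ) • sgdPoint lam ρ st.1 e)

/-- The last iterate and the sum of the iterates of SGD on the examples `e`. -/
def sgdState (lam : ℝ) (n : ℕ) (e : Fin n → Example d) : Vec d × Vec d :=
  foldFin (sgdUpdate lam (1 / √(n : ℝ))) n (0, 0) e

/-- The normalized average iterate of SGD on the examples `e`. -/
def sgdVec (lam : ℝ) (n : ℕ) (e : Fin n → Example d) : Vec d :=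
  normalized ((n : ℝ)⁻¹ • (sgdState lam n e).2)

/-- The margin of an example, and whether it is misclassified. -/
def record (w : Vec d) (e : Example d) : ℝ × Bool := (|inner ℝ w e.1|, halfspace w e.1 != e.2)

/-- The records of a sample, in the order in which the algorithm stores them. -/
def records (w : Vec d) (m : ℕ) (e : Fin m → Example d) : List (ℝ × Bool) :=
  foldFin (fun out e => record w e :: out) m [] e

/-- The number of records above the threshold. -/
def countAbove (S : List (ℝ × Bool)) (T : ℝ) : ℕ := S.countP fun p => decide (T ≤ p.1)

/-- The number of misclassified records above the threshold. -/
def countWrong (S : List (ℝ × Bool)) (T : ℝ) : ℕ := S.countP fun p => decide (T ≤ p.1) && p.2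

/-- The update of the best threshold by a new candidate. -/
def improve (q : ℝ) (S : List (ℝ × Bool)) (best : Option (ℝ × ℝ)) (p : ℝ × Bool) :
    Option (ℝ × ℝ) :=
  if q ≤ (countAbove S p.1 : ℝ) / S.length ∧
      (best.elim true fun b => decide ((countWrong S p.1 : ℝ) / countAbove S p.1 < b.2)) = true
  then some (p.1, (countWrong S p.1 : ℝ) / countAbove S p.1) else best

/-- The best threshold for a list of records. -/
def threshold (q : ℝ) (S : List (ℝ × Bool)) : ℝ :=
  (S.foldl (improve q S) none).elim 0 Prod.fst

/-- The rule that is found from the examples `e₁` for SGD and `e₂` for the threshold. -/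
def nextRule (lam q : ℝ) (n m : ℕ) (e₁ : Fin n → Example d) (e₂ : Fin m → Example d) : Vec d × ℝ :=
  (sgdVec lam n e₁, threshold q (records (sgdVec lam n e₁) m e₂))

open Classical in
/-- The number of points that are not covered by the list. -/
def uncoveredCount (X : List (Vec d)) (L : DecisionList d) : ℕ :=
  X.countP fun x => decide (¬ Covered L x)

theorem pays_sgdStep (lam ρ : ℝ) (w : Vec d) (e : Example d) :
    Pays (sgdStep lam ρ w e) (sgdPoint lam ρ w e) (9 * d + 6) :=
  Pays.mono ((pays_dot w e.1).bind ((pays_step _).bind ((pays_step _).bind ((pays_step _).bind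
    ((pays_step _).bind ((pays_addScaled _ _ _).bind (pays_project _))))))) (by omega)

theorem yields_sgd (lam : ℝ) (n : ℕ) (L : DecisionList d) (ω : ℕ → Example d)
    (hω : fetchCost (unclassified L) n ω < ∞) :
    ∃ j : ℕ, (j : ℝ≥0∞) ≤ fetchCost (unclassified L) n ω ∧
      dropStream j ω = (fetch (unclassified L) n ω).2 ∧
      Yields (sgd lam n L) ω (sgdVec lam n (fetch (unclassified L) n ω).1) j
        (n * (12 * d + 7) + (8 * d + 4) + j * drawSteps d L.length) := by
  have hl : (List.range n).length = n := List.length_range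
  have hg : ∀ (st : Vec d × Vec d) (e : Example d), Pays (do
      let w ← sgdStep lam (1 / √(n : ℝ)) st.1 e
      let total ← addScaled st.2 1 w
      step (w, total)) (sgdUpdate lam (1 / √(n : ℝ)) st e) (12 * d + 7) := fun st e =>
    Pays.mono ((pays_sgdStep _ _ _ _).bind ((pays_addScaled _ _ _).bind (pays_step _))) (by omega)
  obtain ⟨j, hj, hdrop, hy⟩ := yields_foldlM_draw (yields_drawUnclassified L) hg (List.range n)
    ((0 : Vec d), (0 : Vec d)) ω (by rwa [hl])
  rw [hl] at hj hdrop hy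
  refine ⟨j, hj, hdrop, ?_⟩
  have hzero : Pays (d := d) (build fun _ => step 0) (0 : Vec d) (d * 2) :=
    pays_build (a := fun _ => 0) fun _ => pays_step _
  have havg : ∀ v : Vec d, Pays (build fun i => step (v i / n)) ((n : ℝ)⁻¹ • v) (d * 2) :=
    fun v => pays_build_div v n
  refine Yields.mono ((pays_step _).bind_yields ((pays_step _).bind_yields (hzero.bind_yields
    (hy.bind_pays ((havg _).bind (pays_normalize _)))))) ?_
  ring_nf
  omega

theorem yields_collect (m : ℕ) (L : DecisionList d) (w : Vec d) (ω : ℕ → Example d)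
    (hω : fetchCost (unclassified L) m ω < ∞) :
    ∃ j : ℕ, (j : ℝ≥0∞) ≤ fetchCost (unclassified L) m ω ∧
      dropStream j ω = (fetch (unclassified L) m ω).2 ∧
      Yields (collect m L w) ω (records w m (fetch (unclassified L) m ω).1) j
        (m * (2 * d + 4) + j * drawSteps d L.length) := by
  have hl : (List.range m).length = m := List.length_range
  have hg : ∀ (out : List (ℝ × Bool)) (e : Example d), Pays (do
      let s ← dot w e.1
      let a ← step |s|
      let h ← step (decide (0 ≤ s))
      let wrong ← step (h != e.2)
      step ((a, wrong) :: out)) (record w e :: out) (2 * d + 4) := fun out e =>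
    Pays.mono ((pays_dot _ _).bind ((pays_step _).bind ((pays_step _).bind ((pays_step _).bind
      (pays_step _))))) (by omega)
  obtain ⟨j, hj, hdrop, hy⟩ := yields_foldlM_draw (yields_drawUnclassified L) hg (List.range m)
    [] ω (by rwa [hl])
  rw [hl] at hj hdrop hy
  exact ⟨j, hj, hdrop, hy⟩

theorem pays_tally (S : List (ℝ × Bool)) (T : ℝ) :
    Pays (d := d) (tally S T) (countAbove S T, countWrong S T) (S.length * 3) := by
  have hbody : ∀ (c : ℕ × ℕ), ∀ p ∈ S, Pays (d := d) (do
      let b ← step (decide (T ≤ p.1))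
      if b then
        let k ← step (c.1 + 1)
        let e ← step (if p.2 then c.2 + 1 else c.2)
        pure (k, e)
      else pure c)
      (if decide (T ≤ p.1) = true then (c.1 + 1, if p.2 then c.2 + 1 else c.2) else c) 3 := by
    intro c p _
    refine (Pays.bind (K' := 2) (pays_step _) ?_).mono le_rfl
    split_ifs
    · exact (pays_step _).bind ((pays_step _).bind (pays_pure _))
    · exact (pays_step _).bind ((pays_step _).bind (pays_pure _))
    · exact (pays_pure _).mono (by omega)
  have hfold : ∀ (l : List (ℝ × Bool)) (c : ℕ × ℕ), l.foldl (fun (c : ℕ × ℕ) (p : ℝ × Bool) =>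
      if decide (T ≤ p.1) = true then (c.1 + 1, if p.2 then c.2 + 1 else c.2) else c) c
      = (c.1 + countAbove l T, c.2 + countWrong l T) := by
    intro l
    induction l with
    | nil => simp [countAbove, countWrong]
    | cons p l ih =>
      intro c
      rw [List.foldl_cons, ih]
      simp only [countAbove, countWrong, List.countP_cons]
      by_cases hT : T ≤ p.1 <;> by_cases hp : p.2 = true <;> simp [hT, hp] <;> omega
  have := pays_foldlM (d := d) S hbody (0, 0)
  rw [hfold] at this
  simp only [Nat.zero_add] at this
  exact this

theorem pays_bestThreshold (q : ℝ) (S : List (ℝ × Bool)) :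
    Pays (d := d) (bestThreshold q S) (threshold q S) (S.length * (S.length * 3 + 4) + 1) := by
  have hbody : ∀ (best : Option (ℝ × ℝ)), ∀ p ∈ S, Pays (d := d) (do
      let c ← tally S p.1
      let mass ← step ((c.1 : ℝ) / S.length)
      let feasible ← step (decide (q ≤ mass))
      if feasible then
        let r ← step ((c.2 : ℝ) / c.1)
        let better ← step (best.elim true fun b => decide (r < b.2))
        if better then pure (some (p.1, r)) else pure best
      else pure best) (improve q S best p) (S.length * 3 + 4) := by
    intro best p _
    refine Pays.mono (Pays.bind (K' := 4) (pays_tally S p.1) (Pays.bind (K' := 3) (pays_step _)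
      (Pays.bind (K' := 2) (pays_step _) ?_))) le_rfl
    unfold improve
    by_cases h1 : q ≤ (countAbove S p.1 : ℝ) / S.length
    · rw [if_pos (by simpa using h1)]
      refine Pays.bind (K := 1) (K' := 1) (pays_step _) (Pays.bind (K := 1) (K' := 0)
        (pays_step _) ?_)
      by_cases h2 : (best.elim true fun b =>
          decide ((countWrong S p.1 : ℝ) / countAbove S p.1 < b.2)) = true
      · rw [if_pos h2, if_pos ⟨h1, h2⟩]
        exact pays_pure _
      · rw [if_neg h2, if_neg fun h => h2 h.2]
        exact pays_pure _
    · rw [if_neg (by simpa using h1), if_neg fun h => h1 h.1]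
      exact (pays_pure _).mono (by omega)
  exact (pays_foldlM (d := d) S hbody none).bind (pays_step _)

open Classical in
theorem pays_countUnclassified (X : List (Vec d)) (L : DecisionList d) :
    Pays (countUnclassified X L) (uncoveredCount X L)
      (X.length * (L.length * (2 * d + 2) + 2)) := by
  have hfold : ∀ (l : List (Vec d)) (c : ℕ), l.foldl (fun (c : ℕ) (x : Vec d) =>
      if decide (Covered L x) = true then c else c + 1) c = c + uncoveredCount l L := by
    intro l
    induction l with
    | nil => simp [uncoveredCount]
    | cons x l ih =>
      intro c
      rw [List.foldl_cons, ih]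
      simp only [uncoveredCount, List.countP_cons]
      by_cases hx : Covered L x <;> simp [hx] <;> omega
  have := pays_foldlM (d := d) X (K := L.length * (2 * d + 2) + 2) (f := fun (k : ℕ) x => do
      let b ← isCovered L x
      step (if b then k else k + 1))
    (g := fun c x => if decide (Covered L x) = true then c else c + 1)
    (fun c x _ => (pays_isCovered L x).bind
      (q := fun b => step (if b = true then c else c + 1)) (pays_step _)) 0
  rw [hfold, Nat.zero_add] at this
  exact this

theorem length_foldFin_cons {E F : Type} (f : E → F) (k : ℕ) (l : List F) (e : Fin k → E) :
    (foldFin (fun out e => f e :: out) k l e).length = l.length + k := by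
  induction k generalizing l with
  | zero => rfl
  | succ k ih => rw [foldFin, ih, List.length_cons]; omega

theorem length_records (w : Vec d) (m : ℕ) (e : Fin m → Example d) :
    (records w m e).length = m := by
  rw [records, length_foldFin_cons]; simp

/-- The body of the main loop. -/
def mainBody (lam q ε : ℝ) (n m : ℕ) (X : List (Vec d)) (L : DecisionList d) :
    Comp d (DecisionList d ⊕ DecisionList d) := do
  let k ← countUnclassified X L
  let frac ← step ((k : ℝ) / X.length)
  let go ← step (decide (ε ≤ frac))
  if go then
    let w ← sgd lam n L
    let S ← collect m L w
    let T ← bestThreshold q S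
    tick (L.length + 1)
    pure (Sum.inl (L ++ [(w, T)]))
  else pure (Sum.inr L)

/-- The number of steps in one round of the main loop, without those for drawing examples. -/
def roundSteps (d n m x l : ℕ) : ℕ :=
  x * (l * (2 * d + 2) + 2) + 2 + (n * (12 * d + 7) + (8 * d + 4)) + m * (2 * d + 4)
    + (m * (m * 3 + 4) + 1) + (l + 1)

theorem yields_mainBody_exit (lam q ε : ℝ) (n m : ℕ) (X : List (Vec d)) (L : DecisionList d)
    (ω : ℕ → Example d) (h : ¬ ε ≤ (uncoveredCount X L : ℝ) / X.length) :
    Yields (mainBody lam q ε n m X L) ω (Sum.inr L) 0 (roundSteps d n m X.length L.length) := by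
  refine Yields.mono (K := X.length * (L.length * (2 * d + 2) + 2) + (1 + (1 + 0)))
    ((pays_countUnclassified X L).bind ((pays_step _).bind ((pays_step _).bind ?_)) ω) ?_
  · rw [if_neg (by simpa using h)]
    exact pays_pure _
  · unfold roundSteps; omega

theorem yields_mainBody_next (lam q ε : ℝ) (n m : ℕ) (X : List (Vec d)) (L : DecisionList d)
    (ω : ℕ → Example d) (h : ε ≤ (uncoveredCount X L : ℝ) / X.length)
    (h₁ : fetchCost (unclassified L) n ω < ∞)
    (h₂ : fetchCost (unclassified L) m (fetch (unclassified L) n ω).2 < ∞) :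
    ∃ j : ℕ, (j : ℝ≥0∞) ≤ fetchCost (unclassified L) n ω
        + fetchCost (unclassified L) m (fetch (unclassified L) n ω).2 ∧
      dropStream j ω = (fetch (unclassified L) m (fetch (unclassified L) n ω).2).2 ∧
      Yields (mainBody lam q ε n m X L) ω
        (Sum.inl (L ++ [nextRule lam q n m (fetch (unclassified L) n ω).1
          (fetch (unclassified L) m (fetch (unclassified L) n ω).2).1])) j
        (roundSteps d n m X.length L.length + j * drawSteps d L.length) := by
  obtain ⟨j₁, hj₁, hd₁, hy₁⟩ := yields_sgd lam n L ω h₁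
  obtain ⟨j₂, hj₂, hd₂, hy₂⟩ := yields_collect m L
    (sgdVec lam n (fetch (unclassified L) n ω).1) _ h₂
  refine ⟨j₁ + j₂, by rw [Nat.cast_add]; exact add_le_add hj₁ hj₂, ?_, ?_⟩
  · rw [← dropStream_dropStream, hd₁, hd₂]
  · rw [← hd₁] at hy₂
    have hT := pays_bestThreshold (d := d) q (records (sgdVec lam n (fetch (unclassified L) n ω).1)
      m (fetch (unclassified L) m (fetch (unclassified L) n ω).2).1)
    rw [length_records] at hT
    rw [hd₁] at hy₂
    refine Yields.mono ((pays_countUnclassified X L).bind_yields ((pays_step _).bind_yields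
      ((pays_step _).bind_yields (K' := (n * (12 * d + 7) + (8 * d + 4)
        + j₁ * drawSteps d L.length) + ((m * (2 * d + 4) + j₂ * drawSteps d L.length)
        + ((m * (m * 3 + 4) + 1) + ((L.length + 1) + 0)))) ?_))) ?_
    · rw [if_pos (by simpa using h)]
      refine hy₁.bind ?_
      rw [hd₁]
      exact hy₂.bind_pays (hT.bind ((pays_tick _).bind (pays_pure _)))
    · unfold roundSteps
      ring_nf
      omega

/-- The initial sample of points. -/
def samplePoints (N : ℕ) (e : Fin N → Example d) : List (Vec d) :=
  foldFin (fun out e => e.1 :: out) N [] e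

theorem hitTime_univ {E : Type} (ω : ℕ → E) : hitTime Set.univ ω = 0 :=
  hitTime_eq (Set.mem_univ _) (by simp)

/-- The initial sample is treated as rejection sampling from the whole space, so that the same
splitting of the stream serves for it as for the rounds of the loop. -/
theorem yields_learner (η γ ε : ℝ) (N n m : ℕ) (ω : ℕ → Example d)
    (hω : fetchCost (Set.univ : Set (Example d)) N ω < ∞) {L : DecisionList d} {j K : ℕ}
    (hloop : Yields (Comp.loop (mainBody (η + ε) (γ * ε) ε n m
      (samplePoints N (fetch Set.univ N ω).1)) []) (fetch Set.univ N ω).2 L j K) :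
    ∃ j₀ : ℕ, (j₀ : ℝ≥0∞) ≤ fetchCost (Set.univ : Set (Example d)) N ω ∧
      Yields (learner d η γ ε N n m) ω L (j₀ + j) (N + j₀ * (d + 1) + 2 + K) := by
  have hl : (List.range N).length = N := List.length_range
  have hdr : ∀ ω : ℕ → Example d, (∃ t, ω t ∈ (Set.univ : Set (Example d))) →
      Yields draw ω (fetchOne Set.univ ω).1 (hitTime Set.univ ω + 1)
        ((hitTime Set.univ ω + 1) * (d + 1)) := by
    intro ω _
    have := yields_draw ω
    simpa [fetchOne, hitTime_univ] using this
  obtain ⟨j₀, hj₀, hdrop, hy⟩ := yields_foldlM_draw hdr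
    (g := fun (out : List (Vec d)) (e : Example d) => e.1 :: out)
    (fun (out : List (Vec d)) (e : Example d) => pays_step (e.1 :: out)) (List.range N) [] ω
    (by rwa [hl])
  rw [hl] at hj₀ hdrop hy
  refine ⟨j₀, hj₀, ?_⟩
  rw [← hdrop] at hloop
  exact Yields.mono ((pays_step _).bind_yields ((pays_step _).bind_yields (hy.bind hloop)))
    (by omega)

theorem exec_of_yields {α : Type} {p : Comp d α} {ω : ℕ → Example d} {a : α} {j K : ℕ}
    (h : Yields p ω a j K) : ∃ u : Usage, p.exec ω = some (a, u) ∧ u.samples = j ∧ u.steps ≤ K := by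
  obtain ⟨t, ht, e⟩ := h ω 0 0 (dropStream_zero ω)
  exact ⟨⟨0 + j, t⟩, e, Nat.zero_add j, by simpa using ht⟩

end Refinement

/-! ### Measurability of the rules -/

section Measurability

variable {d : ℕ} {Θ : Type} [MeasurableSpace Θ]

theorem measurable_labelValue : Measurable labelValue := measurable_of_finite _

theorem measurable_leakySlope (lam : ℝ) : Measurable (leakySlope lam) :=
  Measurable.ite measurableSet_Ici measurable_const measurable_const

theorem measurable_leakyReLU (lam : ℝ) : Measurable (leakyReLU lam) :=
  Measurable.ite measurableSet_Ici (measurable_const.mul measurable_id)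
    (measurable_const.mul measurable_id)

theorem measurable_halfspace : Measurable fun p : Vec d × Vec d => halfspace p.1 p.2 := by
  refine measurable_to_bool ?_
  have : (fun p : Vec d × Vec d => halfspace p.1 p.2) ⁻¹' {true}
      = {p | 0 ≤ inner ℝ p.1 p.2} := by
    ext; simp [halfspace]
  rw [this]
  exact measurableSet_le measurable_const (measurable_fst.inner measurable_snd)

theorem measurable_ballProj : Measurable (ballProj (d := d)) :=
  Measurable.ite (measurableSet_le measurable_norm measurable_const) measurable_id
    (measurable_norm.inv.smul measurable_id)

theorem measurable_sgdPoint (lam ρ : ℝ) {w : Θ → Vec d} {e : Θ → Example d} (hw : Measurable w)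
    (he : Measurable e) : Measurable fun θ => sgdPoint lam ρ (w θ) (e θ) := by
  have hl : Measurable fun θ => labelValue (e θ).2 := measurable_labelValue.comp he.snd
  have hz : Measurable fun θ => -labelValue (e θ).2 * inner ℝ (w θ) (e θ).1 :=
    Measurable.mul hl.neg (hw.inner he.fst)
  have hs : Measurable fun θ => leakySlope lam (-labelValue (e θ).2 * inner ℝ (w θ) (e θ).1) :=
    (measurable_leakySlope lam).comp hz
  exact measurable_ballProj.comp
    (Measurable.add hw (Measurable.smul (Measurable.mul (Measurable.const_mul hs ρ) hl) he.fst))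

theorem measurable_sgdUpdate (lam ρ : ℝ) :
    Measurable fun p : (Vec d × Vec d) × Example d => sgdUpdate lam ρ p.1 p.2 := by
  have h : Measurable fun p : (Vec d × Vec d) × Example d => sgdPoint lam ρ p.1.1 p.2 :=
    measurable_sgdPoint lam ρ measurable_fst.fst measurable_snd
  have h1 : Measurable fun p : (Vec d × Vec d) × Example d => p.1.2 := measurable_fst.snd
  have h2 : Measurable fun p : (Vec d × Vec d) × Example d => (sgdPoint lam ρ p.1.1 p.2,
      p.1.2 + (1 : ℝ) • sgdPoint lam ρ p.1.1 p.2) :=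
    Measurable.prodMk h (Measurable.add h1 (Measurable.fun_const_smul h (1 : ℝ)))
  exact h2

theorem measurable_foldFin {σ E : Type} [MeasurableSpace σ] [MeasurableSpace E] {g : σ → E → σ}
    (hg : Measurable fun p : σ × E => g p.1 p.2) (k : ℕ) :
    Measurable fun p : σ × (Fin k → E) => foldFin g k p.1 p.2 := by
  induction k with
  | zero => exact measurable_fst
  | succ k ih =>
    have h1 : Measurable fun p : σ × (Fin (k + 1) → E) => g p.1 (p.2 0) :=
      hg.comp (measurable_fst.prodMk ((measurable_pi_apply 0).comp measurable_snd))
    have h2 : Measurable fun p : σ × (Fin (k + 1) → E) => fun i : Fin k => p.2 i.succ :=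
      measurable_pi_iff.2 fun i => (measurable_pi_apply i.succ).comp measurable_snd
    exact ih.comp (h1.prodMk h2)

theorem measurable_sgdState (lam : ℝ) (n : ℕ) : Measurable (sgdState (d := d) lam n) :=
  (measurable_foldFin (measurable_sgdUpdate lam (1 / √(n : ℝ))) n).comp
    (measurable_const.prodMk measurable_id)

theorem measurable_sgdVec (lam : ℝ) (n : ℕ) : Measurable (sgdVec (d := d) lam n) := by
  have h : Measurable fun e : Fin n → Example d => (n : ℝ)⁻¹ • (sgdState lam n e).2 :=
    (measurable_sgdState lam n).snd.fun_const_smul _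
  exact h.norm.inv.smul h

theorem measurable_record {w : Θ → Vec d} {e : Θ → Example d} (hw : Measurable w)
    (he : Measurable e) : Measurable fun θ => record (w θ) (e θ) := by
  have h1 : Measurable fun θ => |inner ℝ (w θ) (e θ).1| := (hw.inner he.fst).abs
  have h2 : Measurable fun θ => (halfspace (w θ) (e θ).1, (e θ).2) :=
    (measurable_halfspace.comp (hw.prodMk he.fst)).prodMk he.snd
  exact h1.prodMk ((measurable_of_finite fun b : Bool × Bool => b.1 != b.2).comp h2)

/-- Random lists are represented throughout as fixed lists of measurable functions of a parameter
`θ`. Measurability is then only asked of functions into numbers, vectors and finite types. -/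
theorem measurable_countP {E : Type} [MeasurableSpace E] (S : List (Θ → E))
    (hS : ∀ f ∈ S, Measurable f) {P : Θ → E → Bool}
    (hP : Measurable fun p : Θ × E => P p.1 p.2) :
    Measurable fun θ => (S.map fun f => f θ).countP (P θ) := by
  induction S with
  | nil => exact measurable_const
  | cons f S ih =>
    simp only [List.map_cons, List.countP_cons]
    have hf : Measurable fun θ => P θ (f θ) := hP.comp (measurable_id.prodMk (hS f (by simp)))
    exact (ih fun g hg => hS g (by simp [hg])).add
      ((measurable_of_finite fun b : Bool => if b = true then 1 else 0).comp hf)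

theorem measurable_decide {p : Θ → Prop} [DecidablePred p] (h : MeasurableSet {θ | p θ}) :
    Measurable fun θ => decide (p θ) := by
  refine measurable_to_bool ?_
  have : (fun θ => decide (p θ)) ⁻¹' {true} = {θ | p θ} := by ext; simp
  rwa [this]

theorem measurable_countAbove (S : List (Θ → ℝ × Bool)) (hS : ∀ f ∈ S, Measurable f)
    {T : Θ → ℝ} (hT : Measurable T) :
    Measurable fun θ => countAbove (S.map fun f => f θ) (T θ) :=
  measurable_countP S hS
    (measurable_decide (measurableSet_le (hT.comp measurable_fst) measurable_snd.fst))

theorem measurable_countWrong (S : List (Θ → ℝ × Bool)) (hS : ∀ f ∈ S, Measurable f)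
    {T : Θ → ℝ} (hT : Measurable T) :
    Measurable fun θ => countWrong (S.map fun f => f θ) (T θ) := by
  refine measurable_countP S hS (P := fun θ p => decide (T θ ≤ p.1) && p.2) ?_
  have h : Measurable fun p : Θ × ℝ × Bool => (decide (T p.1 ≤ p.2.1), p.2.2) :=
    (measurable_decide (measurableSet_le (hT.comp measurable_fst) measurable_snd.fst)).prodMk
      measurable_snd.snd
  exact (measurable_of_finite fun b : Bool × Bool => b.1 && b.2).comp h

/-- The update of the best threshold by a candidate `a` with empirical mass `p` and error `r`. -/
def improveWith (q p r a : ℝ) (best : Option (ℝ × ℝ)) : Option (ℝ × ℝ) :=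
  if q ≤ p ∧ (best.elim true fun b => decide (r < b.2)) = true then some (a, r) else best

/-- An optional pair is followed through two ordinary functions, `isSome` and `getD (0, 0)`, which
together determine it. -/
theorem measurable_improveWith (q : ℝ) {p r a : Θ → ℝ} (hp : Measurable p) (hr : Measurable r)
    (ha : Measurable a) {b : Θ → Option (ℝ × ℝ)} (hb1 : Measurable fun θ => (b θ).isSome)
    (hb2 : Measurable fun θ => (b θ).getD (0, 0)) :
    Measurable (fun θ => (improveWith q (p θ) (r θ) (a θ) (b θ)).isSome) ∧
      Measurable fun θ => (improveWith q (p θ) (r θ) (a θ) (b θ)).getD (0, 0) := by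
  classical
  have hset : MeasurableSet {θ | q ≤ p θ ∧
      ((b θ).elim true fun b => decide (r θ < b.2)) = true} := by
    have : {θ | q ≤ p θ ∧ ((b θ).elim true fun b => decide (r θ < b.2)) = true}
        = {θ | q ≤ p θ} ∩
          ((fun θ => (b θ).isSome) ⁻¹' {false} ∪ {θ | r θ < ((b θ).getD (0, 0)).2}) := by
      ext θ
      rcases hbθ : b θ with _ | v <;> simp [hbθ]
    rw [this]
    exact (measurableSet_le measurable_const hp).inter
      ((hb1 (measurableSet_singleton _)).union (measurableSet_lt hr hb2.snd))
  constructor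
  · have : (fun θ => (improveWith q (p θ) (r θ) (a θ) (b θ)).isSome) = fun θ =>
        if q ≤ p θ ∧ ((b θ).elim true fun b => decide (r θ < b.2)) = true
        then true else (b θ).isSome := by
      funext θ; unfold improveWith; split_ifs <;> rfl
    rw [this]
    exact Measurable.ite hset measurable_const hb1
  · have : (fun θ => (improveWith q (p θ) (r θ) (a θ) (b θ)).getD (0, 0)) = fun θ =>
        if q ≤ p θ ∧ ((b θ).elim true fun b => decide (r θ < b.2)) = true
        then (a θ, r θ) else (b θ).getD (0, 0) := by
      funext θ; unfold improveWith; split_ifs <;> rfl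
    rw [this]
    exact Measurable.ite hset (ha.prodMk hr) hb2

theorem measurable_threshold (q : ℝ) (S : List (Θ → ℝ × Bool)) (hS : ∀ f ∈ S, Measurable f) :
    Measurable fun θ => threshold q (S.map fun f => f θ) := by
  -- The fold runs over a varying list `l` from a varying state `b`, while the counts always refer
  -- to the whole list `S`.
  have key : ∀ (l : List (Θ → ℝ × Bool)), (∀ f ∈ l, Measurable f) → ∀ b : Θ → Option (ℝ × ℝ),
      Measurable (fun θ => (b θ).isSome) → Measurable (fun θ => (b θ).getD (0, 0)) →
      Measurable fun θ => (((l.map fun f => f θ).foldl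
        (improve q (S.map fun f => f θ)) (b θ)).getD (0, 0)) := by
    intro l
    induction l with
    | nil => intro _ b _ hb; exact hb
    | cons f l ih =>
      intro hl b hb1 hb2
      have hf : Measurable f := hl f (by simp)
      have hc : Measurable fun θ => (countAbove (S.map fun f => f θ) (f θ).1 : ℝ) :=
        (measurable_of_countable fun k : ℕ => (k : ℝ)).comp
          (measurable_countAbove S hS hf.fst)
      have hw : Measurable fun θ => (countWrong (S.map fun f => f θ) (f θ).1 : ℝ) :=
        (measurable_of_countable fun k : ℕ => (k : ℝ)).comp
          (measurable_countWrong S hS hf.fst)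
      have hm : Measurable fun θ => (countAbove (S.map fun f => f θ) (f θ).1 : ℝ)
          / (S.map fun f => f θ).length := by
        simp only [List.length_map]
        exact hc.div_const _
      obtain ⟨h1, h2⟩ := measurable_improveWith q hm (hw.div hc) hf.fst hb1 hb2
      exact ih (fun g hg => hl g (by simp [hg])) _ h1 h2
  have := (key S hS (fun _ => none) measurable_const measurable_const).fst
  have heq : (fun θ => threshold q (S.map fun f => f θ)) = fun θ =>
      (((S.map fun f => f θ).foldl (improve q (S.map fun f => f θ)) none).getD (0, 0)).1 := by
    funext θ
    unfold threshold
    generalize (S.map fun f => f θ).foldl (improve q (S.map fun f => f θ)) none = o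
    rcases o with _ | v <;> rfl
  rw [heq]
  exact this

theorem foldFin_cons_eq {E F : Type} (f : E → F) (k : ℕ) (l : List F) (e : Fin k → E) :
    foldFin (fun out e => f e :: out) k l e = ((List.finRange k).map fun i => f (e i)).reverse ++ l := by
  induction k generalizing l with
  | zero => simp [foldFin]
  | succ k ih =>
    rw [foldFin, ih, List.finRange_succ]
    simp [List.map_map, Function.comp_def]

theorem records_eq (w : Vec d) (m : ℕ) (e : Fin m → Example d) :
    records w m e = ((List.finRange m).map fun i => record w (e i)).reverse := by
  rw [records, foldFin_cons_eq, List.append_nil]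

theorem measurable_threshold_records (q : ℝ) (m : ℕ) {w : Θ → Vec d} {e : Θ → Fin m → Example d}
    (hw : Measurable w) (he : Measurable e) :
    Measurable fun θ => threshold q (records (w θ) m (e θ)) := by
  have := measurable_threshold q
    (((List.finRange m).map fun i => fun θ => record (w θ) (e θ i)).reverse) (by
      intro f hf
      simp only [List.mem_reverse, List.mem_map] at hf
      obtain ⟨i, _, rfl⟩ := hf
      exact measurable_record hw ((measurable_pi_apply i).comp he))
  simp only [records_eq]
  simpa only [List.map_reverse, List.map_map, Function.comp_def] using this

theorem measurable_nextRule (lam q : ℝ) (n m : ℕ) {e₁ : Θ → Fin n → Example d}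
    {e₂ : Θ → Fin m → Example d} (h₁ : Measurable e₁) (h₂ : Measurable e₂) :
    Measurable fun θ => nextRule lam q n m (e₁ θ) (e₂ θ) := by
  have hw : Measurable fun θ => sgdVec lam n (e₁ θ) := (measurable_sgdVec lam n).comp h₁
  have hT := measurable_threshold_records q m hw h₂
  have h : Measurable fun θ => (sgdVec lam n (e₁ θ),
      threshold q (records (sgdVec lam n (e₁ θ)) m (e₂ θ))) := Measurable.prodMk hw hT
  exact h

theorem measurableSet_covered (L : List (Θ → Vec d × ℝ)) (hL : ∀ f ∈ L, Measurable f)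
    {E : Type} [MeasurableSpace E] {x : E → Vec d} (hx : Measurable x) {t : E → Θ}
    (ht : Measurable t) :
    MeasurableSet {p : E | Covered (L.map fun f => f (t p)) (x p)} := by
  have : {p : E | Covered (L.map fun f => f (t p)) (x p)}
      = ⋃ f ∈ {f | f ∈ L}, {p : E | (f (t p)).2 ≤ |inner ℝ (f (t p)).1 (x p)|} := by
    ext p; simp [Covered]
  rw [this]
  refine MeasurableSet.biUnion (List.finite_toSet L).countable fun f hf => ?_
  have := (hL f hf).comp ht
  exact measurableSet_le this.snd (this.fst.inner hx).abs

theorem measurableSet_unclassified_map (L : List (Θ → Vec d × ℝ)) (hL : ∀ f ∈ L, Measurable f) :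
    MeasurableSet {p : Θ × Example d | p.2 ∈ unclassified (L.map fun f => f p.1)} :=
  (measurableSet_covered L hL measurable_snd.fst measurable_fst).compl

theorem measurableSet_unclassified (L : DecisionList d) : MeasurableSet (unclassified L) := by
  have h := measurableSet_unclassified_map (Θ := Unit) (L.map fun r _ => r) (by
    intro f hf
    obtain ⟨r, _, rfl⟩ := List.mem_map.1 hf
    exact measurable_const)
  have h2 : Measurable fun e : Example d => ((), e) := measurable_const.prodMk measurable_id
  simpa [List.map_map, Function.comp_def] using h2 h

end Measurability

/-! ### Concentration -/

section Chernoff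

variable {E : Type} [MeasurableSpace E] (Q : Measure E) [IsProbabilityMeasure Q]

theorem integrable_of_abs_le {Z : E → ℝ} (hZ : Measurable Z) {B : ℝ} (hB : ∀ᵐ x ∂Q, |Z x| ≤ B) :
    Integrable Z Q :=
  Integrable.of_bound hZ.aestronglyMeasurable B hB

/-- Uses `exp u ≤ 1 + u + u ^ 2` for `|u| ≤ 1`. Keeping the second moment instead of the range
yields multiplicative Chernoff bounds, with exponents linear in the mass of a rare event. -/
theorem lintegral_exp_le {Z : E → ℝ} (hZ : Measurable Z) (hb : ∀ᵐ x ∂Q, |Z x| ≤ 1) {t : ℝ}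
    (ht0 : 0 ≤ t) (ht1 : t ≤ 1) :
    ∫⁻ x, ENNReal.ofReal (Real.exp (t * Z x)) ∂Q
      ≤ ENNReal.ofReal (Real.exp (t * ∫ x, Z x ∂Q + t ^ 2 * ∫ x, Z x ^ 2 ∂Q)) := by
  have hi := integrable_of_abs_le Q hZ hb
  have hi2 : Integrable (fun x => Z x ^ 2) Q :=
    integrable_of_abs_le Q (hZ.pow_const 2) (B := 1) (by
      filter_upwards [hb] with x hx
      rw [abs_pow]
      exact pow_le_one₀ (abs_nonneg _) hx)
  have hpt : ∀ᵐ x ∂Q, Real.exp (t * Z x) ≤ 1 + t * Z x + t ^ 2 * Z x ^ 2 := by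
    filter_upwards [hb] with x hx
    have h1 : |t * Z x| ≤ 1 := by
      rw [abs_mul, abs_of_nonneg ht0]
      exact mul_le_one₀ ht1 (abs_nonneg _) hx
    have := (abs_le.1 (Real.abs_exp_sub_one_sub_id_le h1)).2
    nlinarith
  have hlin : Integrable (fun x => 1 + t * Z x + t ^ 2 * Z x ^ 2) Q :=
    ((integrable_const 1).add (hi.const_mul t)).add (hi2.const_mul (t ^ 2))
  calc ∫⁻ x, ENNReal.ofReal (Real.exp (t * Z x)) ∂Q
      ≤ ∫⁻ x, ENNReal.ofReal (1 + t * Z x + t ^ 2 * Z x ^ 2) ∂Q :=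
        lintegral_mono_ae (hpt.mono fun x hx => ENNReal.ofReal_le_ofReal hx)
    _ = ENNReal.ofReal (∫ x, (1 + t * Z x + t ^ 2 * Z x ^ 2) ∂Q) := by
        rw [ofReal_integral_eq_lintegral_ofReal hlin]
        exact hpt.mono fun x hx => (Real.exp_pos _).le.trans hx
    _ ≤ _ := by
        refine ENNReal.ofReal_le_ofReal ?_
        have e1 : ∫ x, (1 + t * Z x + t ^ 2 * Z x ^ 2) ∂Q
            = ∫ x, (1 + t * Z x) ∂Q + ∫ x, t ^ 2 * Z x ^ 2 ∂Q :=
          integral_add ((integrable_const 1).add (hi.const_mul t)) (hi2.const_mul (t ^ 2))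
        have e2 : ∫ x, (1 + t * Z x) ∂Q = ∫ _, (1 : ℝ) ∂Q + ∫ x, t * Z x ∂Q :=
          integral_add (integrable_const 1) (hi.const_mul t)
        rw [e1, e2, integral_const_mul, integral_const_mul]
        simp only [integral_const, probReal_univ, smul_eq_mul, mul_one]
        have := Real.add_one_le_exp (t * ∫ x, Z x ∂Q + t ^ 2 * ∫ x, Z x ^ 2 ∂Q)
        linarith

theorem lintegral_pi_exp_sum_le {Z : E → ℝ} (hZ : Measurable Z) (t : ℝ) {B : ℝ}
    (hB : ∫⁻ x, ENNReal.ofReal (Real.exp (t * Z x)) ∂Q ≤ ENNReal.ofReal (Real.exp B)) (k : ℕ) :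
    ∫⁻ e, ENNReal.ofReal (Real.exp (t * ∑ i, Z (e i))) ∂(Measure.pi fun _ : Fin k => Q)
      ≤ ENNReal.ofReal (Real.exp (k * B)) := by
  have hm : ∀ k : ℕ, Measurable fun e : Fin k → E =>
      ENNReal.ofReal (Real.exp (t * ∑ i, Z (e i))) := fun k =>
    (Real.measurable_exp.comp (measurable_const.mul (Finset.measurable_sum _ fun i _ =>
      hZ.comp (measurable_pi_apply i)))).ennreal_ofReal
  induction k with
  | zero => simp
  | succ k ih =>
    rw [lintegral_pi_cons Q k (hm _)]
    have hstep : ∀ x (e : Fin k → E), ENNReal.ofReal (Real.exp (t * ∑ i : Fin (k + 1),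
        Z ((Fin.cons x e : Fin (k + 1) → E) i)))
        = ENNReal.ofReal (Real.exp (t * Z x)) * ENNReal.ofReal (Real.exp (t * ∑ i, Z (e i))) := by
      intro x e
      rw [Fin.sum_univ_succ, ← ENNReal.ofReal_mul (Real.exp_pos _).le, ← Real.exp_add]
      simp only [Fin.cons_zero, Fin.cons_succ]
      ring_nf
    simp only [hstep]
    have hZm : Measurable fun x => ENNReal.ofReal (Real.exp (t * Z x)) :=
      (Real.measurable_exp.comp (measurable_const.mul hZ)).ennreal_ofReal
    simp only [lintegral_const_mul _ (hm k)]
    rw [lintegral_mul_const _ hZm]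
    refine (mul_le_mul' hB ih).trans ?_
    rw [← ENNReal.ofReal_mul (Real.exp_pos _).le, ← Real.exp_add]
    refine ENNReal.ofReal_le_ofReal (Real.exp_le_exp.2 ?_)
    push_cast
    linarith

/-- Markov's inequality for an exponential. -/
theorem measure_le_exp {F : Type} [MeasurableSpace F] (P : Measure F) {V : F → ℝ}
    (hV : Measurable V) {a B : ℝ}
    (h : ∫⁻ x, ENNReal.ofReal (Real.exp (V x)) ∂P ≤ ENNReal.ofReal (Real.exp B)) :
    P {x | a ≤ V x} ≤ ENNReal.ofReal (Real.exp (B - a)) := by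
  have hm : Measurable fun x => ENNReal.ofReal (Real.exp (V x)) :=
    (Real.measurable_exp.comp hV).ennreal_ofReal
  have h1 := mul_meas_ge_le_lintegral (μ := P) hm (ENNReal.ofReal (Real.exp a))
  have h2 : {x | a ≤ V x} ⊆ {x | ENNReal.ofReal (Real.exp a) ≤ ENNReal.ofReal (Real.exp (V x))} :=
    fun x hx => ENNReal.ofReal_le_ofReal (Real.exp_le_exp.2 hx)
  have h3 : ENNReal.ofReal (Real.exp a) * P {x | a ≤ V x} ≤ ENNReal.ofReal (Real.exp B) :=
    ((mul_le_mul_right (measure_mono h2) _).trans h1).trans h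
  calc P {x | a ≤ V x}
      = ENNReal.ofReal (Real.exp (-a)) * (ENNReal.ofReal (Real.exp a) * P {x | a ≤ V x}) := by
        rw [← mul_assoc, ← ENNReal.ofReal_mul (Real.exp_pos _).le, ← Real.exp_add]
        simp
    _ ≤ ENNReal.ofReal (Real.exp (-a)) * ENNReal.ofReal (Real.exp B) := by gcongr
    _ = _ := by
        rw [← ENNReal.ofReal_mul (Real.exp_pos _).le, ← Real.exp_add]
        ring_nf

/-- Chernoff's bound for a sum of `k` independent copies of `Z`. -/
theorem chernoff {Z : E → ℝ} (hZ : Measurable Z) (hb : ∀ᵐ x ∂Q, |Z x| ≤ 1) {t : ℝ}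
    (ht0 : 0 ≤ t) (ht1 : t ≤ 1) {a b : ℝ} (ha : ∫ x, Z x ∂Q ≤ a) (hb2 : ∫ x, Z x ^ 2 ∂Q ≤ b)
    (k : ℕ) (s : ℝ) :
    (Measure.pi fun _ : Fin k => Q) {e | s ≤ ∑ i, Z (e i)}
      ≤ ENNReal.ofReal (Real.exp (k * (t * a + t ^ 2 * b) - t * s)) := by
  have h1 : ∫⁻ x, ENNReal.ofReal (Real.exp (t * Z x)) ∂Q
      ≤ ENNReal.ofReal (Real.exp (t * a + t ^ 2 * b)) := by
    refine (lintegral_exp_le Q hZ hb ht0 ht1).trans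
      (ENNReal.ofReal_le_ofReal (Real.exp_le_exp.2 ?_))
    have := mul_le_mul_of_nonneg_left ha ht0
    have := mul_le_mul_of_nonneg_left hb2 (sq_nonneg t)
    linarith
  have hm : Measurable fun e : Fin k → E => t * ∑ i, Z (e i) :=
    measurable_const.mul (Finset.measurable_sum _ fun i _ => hZ.comp (measurable_pi_apply i))
  refine (measure_mono fun e he => ?_).trans
    (measure_le_exp _ hm (a := t * s) (lintegral_pi_exp_sum_le Q hZ t h1 k))
  exact mul_le_mul_of_nonneg_left he ht0

end Chernoff

/-! ### Projected stochastic gradient descent -/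

section SGD

variable {d : ℕ}

/-- The loss of the vector `w` on an example. -/
def loss (lam : ℝ) (w : Vec d) (e : Example d) : ℝ :=
  leakyReLU lam (-labelValue e.2 * inner ℝ w e.1)

/-- The expected loss of the vector `w`. -/
def risk (Q : Measure (Example d)) (lam : ℝ) (w : Vec d) : ℝ := ∫ e, loss lam w e ∂Q

variable {lam : ℝ}

/-- As a maximum of two linear maps the loss is sublinear. Subadditivity and positive homogeneity
take the place of convexity below: they bound the risk of the sum of the iterates directly. -/
theorem leakyReLU_eq_max (h : lam ≤ 1 / 2) (z : ℝ) :
    leakyReLU lam z = max ((1 - lam) * z) (lam * z) := by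
  unfold leakyReLU
  split_ifs with hz
  · rw [max_eq_left (by nlinarith)]
  · rw [max_eq_right (by nlinarith)]

theorem leakyReLU_add_le (h : lam ≤ 1 / 2) (y z : ℝ) :
    leakyReLU lam (y + z) ≤ leakyReLU lam y + leakyReLU lam z := by
  simp only [leakyReLU_eq_max h, mul_add]
  exact max_add_add_le_max_add_max

theorem leakyReLU_mul {c : ℝ} (hc : 0 ≤ c) (h : lam ≤ 1 / 2) (z : ℝ) :
    leakyReLU lam (c * z) = c * leakyReLU lam z := by
  simp only [leakyReLU_eq_max h]
  rw [mul_max_of_nonneg _ _ hc]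
  ring_nf

theorem abs_leakyReLU_le (h0 : 0 ≤ lam) (h : lam ≤ 1 / 2) (z : ℝ) : |leakyReLU lam z| ≤ |z| := by
  unfold leakyReLU
  split_ifs
  · rw [abs_mul, abs_of_nonneg (by linarith : 0 ≤ 1 - lam)]
    exact mul_le_of_le_one_left (abs_nonneg z) (by linarith)
  · rw [abs_mul, abs_of_nonneg h0]
    exact mul_le_of_le_one_left (abs_nonneg z) (by linarith)

theorem abs_labelValue (y : Bool) : |labelValue y| = 1 := by cases y <;> simp [labelValue]

theorem abs_loss_le (h0 : 0 ≤ lam) (h : lam ≤ 1 / 2) (w : Vec d) {e : Example d} (he : ‖e.1‖ ≤ 1) :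
    |loss lam w e| ≤ ‖w‖ := by
  refine (abs_leakyReLU_le h0 h _).trans ?_
  rw [abs_mul, abs_neg, abs_labelValue, one_mul]
  exact (abs_real_inner_le_norm w e.1).trans (mul_le_of_le_one_right (norm_nonneg w) he)

theorem measurable_loss (lam : ℝ) : Measurable fun p : Vec d × Example d => loss lam p.1 p.2 := by
  have h : Measurable fun p : Vec d × Example d => -labelValue p.2.2 * inner ℝ p.1 p.2.1 :=
    Measurable.mul (measurable_labelValue.comp measurable_snd.snd).neg
      (measurable_fst.inner measurable_snd.fst)
  exact (measurable_leakyReLU lam).comp h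

theorem measurable_loss_right (lam : ℝ) (w : Vec d) : Measurable (loss lam w) :=
  (measurable_loss lam).comp (measurable_const.prodMk measurable_id)

theorem norm_ballProj_le (v : Vec d) : ‖ballProj v‖ ≤ 1 := by
  unfold ballProj
  split_ifs with h
  · exact h
  · rw [norm_smul, norm_inv, norm_norm, inv_mul_cancel₀]
    intro h0
    rw [h0] at h
    exact h zero_le_one

/-- For `‖v‖ > 1` the difference of the two sides is `(‖v‖ - 1) * (‖v‖ + 1 - 2 * ⟨v, w⟩ / ‖v‖)`, and
`⟨v, w⟩ ≤ ‖v‖` makes the second factor positive. -/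
theorem norm_ballProj_sub_sq_le (v : Vec d) {w : Vec d} (hw : ‖w‖ ≤ 1) :
    ‖ballProj v - w‖ ^ 2 ≤ ‖v - w‖ ^ 2 := by
  unfold ballProj
  split_ifs with h
  · exact le_rfl
  · push Not at h
    have hpos : 0 < ‖v‖ := by linarith
    rw [@norm_sub_sq_real, @norm_sub_sq_real, norm_smul, norm_inv, norm_norm,
      inv_mul_cancel₀ hpos.ne', inner_smul_left]
    have hin : inner ℝ v w ≤ ‖v‖ := (real_inner_le_norm v w).trans
      (mul_le_of_le_one_right hpos.le hw)
    have hx : (‖v‖ - 1) * (‖v‖⁻¹ * inner ℝ v w) ≤ ‖v‖ - 1 := by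
      refine mul_le_of_le_one_right (by linarith) ?_
      rw [inv_mul_le_iff₀ hpos]
      linarith
    have hy : (‖v‖ - 1) * (‖v‖⁻¹ * inner ℝ v w) = inner ℝ v w - ‖v‖⁻¹ * inner ℝ v w := by
      field_simp
    simp only [conj_trivial]
    nlinarith

/-- The usual one-step inequality: drop the projection, expand the square, bound the cross term by
the subgradient inequality, and use that the subgradient has norm at most `1`. -/
theorem norm_sgdPoint_sub_sq_le (h0 : 0 ≤ lam) (h : lam ≤ 1 / 2) {ρ : ℝ} (hρ : 0 ≤ ρ)
    (w : Vec d) {v : Vec d} (hv : ‖v‖ ≤ 1) {e : Example d} (he : ‖e.1‖ ≤ 1) :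
    ‖sgdPoint lam ρ w e - v‖ ^ 2
      ≤ ‖w - v‖ ^ 2 - 2 * ρ * (loss lam w e - loss lam v e) + ρ ^ 2 := by
  refine (norm_ballProj_sub_sq_le _ hv).trans ?_
  have hsub := leakyReLU_subgradient h (labelValue e.2) w v e.1
  set c := leakySlope lam (-labelValue e.2 * inner ℝ w e.1) with hc
  have hc1 : 0 ≤ c ∧ c ≤ 1 := by
    rw [hc]; unfold leakySlope; split_ifs <;> constructor <;> linarith
  have hx : w + (ρ * c * labelValue e.2) • e.1 - v = (w - v) + (ρ * c * labelValue e.2) • e.1 := by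
    abel
  rw [hx, @norm_add_sq_real, inner_smul_right, norm_smul, Real.norm_eq_abs, mul_pow, sq_abs]
  rw [inner_smul_left, conj_trivial] at hsub
  have hl2 : labelValue e.2 ^ 2 = 1 := by rw [← sq_abs, abs_labelValue, one_pow]
  have hin : inner ℝ e.1 (v - w) = -inner ℝ (w - v) e.1 := by
    rw [real_inner_comm, ← neg_sub w v, inner_neg_left]
  rw [hin] at hsub
  have hsub' : loss lam w e + c * labelValue e.2 * inner ℝ (w - v) e.1 ≤ loss lam v e := by
    unfold loss; linarith
  have hlast : (ρ * c * labelValue e.2) ^ 2 * ‖e.1‖ ^ 2 ≤ ρ ^ 2 := by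
    rw [mul_pow, mul_pow, hl2, mul_one]
    have h1 : c ^ 2 ≤ 1 := pow_le_one₀ hc1.1 hc1.2
    have h2 : ‖e.1‖ ^ 2 ≤ 1 := pow_le_one₀ (norm_nonneg _) he
    calc ρ ^ 2 * c ^ 2 * ‖e.1‖ ^ 2 ≤ ρ ^ 2 * 1 * 1 := by gcongr
      _ = ρ ^ 2 := by ring
  have := mul_le_mul_of_nonneg_left hsub' hρ
  nlinarith

variable (Q : Measure (Example d)) [IsProbabilityMeasure Q] (hQ : ∀ᵐ e ∂Q, ‖e.1‖ ≤ 1)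

include hQ in
theorem integrable_loss (h0 : 0 ≤ lam) (h : lam ≤ 1 / 2) (w : Vec d) : Integrable (loss lam w) Q :=
  integrable_of_abs_le Q (measurable_loss_right lam w) (hQ.mono fun _ he => abs_loss_le h0 h w he)

include hQ in
theorem abs_risk_le (h0 : 0 ≤ lam) (h : lam ≤ 1 / 2) (w : Vec d) : |risk Q lam w| ≤ ‖w‖ := by
  have := norm_integral_le_of_norm_le_const (μ := Q) (f := loss lam w) (C := ‖w‖)
    (hQ.mono fun _ he => abs_loss_le h0 h w he)
  simpa [risk] using this

include hQ in
theorem risk_add_le (h0 : 0 ≤ lam) (h : lam ≤ 1 / 2) (v w : Vec d) :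
    risk Q lam (v + w) ≤ risk Q lam v + risk Q lam w := by
  unfold risk
  rw [← integral_add (integrable_loss Q hQ h0 h v) (integrable_loss Q hQ h0 h w)]
  refine integral_mono (integrable_loss Q hQ h0 h _)
    ((integrable_loss Q hQ h0 h v).add (integrable_loss Q hQ h0 h w)) fun e => ?_
  simp only [loss, inner_add_left, mul_add]
  exact leakyReLU_add_le h _ _

omit [IsProbabilityMeasure Q] in
theorem risk_smul (h : lam ≤ 1 / 2) {c : ℝ} (hc : 0 ≤ c) (w : Vec d) :
    risk Q lam (c • w) = c * risk Q lam w := by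
  unfold risk
  rw [← integral_const_mul]
  refine integral_congr_ae (Filter.Eventually.of_forall fun e => ?_)
  simp only [loss, inner_smul_left, conj_trivial, ← leakyReLU_mul hc h]
  ring_nf

omit [IsProbabilityMeasure Q] in
theorem risk_zero (h : lam ≤ 1 / 2) : risk Q lam (0 : Vec d) = 0 := by
  simpa using risk_smul Q h le_rfl (0 : Vec d)

theorem measurable_risk : Measurable (risk (d := d) Q lam) :=
  ((measurable_loss lam).stronglyMeasurable.integral_prod_right' (ν := Q)).measurable

/-- The potential of a state of SGD with respect to the comparison vector `v`. -/
def potential (Q : Measure (Example d)) (lam ρ s : ℝ) (v : Vec d) (st : Vec d × Vec d) : ℝ :=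
  s * (risk Q lam st.2 - risk Q lam st.1) + s / (2 * ρ) * ‖st.1 - v‖ ^ 2

theorem measurable_potential (ρ s : ℝ) (v : Vec d) : Measurable (potential Q lam ρ s v) := by
  have h1 : Measurable fun st : Vec d × Vec d => risk Q lam st.2 :=
    (measurable_risk Q).comp measurable_snd
  have h2 : Measurable fun st : Vec d × Vec d => risk Q lam st.1 :=
    (measurable_risk Q).comp measurable_fst
  have h3 : Measurable fun st : Vec d × Vec d => ‖st.1 - v‖ ^ 2 :=
    ((measurable_fst.sub measurable_const).norm).pow_const 2
  exact ((h1.sub h2).const_mul s).add (h3.const_mul _)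

include hQ in
-- The loss is sampled at the old iterate, but the new one is added to the sum. Subtracting the risk
-- of the current iterate in the potential repairs this shift: subadditivity lets the new iterate's
-- risk cancel, and the old iterate's risk is left to be compared with its sampled loss. The
-- distance term turns the sampled regret against `v` into a telescoping sum.
theorem lintegral_potential_update_le (h0 : 0 ≤ lam) (h : lam ≤ 1 / 2) {ρ s : ℝ} (hρ : 0 < ρ)
    (hs0 : 0 ≤ s) (hs1 : 4 * s ≤ 1) {v : Vec d} (hv : ‖v‖ ≤ 1) (st : Vec d × Vec d)
    (hst : ‖st.1‖ ≤ 1) :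
    ∫⁻ e, ENNReal.ofReal (Real.exp (potential Q lam ρ s v (sgdUpdate lam ρ st e))) ∂Q
      ≤ ENNReal.ofReal (Real.exp (potential Q lam ρ s v st
          + (s * risk Q lam v + s * ρ / 2 + 16 * s ^ 2))) := by
  -- The difference between expected and sampled regret. It is centred, and the division by `4`
  -- makes it bounded by `1`, whence the parameter `4 * s` and the term `16 * s ^ 2`.
  let Z : Example d → ℝ := fun e =>
    ((risk Q lam st.1 - risk Q lam v) - (loss lam st.1 e - loss lam v e)) / 4
  have hZm : Measurable Z :=
    (measurable_const.sub ((measurable_loss_right lam st.1).sub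
      (measurable_loss_right lam v))).div_const 4
  have hZb : ∀ᵐ e ∂Q, |Z e| ≤ 1 := by
    filter_upwards [hQ] with e he
    have a1 := abs_le.1 ((abs_risk_le Q hQ h0 h st.1).trans hst)
    have a2 := abs_le.1 ((abs_risk_le Q hQ h0 h v).trans hv)
    have a3 := abs_le.1 ((abs_loss_le h0 h st.1 he).trans hst)
    have a4 := abs_le.1 ((abs_loss_le h0 h v he).trans hv)
    rw [abs_le]
    constructor <;> simp only [Z] <;> linarith
  have hZ0 : ∫ e, Z e ∂Q = 0 := by
    simp only [Z]
    have i1 := integrable_loss Q hQ h0 h st.1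
    have i2 := integrable_loss Q hQ h0 h v
    have e1 : ∫ e, (risk Q lam st.1 - risk Q lam v - (loss lam st.1 e - loss lam v e)) ∂Q
        = ∫ _, (risk Q lam st.1 - risk Q lam v) ∂Q - ∫ e, (loss lam st.1 e - loss lam v e) ∂Q :=
      integral_sub (integrable_const _) (i1.sub i2)
    rw [integral_div, e1, integral_sub i1 i2]
    simp [risk]
  have hZ2 : ∫ e, Z e ^ 2 ∂Q ≤ 1 := by
    have := integral_mono_of_nonneg (μ := Q) (f := fun e => Z e ^ 2) (g := fun _ => (1 : ℝ))
      (Filter.Eventually.of_forall fun e => sq_nonneg _) (integrable_const _) (by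
        filter_upwards [hZb] with e he
        rw [← sq_abs]
        exact pow_le_one₀ (abs_nonneg _) he)
    simpa using this
  have hpt : ∀ᵐ e ∂Q, potential Q lam ρ s v (sgdUpdate lam ρ st e)
      ≤ (potential Q lam ρ s v st + (s * risk Q lam v + s * ρ / 2)) + 4 * s * Z e := by
    filter_upwards [hQ] with e he
    have h1 := norm_sgdPoint_sub_sq_le h0 h hρ.le st.1 hv he
    have h2 := risk_add_le Q hQ h0 h st.2 (sgdPoint lam ρ st.1 e)
    simp only [potential, sgdUpdate, one_smul, Z]
    have h3 := mul_le_mul_of_nonneg_left h1 (div_nonneg hs0 (by linarith : 0 ≤ 2 * ρ))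
    have h4 : s / (2 * ρ) * (‖st.1 - v‖ ^ 2 - 2 * ρ * (loss lam st.1 e - loss lam v e) + ρ ^ 2)
        = s / (2 * ρ) * ‖st.1 - v‖ ^ 2 - s * (loss lam st.1 e - loss lam v e) + s * ρ / 2 := by
      field_simp
    have h5 := mul_le_mul_of_nonneg_left h2 hs0
    rw [h4] at h3
    nlinarith
  have hmgf := lintegral_exp_le Q hZm hZb (by linarith : 0 ≤ 4 * s) hs1
  set c := potential Q lam ρ s v st + (s * risk Q lam v + s * ρ / 2) with hc
  calc ∫⁻ e, ENNReal.ofReal (Real.exp (potential Q lam ρ s v (sgdUpdate lam ρ st e))) ∂Q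
      ≤ ∫⁻ e, ENNReal.ofReal (Real.exp c) * ENNReal.ofReal (Real.exp (4 * s * Z e)) ∂Q := by
        refine lintegral_mono_ae (hpt.mono fun e he => ?_)
        rw [← ENNReal.ofReal_mul (Real.exp_pos _).le, ← Real.exp_add]
        exact ENNReal.ofReal_le_ofReal (Real.exp_le_exp.2 he)
    _ = ENNReal.ofReal (Real.exp c) * ∫⁻ e, ENNReal.ofReal (Real.exp (4 * s * Z e)) ∂Q :=
        lintegral_const_mul _
          (Real.measurable_exp.comp (measurable_const.mul hZm)).ennreal_ofReal
    _ ≤ ENNReal.ofReal (Real.exp c) * ENNReal.ofReal (Real.exp (16 * s ^ 2)) := by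
        refine mul_le_mul_right (hmgf.trans (ENNReal.ofReal_le_ofReal (Real.exp_le_exp.2 ?_))) _
        rw [hZ0]
        nlinarith [sq_nonneg s]
    _ = _ := by
        rw [← ENNReal.ofReal_mul (Real.exp_pos _).le, ← Real.exp_add, hc]
        ring_nf

/-- An exponential bound for one step of a fold over independent examples gives one for all. -/
theorem lintegral_exp_foldFin_le {σ E : Type} [MeasurableSpace σ] [MeasurableSpace E]
    (P : Measure E) [IsProbabilityMeasure P] {g : σ → E → σ}
    (hg : Measurable fun p : σ × E => g p.1 p.2) {V : σ → ℝ} (hV : Measurable V) {B : ℝ}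
    {I : σ → Prop} (hI : ∀ s x, I s → I (g s x))
    (hstep : ∀ s, I s → ∫⁻ x, ENNReal.ofReal (Real.exp (V (g s x))) ∂P
      ≤ ENNReal.ofReal (Real.exp (V s + B))) (n : ℕ) (s : σ) (hs : I s) :
    ∫⁻ e, ENNReal.ofReal (Real.exp (V (foldFin g n s e))) ∂(Measure.pi fun _ : Fin n => P)
      ≤ ENNReal.ofReal (Real.exp (V s + n * B)) := by
  induction n generalizing s with
  | zero => simp [foldFin]
  | succ n ih =>
    have hm : Measurable fun e : Fin (n + 1) → E =>
        ENNReal.ofReal (Real.exp (V (foldFin g (n + 1) s e))) :=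
      (Real.measurable_exp.comp (hV.comp ((measurable_foldFin hg (n + 1)).comp
        (measurable_const.prodMk measurable_id)))).ennreal_ofReal
    have hm1 : Measurable fun x : E => ENNReal.ofReal (Real.exp (V (g s x))) :=
      (Real.measurable_exp.comp (hV.comp (hg.comp
        (measurable_const.prodMk measurable_id)))).ennreal_ofReal
    rw [lintegral_pi_cons P n hm]
    calc ∫⁻ x, ∫⁻ e, ENNReal.ofReal (Real.exp (V (foldFin g (n + 1) s (Fin.cons x e))))
          ∂(Measure.pi fun _ => P) ∂P
        ≤ ∫⁻ x, ENNReal.ofReal (Real.exp (V (g s x))) * ENNReal.ofReal (Real.exp (n * B)) ∂P := by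
          refine lintegral_mono fun x => ?_
          rw [← ENNReal.ofReal_mul (Real.exp_pos _).le, ← Real.exp_add]
          exact ih (g s x) (hI s x hs)
      _ = (∫⁻ x, ENNReal.ofReal (Real.exp (V (g s x))) ∂P)
            * ENNReal.ofReal (Real.exp (n * B)) := lintegral_mul_const _ hm1
      _ ≤ ENNReal.ofReal (Real.exp (V s + B)) * ENNReal.ofReal (Real.exp (n * B)) := by
          gcongr
          exact hstep s hs
      _ = _ := by
          rw [← ENNReal.ofReal_mul (Real.exp_pos _).le, ← Real.exp_add]
          push_cast
          ring_nf

theorem norm_sgdPoint_le (lam ρ : ℝ) (w : Vec d) (e : Example d) : ‖sgdPoint lam ρ w e‖ ≤ 1 :=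
  norm_ballProj_le _

include hQ in
theorem lintegral_potential_le (h0 : 0 ≤ lam) (h : lam ≤ 1 / 2) {ρ s : ℝ} (hρ : 0 < ρ)
    (hs0 : 0 ≤ s) (hs1 : 4 * s ≤ 1) {v : Vec d} (hv : ‖v‖ ≤ 1) (n : ℕ) (st : Vec d × Vec d)
    (hst : ‖st.1‖ ≤ 1) :
    ∫⁻ e, ENNReal.ofReal (Real.exp (potential Q lam ρ s v (foldFin (sgdUpdate lam ρ) n st e)))
        ∂(Measure.pi fun _ : Fin n => Q)
      ≤ ENNReal.ofReal (Real.exp (potential Q lam ρ s v st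
          + n * (s * risk Q lam v + s * ρ / 2 + 16 * s ^ 2))) :=
  lintegral_exp_foldFin_le Q (measurable_sgdUpdate lam ρ) (measurable_potential Q ρ s v)
    (I := fun st => ‖st.1‖ ≤ 1) (fun _ _ _ => norm_sgdPoint_le _ _ _ _)
    (fun st hst => lintegral_potential_update_le Q hQ h0 h hρ hs0 hs1 hv st hst) n st hst

theorem norm_sgd_sum_le (lam ρ : ℝ) (n : ℕ) (st : Vec d × Vec d) (e : Fin n → Example d) :
    ‖(foldFin (sgdUpdate lam ρ) n st e).2‖ ≤ ‖st.2‖ + n := by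
  induction n generalizing st with
  | zero => simp [foldFin]
  | succ n ih =>
    rw [foldFin]
    refine (ih _ _).trans ?_
    have h1 : ‖(sgdUpdate lam ρ st (e 0)).2‖ ≤ ‖st.2‖ + 1 := by
      simp only [sgdUpdate, one_smul]
      exact (norm_add_le _ _).trans (add_le_add le_rfl (norm_sgdPoint_le _ _ _ _))
    push_cast
    linarith

/-- SGD finds a vector of small risk with high probability. -/
theorem sgdState_risk_bound (hQ : ∀ᵐ e ∂Q, ‖e.1‖ ≤ 1) (h0 : 0 ≤ lam) (h : lam ≤ 1 / 2) {v : Vec d}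
    (hv : ‖v‖ ≤ 1) {q : ℝ} (hq0 : 0 < q) (hq1 : q ≤ 1) (hrisk : risk Q lam v ≤ -q) {n : ℕ}
    (hn : (40 / q) ^ 2 ≤ n) :
    (Measure.pi fun _ : Fin n => Q) {e | -(4 / 5 * q * n) < risk Q lam (sgdState lam n e).2}
      ≤ ENNReal.ofReal (Real.exp (-(q ^ 2 * n / 5000))) := by
  have hnpos : (0 : ℝ) < n := lt_of_lt_of_le (by positivity) hn
  set r := √(n : ℝ) with hr
  have hrpos : 0 < r := Real.sqrt_pos.2 hnpos
  have hr2 : r ^ 2 = n := Real.sq_sqrt hnpos.le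
  have hrq : 40 ≤ q * r := by
    have : 40 / q ≤ r := Real.le_sqrt_of_sq_le hn
    rw [div_le_iff₀ hq0] at this
    linarith
  -- The exponent will be `-(3/20) * s * q * n + 16 * s ^ 2 * n`, which is smallest near `s = q /
  -- 213`; this choice still gives `-(q ^ 2 * n / 5000)`.
  set s := q / 256 with hs
  have hpot := lintegral_potential_le Q hQ h0 h (ρ := 1 / r) (s := s) (by positivity)
    (by positivity) (by rw [hs]; linarith) hv n (0, 0) (by simp)
  have hV0 : potential Q lam (1 / r) s v (0, 0) ≤ s * r / 2 := by
    simp only [potential, risk_zero Q h, zero_sub, norm_neg, sub_zero, mul_zero, zero_add]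
    have : ‖v‖ ^ 2 ≤ 1 := pow_le_one₀ (norm_nonneg _) hv
    calc s / (2 * (1 / r)) * ‖v‖ ^ 2 ≤ s / (2 * (1 / r)) * 1 := by gcongr
      _ = s * r / 2 := by field_simp
  have hm : Measurable fun e : Fin n → Example d =>
      potential Q lam (1 / r) s v (sgdState lam n e) :=
    (measurable_potential Q _ s v).comp (measurable_sgdState lam n)
  have hnorm : ∀ e : Fin n → Example d, ‖(sgdState lam n e).1‖ ≤ 1 := by
    have : ∀ (k : ℕ) (st : Vec d × Vec d) (e : Fin k → Example d), ‖st.1‖ ≤ 1 →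
        ‖(foldFin (sgdUpdate lam (1 / r)) k st e).1‖ ≤ 1 := by
      intro k
      induction k with
      | zero => intro st e h; exact h
      | succ k ih => intro st e _; exact ih _ _ (norm_sgdPoint_le _ _ _ _)
    intro e
    exact this n (0, 0) e (by simp)
  -- The extra `-1` pays for the risk of the last iterate, which the potential subtracts.
  refine (measure_mono fun e he => ?_).trans
    ((measure_le_exp _ hm (a := s * (-(4 / 5 * q * n) - 1)) hpot).trans
      (ENNReal.ofReal_le_ofReal (Real.exp_le_exp.2 ?_)))
  · have h1 : risk Q lam (sgdState lam n e).1 ≤ 1 :=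
      (abs_le.1 ((abs_risk_le Q hQ h0 h _).trans (hnorm e))).2
    have he' : -(4 / 5 * q * n) < risk Q lam (sgdState lam n e).2 := he
    change _ ≤ potential Q lam (1 / r) s v (sgdState lam n e)
    unfold potential
    have h2 : s * (-(4 / 5 * q * n) - 1)
        ≤ s * (risk Q lam (sgdState lam n e).2 - risk Q lam (sgdState lam n e).1) :=
      mul_le_mul_of_nonneg_left (by linarith) (by positivity)
    have h3 : 0 ≤ s / (2 * (1 / r)) * ‖(sgdState lam n e).1 - v‖ ^ 2 := by positivity
    linarith
  · have hnr : (n : ℝ) * (s * (1 / r) / 2) = s * r / 2 := by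
      rw [← hr2]; field_simp
    have h1 : (n : ℝ) * (s * risk Q lam v) ≤ n * (s * -q) := by gcongr
    -- The size of `n` makes the start `s * r / 2`, the step-size terms `s * r / 2` and the extra
    -- `s` together at most a twentieth of `s * q * n`, well below the gap of one fifth between `q`
    -- and `4 / 5 * q`.
    have h3 : r * 40 ≤ q * n := by rw [← hr2]; nlinarith
    have hr1 : 1 ≤ r := by nlinarith
    have h4 : s * r ≤ s * (q * n / 40) := by gcongr; linarith
    have h5 : s * 1 ≤ s * (q * n / 40) := by gcongr; linarith
    have h6 : potential Q lam (1 / r) s v (0, 0)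
        + n * (s * risk Q lam v + s * (1 / r) / 2 + 16 * s ^ 2) - s * (-(4 / 5 * q * n) - 1)
        ≤ s * (q * n / 20) - n * (s * q) / 5 + 16 * s ^ 2 * n := by
      nlinarith
    refine h6.trans ?_
    rw [hs]
    have : 0 < q ^ 2 * n := by positivity
    nlinarith

omit [IsProbabilityMeasure Q] in
-- The risk is positively homogeneous and the average lies in the unit ball, so normalizing only
-- makes a negative risk more negative. Negativity also excludes the average `0`.
theorem risk_sgdVec_le (h : lam ≤ 1 / 2) {q : ℝ} (hq0 : 0 < q) {n : ℕ} (hn : 0 < n)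
    (e : Fin n → Example d) (hrisk : risk Q lam (sgdState lam n e).2 ≤ -(4 / 5 * q * n)) :
    risk Q lam (sgdVec lam n e) ≤ -(4 / 5 * q) ∧ ‖sgdVec lam n e‖ ≤ 1 := by
  have hnpos : (0 : ℝ) < n := Nat.cast_pos.2 hn
  set a := (n : ℝ)⁻¹ • (sgdState lam n e).2 with ha
  have h1 : risk Q lam a ≤ -(4 / 5 * q) := by
    rw [ha, risk_smul Q h (by positivity), inv_mul_le_iff₀ hnpos]
    linarith
  have h2 : ‖a‖ ≤ 1 := by
    rw [ha, norm_smul, norm_inv, Real.norm_natCast, inv_mul_le_iff₀ hnpos, mul_one]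
    have := norm_sgd_sum_le lam (1 / √(n : ℝ)) n (0, 0) e
    rwa [norm_zero, zero_add] at this
  have h3 : a ≠ 0 := by
    intro h0
    rw [h0, risk_zero Q h] at h1
    linarith
  have hpos : 0 < ‖a‖ := norm_pos_iff.2 h3
  constructor
  · change risk Q lam (‖a‖⁻¹ • a) ≤ _
    rw [risk_smul Q h (by positivity), inv_mul_le_iff₀ hpos]
    nlinarith
  · change ‖‖a‖⁻¹ • a‖ ≤ 1
    rw [norm_smul, norm_inv, norm_norm, inv_mul_cancel₀ hpos.ne']

end SGD

/-! ### The optimal risk under Massart noise -/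

section Massart

variable {d : ℕ}

/-- The loss as error minus `lam`, weighted by the margin. Both the risk of the target and the
layer-cake formula for thresholds start from this form. -/
theorem loss_eq (lam : ℝ) (w : Vec d) (e : Example d) :
    loss lam w e = ((if halfspace w e.1 ≠ e.2 then 1 else 0) - lam) * |inner ℝ w e.1| := by
  obtain ⟨x, y⟩ := e
  simp only [loss, leakyReLU, halfspace, labelValue]
  rcases lt_trichotomy (inner ℝ w x) 0 with h | h | h
  · cases y <;> simp [h.not_ge, h.le, abs_of_neg h]
  · cases y <;> simp [h]
  · cases y <;> simp [h.not_ge, h.le, abs_of_pos h]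

/-- Given `x`, the expected loss of the target is `(flip x - lam) * |⟨wstar, x⟩|`, at most `-δ * γ`
because `flip x ≤ η` and the margin is at least `γ`. The set `S` restricts `x` only and leaves the
law of the label given `x` intact, so the bound integrates over it. -/
theorem setIntegral_loss_le {D : Measure (Example d)} [IsProbabilityMeasure D] {wstar : Vec d}
    {η γ δ : ℝ} (hη : 0 ≤ η) (hγ : 0 < γ) (hδ : 0 < δ) (hlam : η + δ ≤ 1 / 2)
    (hnorm : ‖wstar‖ = 1) (hmargin : HasMargin D wstar γ) (hD : IsMassart D (halfspace wstar) η)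
    {S : Set (Vec d)} (hS : MeasurableSet S) :
    ∫ e in Prod.fst ⁻¹' S, loss (η + δ) wstar e ∂D ≤ -(γ * δ) * D.real (Prod.fst ⁻¹' S) := by
  obtain ⟨flip, hfm, hf, hDeq⟩ := hD
  set μ := D.fst with hμ
  set lam := η + δ with hlamdef
  let φ : Example d → ℝ := fun e => S.indicator 1 e.1 * (loss lam wstar e + γ * δ)
  have hSm : Measurable (S.indicator (1 : Vec d → ℝ)) := measurable_one.indicator hS
  have hφm : Measurable φ :=
    (hSm.comp measurable_fst).mul ((measurable_loss_right lam wstar).add measurable_const)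
  have hin : Measurable fun x : Vec d => |inner ℝ wstar x| := (measurable_const.inner measurable_id).abs
  have hxm : MeasurableSet {x : Vec d | ‖x‖ ≤ 1 ∧ γ ≤ |inner ℝ wstar x|} :=
    (measurableSet_le measurable_norm measurable_const).inter (measurableSet_le measurable_const hin)
  have hμx : ∀ᵐ x ∂μ, ‖x‖ ≤ 1 ∧ γ ≤ |inner ℝ wstar x| :=
    (ae_map_iff measurable_fst.aemeasurable hxm).2 hmargin
  have hS01 : ∀ x, 0 ≤ S.indicator (1 : Vec d → ℝ) x ∧ S.indicator (1 : Vec d → ℝ) x ≤ 1 := by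
    intro x
    by_cases hx : x ∈ S <;> simp [hx]
  have hD1 : ∀ᵐ e ∂D, ‖e.1‖ ≤ 1 := hmargin.mono fun e he => he.1
  have hlossint := integrable_loss D hD1 (by linarith : 0 ≤ lam) hlam wstar
  have hφint : Integrable φ D := by
    refine integrable_of_abs_le D hφm (B := 1 + γ * δ) ?_
    filter_upwards [hD1] with e he
    have h1 := (abs_loss_le (by linarith : 0 ≤ lam) hlam wstar he).trans hnorm.le
    have h2 : |loss lam wstar e + γ * δ| ≤ 1 + γ * δ :=
      (abs_add_le _ _).trans (add_le_add h1 (abs_of_pos (by positivity)).le)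
    rw [abs_mul, abs_of_nonneg (hS01 e.1).1]
    exact (mul_le_of_le_one_left (abs_nonneg _) (hS01 e.1).2).trans h2
  have hhalf : Measurable (halfspace wstar) :=
    measurable_halfspace.comp (measurable_const.prodMk measurable_id)
  have hg1 : Measurable fun x : Vec d => (x, halfspace wstar x) := measurable_id.prodMk hhalf
  have hg2 : Measurable fun x : Vec d => (x, !halfspace wstar x) :=
    measurable_id.prodMk ((measurable_of_finite fun b : Bool => !b).comp hhalf)
  have hd1 : Measurable fun x => ENNReal.ofReal (1 - flip x) :=
    (measurable_const.sub hfm).ennreal_ofReal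
  have hd2 : Measurable fun x => ENNReal.ofReal (flip x) := hfm.ennreal_ofReal
  have hle1 : (μ.withDensity fun x => ENNReal.ofReal (1 - flip x)).map
      (fun x => (x, halfspace wstar x)) ≤ D := by
    conv_rhs => rw [hDeq]
    exact Measure.le_add_right le_rfl
  have hle2 : (μ.withDensity fun x => ENNReal.ofReal (flip x)).map
      (fun x => (x, !halfspace wstar x)) ≤ D := by
    conv_rhs => rw [hDeq]
    exact Measure.le_add_left le_rfl
  -- The clean and the flipped part of `D` are integrated separately and pulled back to the
  -- marginal. Both pulled-back integrands are then combined pointwise in `x`.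
  have hsum : ∫ e, φ e ∂D
      = ∫ x, (1 - flip x) * φ (x, halfspace wstar x) ∂μ
        + ∫ x, flip x * φ (x, !halfspace wstar x) ∂μ := by
    have e0 : ∫ e, φ e ∂D = ∫ e, φ e ∂_ := congrArg (fun m => ∫ e, φ e ∂m) hDeq
    rw [e0, integral_add_measure (hφint.mono_measure hle1) (hφint.mono_measure hle2),
      integral_map hg1.aemeasurable hφm.aestronglyMeasurable,
      integral_map hg2.aemeasurable hφm.aestronglyMeasurable,
      integral_withDensity_eq_integral_toReal_smul hd1 (by simp),
      integral_withDensity_eq_integral_toReal_smul hd2 (by simp)]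
    have hη1 : η ≤ 1 := by linarith
    congr 1 <;> refine integral_congr_ae (Filter.Eventually.of_forall fun x => ?_)
    · simp only [smul_eq_mul]
      rw [ENNReal.toReal_ofReal (by linarith [(hf x).2])]
    · simp only [smul_eq_mul]
      rw [ENNReal.toReal_ofReal (hf x).1]
  have hφ1 : ∀ x, φ (x, halfspace wstar x)
      = S.indicator 1 x * (-lam * |inner ℝ wstar x| + γ * δ) := by
    intro x; simp only [φ, loss_eq]; simp
  have hφ2 : ∀ x, φ (x, !halfspace wstar x)
      = S.indicator 1 x * ((1 - lam) * |inner ℝ wstar x| + γ * δ) := by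
    intro x; simp only [φ, loss_eq]; simp
  have hbd : ∀ (c : Vec d → ℝ) (b : ℝ), Measurable c → (∀ x, |c x| ≤ 1) → |b| ≤ 1 →
      Integrable (fun x => c x * (S.indicator 1 x * (b * |inner ℝ wstar x| + γ * δ))) μ := by
    intro c b hc hc1 hb1
    refine integrable_of_abs_le μ (hc.mul (hSm.mul ((hin.const_mul b).add measurable_const)))
      (B := 1 + γ * δ) ?_
    filter_upwards [hμx] with x hx
    have h1 : |inner ℝ wstar x| ≤ 1 := (abs_real_inner_le_norm wstar x).trans (by
      rw [hnorm, one_mul]; exact hx.1)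
    have h2 : |b * |inner ℝ wstar x| + γ * δ| ≤ 1 + γ * δ := by
      refine (abs_add_le _ _).trans (add_le_add ?_ (abs_of_pos (by positivity)).le)
      rw [abs_mul, abs_abs]
      exact mul_le_one₀ hb1 (abs_nonneg _) h1
    rw [abs_mul, abs_mul, abs_of_nonneg (hS01 x).1]
    calc |c x| * (S.indicator 1 x * |b * |inner ℝ wstar x| + γ * δ|)
        ≤ 1 * (1 * (1 + γ * δ)) := by
          gcongr
          · exact mul_nonneg (hS01 x).1 (abs_nonneg _)
          · exact hc1 x
          · exact (hS01 x).2
      _ = 1 + γ * δ := by ring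
  have hφle : ∫ e, φ e ∂D ≤ 0 := by
    rw [hsum]
    simp only [hφ1, hφ2]
    rw [← integral_add]
    · refine integral_nonpos_of_ae ?_
      filter_upwards [hμx] with x hx
      have h1 := (hf x).2
      have h3 : (η + δ - flip x) * |inner ℝ wstar x| ≥ δ * γ := by
        calc δ * γ ≤ δ * |inner ℝ wstar x| := by gcongr; exact hx.2
          _ ≤ _ := by gcongr; linarith
      have h2 : (1 - flip x) * (S.indicator 1 x * (-lam * |inner ℝ wstar x| + γ * δ))
          + flip x * (S.indicator 1 x * ((1 - lam) * |inner ℝ wstar x| + γ * δ))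
          = S.indicator 1 x * (γ * δ - (η + δ - flip x) * |inner ℝ wstar x|) := by
        rw [hlamdef]; ring
      simp only [Pi.zero_apply]
      rw [h2]
      exact mul_nonpos_of_nonneg_of_nonpos (hS01 x).1 (by linarith)
    · refine hbd _ _ (measurable_const.sub hfm) (fun x => ?_) ?_
      · rw [abs_le]; constructor <;> linarith [(hf x).1, (hf x).2]
      · rw [abs_le]; constructor <;> linarith
    · refine hbd _ _ hfm (fun x => ?_) ?_
      · rw [abs_le]; constructor <;> linarith [(hf x).1, (hf x).2]
      · rw [abs_le]; constructor <;> linarith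
  have hA : MeasurableSet (Prod.fst ⁻¹' S : Set (Example d)) := measurable_fst hS
  have hφset : ∫ e, φ e ∂D = ∫ e in Prod.fst ⁻¹' S, (loss lam wstar e + γ * δ) ∂D := by
    rw [← integral_indicator hA]
    refine integral_congr_ae (Filter.Eventually.of_forall fun e => ?_)
    by_cases he : e.1 ∈ S
    · simp [φ, he]
    · simp [φ, he]
  rw [hφset, integral_add hlossint.integrableOn (integrable_const _), setIntegral_const,
    smul_eq_mul] at hφle
  linarith

/-- The risk of the target vector in the distribution conditioned on an unclassified region. -/
theorem risk_cond_le {D : Measure (Example d)} [IsProbabilityMeasure D] {wstar : Vec d}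
    {η γ δ : ℝ} (hη : 0 ≤ η) (hγ : 0 < γ) (hδ : 0 < δ) (hlam : η + δ ≤ 1 / 2)
    (hnorm : ‖wstar‖ = 1) (hmargin : HasMargin D wstar γ) (hD : IsMassart D (halfspace wstar) η)
    {S : Set (Vec d)} (hS : MeasurableSet S) (h0 : D (Prod.fst ⁻¹' S) ≠ 0) :
    risk (ProbabilityTheory.cond D (Prod.fst ⁻¹' S)) (η + δ) wstar ≤ -(γ * δ) := by
  have h := setIntegral_loss_le hη hγ hδ hlam hnorm hmargin hD hS
  have hpos : 0 < D.real (Prod.fst ⁻¹' S) := ENNReal.toReal_pos h0 (measure_ne_top _ _)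
  rw [risk, ProbabilityTheory.cond, integral_smul_measure, ENNReal.toReal_inv, smul_eq_mul]
  change (D.real (Prod.fst ⁻¹' S))⁻¹ * _ ≤ _
  rw [inv_mul_le_iff₀ hpos]
  linarith

end Massart

/-! ### Thresholds -/

section Threshold

variable {d : ℕ}

/-- The examples of margin at least `T` with respect to `w`. -/
def marginSet (w : Vec d) (T : ℝ) : Set (Example d) := {e | T ≤ |inner ℝ w e.1|}

/-- The examples that are misclassified by `w`. -/
def wrongSet (w : Vec d) : Set (Example d) := {e | halfspace w e.1 ≠ e.2}

/-- The excess over `c` of the error of `w` on the examples of margin at least `T`. -/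
def excess (c : ℝ) (w : Vec d) (T : ℝ) (e : Example d) : ℝ :=
  if T ≤ |inner ℝ w e.1| then (if halfspace w e.1 ≠ e.2 then 1 else 0) - c else 0

theorem measurable_absInner (w : Vec d) : Measurable fun e : Example d => |inner ℝ w e.1| :=
  (measurable_const.inner measurable_fst).abs

theorem measurableSet_marginSet (w : Vec d) (T : ℝ) : MeasurableSet (marginSet w T) :=
  measurableSet_le measurable_const (measurable_absInner w)

theorem measurableSet_wrongSet (w : Vec d) : MeasurableSet (wrongSet w) := by
  have h : Measurable fun e : Example d => (halfspace w e.1, e.2) :=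
    (measurable_halfspace.comp (measurable_const.prodMk measurable_fst)).prodMk measurable_snd
  exact h (MeasurableSet.of_discrete (s := {b : Bool × Bool | b.1 ≠ b.2}))

theorem measurable_excess (c : ℝ) (w : Vec d) :
    Measurable fun p : ℝ × Example d => excess c w p.1 p.2 := by
  refine Measurable.ite (measurableSet_le measurable_fst
    ((measurable_absInner w).comp measurable_snd)) ?_ measurable_const
  exact (Measurable.ite (measurable_snd (measurableSet_wrongSet w)) measurable_const
    measurable_const).sub measurable_const

theorem measurable_excess_right (c : ℝ) (w : Vec d) (T : ℝ) : Measurable (excess c w T) :=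
  (measurable_excess c w).comp (measurable_const.prodMk measurable_id)

theorem abs_excess_le {c : ℝ} (h0 : 0 ≤ c) (h1 : c ≤ 1) (w : Vec d) (T : ℝ) (e : Example d) :
    |excess c w T e| ≤ 1 := by
  unfold excess
  split_ifs <;> rw [abs_le] <;> constructor <;> linarith

theorem excess_sq_le {c : ℝ} (h0 : 0 ≤ c) (h1 : c ≤ 1) (w : Vec d) (T : ℝ) (e : Example d) :
    excess c w T e ^ 2 ≤ (marginSet w T).indicator 1 e := by
  by_cases h : T ≤ |inner ℝ w e.1|
  · rw [Set.indicator_of_mem (show e ∈ marginSet w T from h), ← sq_abs]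
    exact pow_le_one₀ (abs_nonneg _) (abs_excess_le h0 h1 w T e)
  · rw [Set.indicator_of_notMem (show e ∉ marginSet w T from h)]
    simp [excess, h]

theorem excess_eq (c : ℝ) (w : Vec d) (T : ℝ) (e : Example d) :
    excess c w T e = (marginSet w T ∩ wrongSet w).indicator 1 e
      - c * (marginSet w T).indicator 1 e := by
  by_cases h : T ≤ |inner ℝ w e.1| <;> by_cases h' : halfspace w e.1 = e.2 <;>
    simp [excess, marginSet, wrongSet, h, h']

variable (Q : Measure (Example d)) [IsProbabilityMeasure Q]

theorem integral_excess (c : ℝ) (w : Vec d) (T : ℝ) :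
    ∫ e, excess c w T e ∂Q
      = Q.real (marginSet w T ∩ wrongSet w) - c * Q.real (marginSet w T) := by
  have hm := measurableSet_marginSet w T
  have hw := hm.inter (measurableSet_wrongSet w)
  simp only [excess_eq]
  rw [integral_sub, integral_const_mul, integral_indicator_one hw, integral_indicator_one hm]
  · exact (integrable_const (1 : ℝ)).indicator hw
  · exact ((integrable_const (1 : ℝ)).indicator hm).const_mul c

/-- Layer cake: the thresholds in `(0, 1]` that lie below the margin form an interval whose length
is the margin. -/
theorem setIntegral_excess (c : ℝ) (w : Vec d) (e : Example d) (h : |inner ℝ w e.1| ≤ 1) :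
    ∫ T in Set.Ioc (0 : ℝ) 1, excess c w T e = loss c w e := by
  set a := |inner ℝ w e.1| with ha
  have ha0 : 0 ≤ a := abs_nonneg _
  have heq : ∀ T, excess c w T e
      = (Set.Iic a).indicator (fun _ => (if halfspace w e.1 ≠ e.2 then 1 else 0) - c) T := by
    intro T
    by_cases hT : T ≤ a <;> simp [excess, ← ha, hT]
  simp only [heq]
  rw [integral_indicator measurableSet_Iic, Measure.restrict_restrict measurableSet_Iic,
    Set.inter_comm, Set.Ioc_inter_Iic, min_eq_right h, setIntegral_const, loss_eq, ← ha]
  simp [ha0, mul_comm]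

/-- If the risk is very negative, the error is small beyond some threshold. -/
theorem exists_threshold (hQ : ∀ᵐ e ∂Q, ‖e.1‖ ≤ 1) {lam : ℝ} (h0 : 0 ≤ lam) (h : lam ≤ 1 / 2)
    {w : Vec d} (hw : ‖w‖ ≤ 1) {b : ℝ} (hrisk : risk Q lam w < -b) :
    ∃ T, ∫ e, excess lam w T e ∂Q < -b := by
  -- By Fubini the risk is the average over `T ∈ (0, 1]` of the expected excess, so the excess
  -- cannot be at least `-b` for all `T`.
  by_contra! hne
  have hprob : IsProbabilityMeasure (volume.restrict (Set.Ioc (0 : ℝ) 1)) :=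
    ⟨by simp⟩
  have hint : Integrable (Function.uncurry fun (e : Example d) (T : ℝ) => excess lam w T e)
      (Q.prod (volume.restrict (Set.Ioc (0 : ℝ) 1))) :=
    integrable_of_abs_le _ ((measurable_excess lam w).comp measurable_swap) (B := 1)
      (Filter.Eventually.of_forall fun p => abs_excess_le h0 (by linarith) w _ _)
  have hswap := integral_integral_swap hint
  have hleft : ∫ e, (∫ T in Set.Ioc (0 : ℝ) 1, excess lam w T e) ∂Q = risk Q lam w := by
    refine integral_congr_ae ?_
    filter_upwards [hQ] with e he
    exact setIntegral_excess lam w e ((abs_real_inner_le_norm w e.1).trans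
      (mul_le_one₀ hw (norm_nonneg _) he))
  have hright : -b ≤ ∫ T in Set.Ioc (0 : ℝ) 1, ∫ e, excess lam w T e ∂Q := by
    have := integral_mono (μ := volume.restrict (Set.Ioc (0 : ℝ) 1)) (f := fun _ => -b)
      (integrable_const _) hint.integral_prod_right hne
    simpa using this
  linarith

/-! ### The empirical choice of a threshold -/

/-- The threshold `T` has empirical mass at least `q`. -/
def Feasible (q : ℝ) (S : List (ℝ × Bool)) (T : ℝ) : Prop :=
  q ≤ (countAbove S T : ℝ) / S.length

/-- The empirical error beyond the threshold `T`. -/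
def empErr (S : List (ℝ × Bool)) (T : ℝ) : ℝ := (countWrong S T : ℝ) / countAbove S T

/-- The loop invariant: the state is a feasible candidate with its error, and no feasible candidate
seen so far does better. The processed prefix `l` grows at its end while the counts stay those of
`S`. -/
theorem foldl_improve (q : ℝ) (S l : List (ℝ × Bool)) :
    (∀ v, l.foldl (improve q S) none = some v →
        ∃ p ∈ l, Feasible q S p.1 ∧ v = (p.1, empErr S p.1)) ∧
      ∀ p ∈ l, Feasible q S p.1 →
        ∃ v, l.foldl (improve q S) none = some v ∧ v.2 ≤ empErr S p.1 := by
  induction l using List.reverseRecOn with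
  | nil => simp
  | append_singleton l p ih =>
    obtain ⟨ih1, ih2⟩ := ih
    rw [List.foldl_append, List.foldl_cons, List.foldl_nil]
    generalize l.foldl (improve q S) none = best at ih1 ih2
    have hcase : (improve q S best p = some (p.1, empErr S p.1) ∧ Feasible q S p.1 ∧
          ∀ v, best = some v → empErr S p.1 ≤ v.2) ∨
        (improve q S best p = best ∧
          (Feasible q S p.1 → ∃ v, best = some v ∧ v.2 ≤ empErr S p.1)) := by
      unfold improve
      split_ifs with hc
      · refine Or.inl ⟨rfl, hc.1, fun v hv => ?_⟩
        subst hv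
        have := hc.2
        simp only [Option.elim_some, decide_eq_true_eq] at this
        exact this.le
      · refine Or.inr ⟨rfl, fun hf => ?_⟩
        rcases best with _ | v
        · exact absurd ⟨hf, rfl⟩ hc
        · refine ⟨v, rfl, not_lt.1 fun hlt => hc ⟨hf, ?_⟩⟩
          exact decide_eq_true hlt
    rcases hcase with ⟨he, hf, hle⟩ | ⟨he, hle⟩
    · rw [he]
      refine ⟨fun v hv => ⟨p, by simp, hf, (Option.some.inj hv).symm⟩, fun p' hp' hf' => ?_⟩
      refine ⟨_, rfl, ?_⟩
      rcases List.mem_append.1 hp' with h | h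
      · obtain ⟨v, hv, hv2⟩ := ih2 p' h hf'
        exact (hle v hv).trans hv2
      · rw [List.mem_singleton.1 h]
    · rw [he]
      refine ⟨fun v hv => ?_, fun p' hp' hf' => ?_⟩
      · obtain ⟨p', hp', h⟩ := ih1 v hv
        exact ⟨p', by simp [hp'], h⟩
      · rcases List.mem_append.1 hp' with h | h
        · exact ih2 p' h hf'
        · rw [List.mem_singleton.1 h] at hf' ⊢
          exact hle hf'

/-- If some threshold is feasible with empirical error at most `c`, then the chosen one is a recorded
value with the same properties. -/
theorem threshold_spec {q c : ℝ} (hq : 0 < q) {S : List (ℝ × Bool)} {T : ℝ} (hT : Feasible q S T)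
    (hc : empErr S T ≤ c) :
    (∃ p ∈ S, threshold q S = p.1) ∧ Feasible q S (threshold q S) ∧
      empErr S (threshold q S) ≤ c := by
  have hne : (S.filter fun p => decide (T ≤ p.1)) ≠ [] := by
    intro h
    have : countAbove S T = 0 := by
      rw [countAbove, List.countP_eq_length_filter, h, List.length_nil]
    rw [Feasible, this] at hT
    simp at hT
    linarith
  -- The smallest recorded value that is at least `T` selects the same records as `T`, so `T` may be
  -- replaced by it.
  obtain ⟨p, hp⟩ : ∃ p, (S.filter fun p => decide (T ≤ p.1)).argmin Prod.fst = some p := by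
    rcases h : (S.filter fun p => decide (T ≤ p.1)).argmin Prod.fst with _ | p
    · exact absurd (List.argmin_eq_none.1 h) hne
    · exact ⟨p, h⟩
  have hpmem := List.argmin_mem hp
  rw [List.mem_filter] at hpmem
  have hTp : T ≤ p.1 := by simpa using hpmem.2
  have hmin : ∀ p' ∈ S, (T ≤ p'.1 ↔ p.1 ≤ p'.1) := fun p' hp' =>
    ⟨fun h => List.le_of_mem_argmin (List.mem_filter.2 ⟨hp', by simpa using h⟩) hp,
      fun h => hTp.trans h⟩
  have h1 : countAbove S T = countAbove S p.1 :=
    List.countP_congr fun p' hp' => by simp [hmin p' hp']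
  have h2 : countWrong S T = countWrong S p.1 :=
    List.countP_congr fun p' hp' => by simp [hmin p' hp']
  have hf : Feasible q S p.1 := by rwa [Feasible, ← h1]
  have he : empErr S p.1 ≤ c := by rwa [empErr, ← h1, ← h2]
  obtain ⟨hA, hB⟩ := foldl_improve q S S
  obtain ⟨v, hv, hv2⟩ := hB p hpmem.1 hf
  obtain ⟨p', hp', hf', hv'⟩ := hA v hv
  have hthr : threshold q S = p'.1 := by rw [threshold, hv, hv']; rfl
  refine ⟨⟨p', hp', hthr⟩, by rwa [hthr], ?_⟩
  rw [hthr]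
  rw [hv'] at hv2
  exact hv2.trans he

end Threshold

/-! ### Uniform convergence over the recorded thresholds -/

section UniformConvergence

variable {d : ℕ}

theorem countP_finRange (m : ℕ) (p : Fin m → Bool) :
    ((List.finRange m).countP p : ℝ) = ∑ i, if p i = true then (1 : ℝ) else 0 := by
  have : ∀ l : List (Fin m), (l.countP p : ℝ) = (l.map fun i => if p i = true then (1 : ℝ) else 0).sum := by
    intro l
    induction l with
    | nil => simp
    | cons i l ih =>
      rw [List.countP_cons, List.map_cons, List.sum_cons, Nat.cast_add, ih]
      split_ifs <;> simp [add_comm]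
  rw [this, ← List.ofFn_eq_map, List.sum_ofFn]

theorem countAbove_records (w : Vec d) (m : ℕ) (e : Fin m → Example d) (T : ℝ) :
    (countAbove (records w m e) T : ℝ) = ∑ i, (marginSet w T).indicator 1 (e i) := by
  rw [countAbove, records_eq, List.countP_reverse, List.countP_map, countP_finRange]
  refine Finset.sum_congr rfl fun i _ => ?_
  by_cases h : T ≤ |inner ℝ w (e i).1| <;> simp [record, marginSet, h]

theorem countWrong_records (w : Vec d) (m : ℕ) (e : Fin m → Example d) (T : ℝ) :
    (countWrong (records w m e) T : ℝ) = ∑ i, (marginSet w T ∩ wrongSet w).indicator 1 (e i) := by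
  rw [countWrong, records_eq, List.countP_reverse, List.countP_map, countP_finRange]
  refine Finset.sum_congr rfl fun i _ => ?_
  by_cases h : T ≤ |inner ℝ w (e i).1| <;> by_cases h' : halfspace w (e i).1 = (e i).2 <;>
    simp [record, marginSet, wrongSet, h, h']

/-- Turns a bound `c` on the empirical error into the sign of a sum of bounded independent terms, to
which Chernoff's bound applies. -/
theorem sum_excess_records (c : ℝ) (w : Vec d) (m : ℕ) (e : Fin m → Example d) (T : ℝ) :
    ∑ i, excess c w T (e i)
      = countWrong (records w m e) T - c * countAbove (records w m e) T := by
  simp only [excess_eq, Finset.sum_sub_distrib, ← Finset.mul_sum, countAbove_records,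
    countWrong_records]

/-- The rule `(w, T)` covers enough mass, with error at most `c` on what it covers. -/
def GoodRule (Q : Measure (Example d)) (c q : ℝ) (r : Vec d × ℝ) : Prop :=
  q / 2 ≤ Q.real (marginSet r.1 r.2) ∧
    Q.real (marginSet r.1 r.2 ∩ wrongSet r.1) ≤ c * Q.real (marginSet r.1 r.2)

variable (Q : Measure (Example d)) [IsProbabilityMeasure Q]

omit [IsProbabilityMeasure Q] in
theorem integral_indicator_marginSet (w : Vec d) (T : ℝ) :
    ∫ e, (marginSet w T).indicator 1 e ∂Q = Q.real (marginSet w T) :=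
  integral_indicator_one (measurableSet_marginSet w T)

theorem integral_excess_sq_le {c : ℝ} (h0 : 0 ≤ c) (h1 : c ≤ 1) (w : Vec d) (T : ℝ) :
    ∫ e, excess c w T e ^ 2 ∂Q ≤ Q.real (marginSet w T) := by
  rw [← integral_indicator_marginSet]
  refine integral_mono_of_nonneg (Filter.Eventually.of_forall fun e => sq_nonneg _)
    ((integrable_const (1 : ℝ)).indicator (measurableSet_marginSet w T))
    (Filter.Eventually.of_forall fun e => excess_sq_le h0 h1 w T e)

theorem abs_indicator_one_le {E : Type} (A : Set E) (e : E) : |A.indicator (1 : E → ℝ) e| ≤ 1 := by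
  by_cases h : e ∈ A <;> simp [h]

theorem indicator_one_sq {E : Type} (A : Set E) (e : E) :
    A.indicator (1 : E → ℝ) e ^ 2 = A.indicator 1 e := by
  by_cases h : e ∈ A <;> simp [h]

theorem measurable_indicator_marginSet (w : Vec d) (T : ℝ) :
    Measurable ((marginSet w T).indicator (1 : Example d → ℝ)) :=
  measurable_one.indicator (measurableSet_marginSet w T)

variable {lam δ q : ℝ}

/-- A bad threshold does not look good on `k` independent examples. -/
theorem bad_threshold_le (h0 : 0 ≤ lam) (h : lam ≤ 1 / 2) (hδ0 : 0 < δ) (hδ1 : δ ≤ 1 / 2)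
    (hq0 : 0 < q) (hq1 : q ≤ 1) (w : Vec d) (T : ℝ)
    (hbad : ¬ GoodRule Q (lam + 3 * δ) q (w, T)) (k : ℕ) :
    (Measure.pi fun _ : Fin k => Q) {e | q * (k + 1) ≤ 1 + ∑ i, (marginSet w T).indicator 1 (e i) ∧
        ∑ i, excess (lam + δ) w T (e i) ≤ 1}
      ≤ ENNReal.ofReal (Real.exp (1 - (k + 1) * (δ ^ 2 * q / 32))) := by
  have hk : (0 : ℝ) ≤ k := Nat.cast_nonneg k
  have hδ2 : δ ^ 2 ≤ 1 := by nlinarith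
  set p := Q.real (marginSet w T) with hp
  -- A bad rule of mass at least `q / 2` has error above `lam + 3 * δ`, so its excess over `lam + δ`
  -- has mean at least `2 * δ * p` and second moment at most `p`; the parameter `δ / 2` fits.
  -- Otherwise the mass is below `q / 2` and the empirical mass is about twice too large. The two
  -- `1`s in the event leave room for one example that has been set aside.
  by_cases hp2 : q / 2 ≤ p
  · have hex : 0 < ∫ e, excess (lam + 3 * δ) w T e ∂Q := by
      rw [integral_excess]
      by_contra! hle
      exact hbad ⟨hp2, by linarith⟩
    have hmean : ∫ e, -excess (lam + δ) w T e ∂Q ≤ -(2 * δ * p) := by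
      rw [integral_neg, integral_excess]
      rw [integral_excess] at hex
      linarith
    have hsq : ∫ e, (-excess (lam + δ) w T e) ^ 2 ∂Q ≤ p := by
      simp only [neg_sq]
      exact integral_excess_sq_le Q (by linarith) (by linarith) w T
    refine (measure_mono fun e he => ?_).trans ((chernoff Q
      (measurable_excess_right (lam + δ) w T).neg (Filter.Eventually.of_forall fun e => ?_)
      (by linarith : 0 ≤ δ / 2) (by linarith) hmean hsq k (-1)).trans
      (ENNReal.ofReal_le_ofReal (Real.exp_le_exp.2 ?_)))
    · have := he.2
      simp only [Set.mem_ofPred_eq, Pi.neg_apply, Finset.sum_neg_distrib]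
      linarith
    · rw [Pi.neg_apply, abs_neg]
      exact abs_excess_le (by linarith) (by linarith) w T e
    · have h1 : (k : ℝ) * (δ ^ 2 * (q / 2)) ≤ k * (δ ^ 2 * p) := by gcongr
      have h2 : δ ^ 2 * q ≤ 1 := mul_le_one₀ hδ2 hq0.le hq1
      have h3 : 0 ≤ (k : ℝ) * (δ ^ 2 * q) := by positivity
      have h4 : k * (δ / 2 * -(2 * δ * p) + (δ / 2) ^ 2 * p) - δ / 2 * -1
          = -(3 / 4) * (k * (δ ^ 2 * p)) + δ / 2 := by ring
      have h5 : 1 - (k + 1) * (δ ^ 2 * q / 32)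
          = 1 - k * (δ ^ 2 * q) / 32 - δ ^ 2 * q / 32 := by ring
      rw [h4, h5]
      linarith
  · push Not at hp2
    refine (measure_mono fun e he => ?_).trans ((chernoff Q (measurable_indicator_marginSet w T)
      (Filter.Eventually.of_forall fun e => abs_indicator_one_le _ e)
      (by norm_num : (0 : ℝ) ≤ 1 / 2) (by norm_num) (a := q / 2) (b := q / 2) ?_ ?_ k
      (q * (k + 1) - 1)).trans (ENNReal.ofReal_le_ofReal (Real.exp_le_exp.2 ?_)))
    · have := he.1
      simp only [Set.mem_ofPred_eq]
      linarith
    · rw [integral_indicator_marginSet]; exact hp2.le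
    · simp only [indicator_one_sq]
      rw [integral_indicator_marginSet]; exact hp2.le
    · have h1 : (k + 1 : ℝ) * (δ ^ 2 * q) ≤ (k + 1) * q := by
        gcongr; exact mul_le_of_le_one_left hq0.le hδ2
      nlinarith

/-- Both masses decrease as the threshold grows, and monotone functions are measurable. -/
theorem measurableSet_goodRule (c q : ℝ) (w : Vec d) :
    MeasurableSet {T : ℝ | GoodRule Q c q (w, T)} := by
  have h1 : Measurable fun T => Q.real (marginSet w T) :=
    Antitone.measurable fun T T' h => measureReal_mono fun e (he : T' ≤ _) => h.trans he
  have h2 : Measurable fun T => Q.real (marginSet w T ∩ wrongSet w) :=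
    Antitone.measurable fun T T' h =>
      measureReal_mono (Set.inter_subset_inter_left _ fun e (he : T' ≤ _) => h.trans he)
  exact (measurableSet_le measurable_const h1).inter (measurableSet_le h2 (h1.const_mul c))

/-- The bound of `bad_threshold_le` for the threshold recorded from the `j`-th example. -/
theorem bad_record_le (h0 : 0 ≤ lam) (h : lam ≤ 1 / 2) (hδ0 : 0 < δ) (hδ1 : δ ≤ 1 / 2)
    (hq0 : 0 < q) (hq1 : q ≤ 1) (w : Vec d) (k : ℕ) (j : Fin (k + 1)) :
    (Measure.pi fun _ : Fin (k + 1) => Q)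
      {e | ¬ GoodRule Q (lam + 3 * δ) q (w, |inner ℝ w (e j).1|) ∧
        q * (k + 1) ≤ ∑ i, (marginSet w |inner ℝ w (e j).1|).indicator 1 (e i) ∧
        ∑ i, excess (lam + δ) w |inner ℝ w (e j).1| (e i) ≤ 0}
      ≤ ENNReal.ofReal (Real.exp (1 - (k + 1) * (δ ^ 2 * q / 32))) := by
  -- The `j`-th example is split off. Once it is given, the threshold is a fixed number and the
  -- other `k` examples are independent of it; its own contribution to either sum is at most `1` in
  -- absolute value.
  let C : Set (Example d × (Fin k → Example d)) :=
    {p | ¬ GoodRule Q (lam + 3 * δ) q (w, |inner ℝ w p.1.1|) ∧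
      q * (k + 1) ≤ 1 + ∑ i, (marginSet w |inner ℝ w p.1.1|).indicator 1 (p.2 i) ∧
      ∑ i, excess (lam + δ) w |inner ℝ w p.1.1| (p.2 i) ≤ 1}
  have ha : Measurable fun p : Example d × (Fin k → Example d) => |inner ℝ w p.1.1| :=
    (measurable_absInner w).comp measurable_fst
  have hC : MeasurableSet C := by
    have hx : ∀ i, Measurable fun p : Example d × (Fin k → Example d) => p.2 i := fun i =>
      (measurable_pi_apply i).comp measurable_snd
    have hs : ∀ i, Measurable fun p : Example d × (Fin k → Example d) =>
        (marginSet w |inner ℝ w p.1.1|).indicator (1 : Example d → ℝ) (p.2 i) := fun i =>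
      (measurable_const (a := (1 : ℝ))).indicator
        (measurableSet_le ha ((measurable_absInner w).comp (hx i)))
    have hex : ∀ i, Measurable fun p : Example d × (Fin k → Example d) =>
        excess (lam + δ) w |inner ℝ w p.1.1| (p.2 i) := fun i =>
      (measurable_excess (lam + δ) w).comp (ha.prodMk (hx i))
    have h1 : MeasurableSet {p : Example d × (Fin k → Example d) | q * (k + 1)
        ≤ 1 + ∑ i, (marginSet w |inner ℝ w p.1.1|).indicator (1 : Example d → ℝ) (p.2 i)} :=
      measurableSet_le measurable_const
        (Measurable.add measurable_const (Finset.measurable_sum _ fun i _ => hs i))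
    have h2 : MeasurableSet {p : Example d × (Fin k → Example d) |
        ∑ i, excess (lam + δ) w |inner ℝ w p.1.1| (p.2 i) ≤ 1} :=
      measurableSet_le (Finset.measurable_sum _ fun i _ => hex i) measurable_const
    exact (ha (measurableSet_goodRule Q _ _ w).compl).inter (h1.inter h2)
  have hmp := measurePreserving_piFinSuccAbove (fun _ : Fin (k + 1) => Q) j
  refine (measure_mono (t := (MeasurableEquiv.piFinSuccAbove (fun _ => Example d) j) ⁻¹' C)
    fun e he => ?_).trans ?_
  · obtain ⟨h1, h2, h3⟩ := he
    rw [Fin.sum_univ_succAbove _ j] at h2 h3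
    refine ⟨h1, ?_, ?_⟩
    · refine h2.trans (add_le_add ?_ le_rfl)
      exact (le_abs_self _).trans (abs_indicator_one_le _ _)
    · have := (abs_le.1 (abs_excess_le (by linarith : 0 ≤ lam + δ) (by linarith) w
        |inner ℝ w (e j).1| (e j))).1
      change ∑ i : Fin k, excess (lam + δ) w |inner ℝ w (e j).1| (e (j.succAbove i)) ≤ 1
      linarith
  · rw [hmp.measure_preimage hC.nullMeasurableSet, Measure.prod_apply hC]
    refine (lintegral_mono (g := fun _ =>
      ENNReal.ofReal (Real.exp (1 - (k + 1) * (δ ^ 2 * q / 32)))) fun x => ?_).trans (by simp)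
    by_cases hx : GoodRule Q (lam + 3 * δ) q (w, |inner ℝ w x.1|)
    · have : Prod.mk x ⁻¹' C = ∅ := Set.eq_empty_of_forall_notMem fun e he => he.1 hx
      rw [this, measure_empty]
      exact zero_le
    · exact (measure_mono fun e he => he.2).trans
        (bad_threshold_le Q h0 h hδ0 hδ1 hq0 hq1 w _ hx k)

/-- With high probability, the threshold found for a vector of small risk makes a good rule. -/
theorem threshold_bad_le (hQ : ∀ᵐ e ∂Q, ‖e.1‖ ≤ 1) (h0 : 0 ≤ lam) (h : lam ≤ 1 / 2) (hδ0 : 0 < δ)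
    (hδ1 : δ ≤ 1 / 2) (hq0 : 0 < q) (hq1 : q ≤ 1) {w : Vec d} (hw : ‖w‖ ≤ 1)
    (hrisk : risk Q lam w ≤ -(4 / 5 * q)) {m : ℕ} (hm : 0 < m) :
    (Measure.pi fun _ : Fin m => Q)
      {e | ¬ GoodRule Q (lam + 3 * δ) q (w, threshold q (records w m e))}
      ≤ ENNReal.ofReal ((m + 2) * Real.exp (1 - m * (δ ^ 2 * q / 32))) := by
  obtain ⟨k, rfl⟩ := Nat.exists_eq_succ_of_ne_zero hm.ne'
  -- Passing from `4/5` to `3/4` provides the strict inequality. As `lam ≤ 1/2`, a mean excess below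
  -- `-(3/4) * q` forces mass at least `(3/2) * q`, which leaves room above the empirical mass `q`
  -- that is required.
  obtain ⟨T, hT⟩ := exists_threshold Q hQ h0 h hw (b := 3 / 4 * q) (by linarith)
  set P := (Measure.pi fun _ : Fin (k + 1) => Q) with hP
  set R := ENNReal.ofReal (Real.exp (1 - ((k + 1 : ℕ) : ℝ) * (δ ^ 2 * q / 32))) with hR
  have hδ2 : δ ^ 2 ≤ 1 := by nlinarith
  have hmpos : (0 : ℝ) < ((k + 1 : ℕ) : ℝ) := by positivity
  set M := ((k + 1 : ℕ) : ℝ) with hM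
  set p := Q.real (marginSet w T) with hp
  have hint := integral_excess Q lam w T
  have hwr : 0 ≤ Q.real (marginSet w T ∩ wrongSet w) := measureReal_nonneg
  have hp15 : 3 / 2 * q ≤ p := by
    have : lam * p ≤ 1 / 2 * p := by gcongr
    linarith
  have hqm : M * (δ ^ 2 * q) ≤ M * q := by
    gcongr; exact mul_le_of_le_one_left hq0.le hδ2
  have hqm0 : 0 < M * q := by positivity
  have hA : P {e | (0 : ℝ) ≤ ∑ i, excess (lam + δ) w T (e i)} ≤ R := by
    -- The excess over `lam` is already negative, and raising the level to `lam + δ` gains `δ` on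
    -- the whole mass `p`.
    have hmean : ∫ e, excess (lam + δ) w T e ∂Q ≤ -(δ * p) := by
      rw [integral_excess]; linarith
    refine (chernoff Q (measurable_excess_right (lam + δ) w T)
      (Filter.Eventually.of_forall fun e => abs_excess_le (by linarith) (by linarith) w T e)
      (by linarith : 0 ≤ δ / 2) (by linarith) hmean
      (integral_excess_sq_le Q (by linarith) (by linarith) w T) (k + 1) 0).trans
      (ENNReal.ofReal_le_ofReal (Real.exp_le_exp.2 ?_))
    have h1 : M * (δ ^ 2 * (3 / 2 * q)) ≤ M * (δ ^ 2 * p) := by gcongr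
    nlinarith
  have hB : P {e | -(q * M) ≤ ∑ i, -(marginSet w T).indicator (1 : Example d → ℝ) (e i)} ≤ R := by
    refine (chernoff Q (measurable_indicator_marginSet w T).neg
      (Filter.Eventually.of_forall fun e => ?_)
      (by norm_num : (0 : ℝ) ≤ 1 / 4) (by norm_num) (a := -p) (b := p) ?_ ?_ (k + 1)
      (-(q * M))).trans (ENNReal.ofReal_le_ofReal (Real.exp_le_exp.2 ?_))
    · rw [Pi.neg_apply, abs_neg]
      exact abs_indicator_one_le _ e
    · simp only [Pi.neg_apply]
      rw [integral_neg, integral_indicator_marginSet]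
    · simp only [Pi.neg_apply, neg_sq, indicator_one_sq]
      rw [integral_indicator_marginSet]
    · have h1 : M * (3 / 2 * q) ≤ M * p := by gcongr
      nlinarith
  have hC : ∀ j : Fin (k + 1), P {e | ¬ GoodRule Q (lam + 3 * δ) q (w, |inner ℝ w (e j).1|) ∧
        q * (k + 1) ≤ ∑ i, (marginSet w |inner ℝ w (e j).1|).indicator 1 (e i) ∧
        ∑ i, excess (lam + δ) w |inner ℝ w (e j).1| (e i) ≤ 0} ≤ R := by
    intro j
    have := bad_record_le Q h0 h hδ0 hδ1 hq0 hq1 w k j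
    rw [hR, hM]
    push_cast
    exact this
  -- If `T` looks as good on the sample as it should, then the chosen threshold is a recorded value
  -- that looks at least as good. A bad choice therefore means that some record is bad but looks
  -- good.
  have hsub : {e | ¬ GoodRule Q (lam + 3 * δ) q (w, threshold q (records w (k + 1) e))} ⊆
      ({e | (0 : ℝ) ≤ ∑ i, excess (lam + δ) w T (e i)} ∪
        {e | -(q * M) ≤ ∑ i, -(marginSet w T).indicator (1 : Example d → ℝ) (e i)}) ∪
      ⋃ j : Fin (k + 1), {e | ¬ GoodRule Q (lam + 3 * δ) q (w, |inner ℝ w (e j).1|) ∧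
        q * (k + 1) ≤ ∑ i, (marginSet w |inner ℝ w (e j).1|).indicator 1 (e i) ∧
        ∑ i, excess (lam + δ) w |inner ℝ w (e j).1| (e i) ≤ 0} := by
    intro e he
    by_contra hne
    simp only [Set.mem_union, Set.mem_iUnion, not_or, not_exists] at hne
    obtain ⟨⟨hne1, hne2⟩, hne3⟩ := hne
    have hne1' : ∑ i, excess (lam + δ) w T (e i) < 0 := not_le.1 hne1
    have hne2' : ∑ i, -(marginSet w T).indicator (1 : Example d → ℝ) (e i) < -(q * M) :=
      not_le.1 hne2
    rw [Finset.sum_neg_distrib, neg_lt_neg_iff, ← countAbove_records] at hne2'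
    rw [sum_excess_records] at hne1'
    have hlen : ((records w (k + 1) e).length : ℝ) = M := by rw [length_records]
    have hca : ∀ {T' : ℝ}, Feasible q (records w (k + 1) e) T' →
        q * M ≤ countAbove (records w (k + 1) e) T' := fun {T'} hf => by
      rw [Feasible, hlen, le_div_iff₀ hmpos] at hf
      exact hf
    have hfeas : Feasible q (records w (k + 1) e) T := by
      rw [Feasible, hlen, le_div_iff₀ hmpos]
      exact hne2'.le
    have hemp : empErr (records w (k + 1) e) T ≤ lam + δ := by
      have hpos : (0 : ℝ) < countAbove (records w (k + 1) e) T := by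
        linarith
      rw [empErr, div_le_iff₀ hpos]
      linarith
    obtain ⟨⟨r, hr, hthr⟩, hf, herr⟩ := threshold_spec hq0 hfeas hemp
    rw [records_eq, List.mem_reverse, List.mem_map] at hr
    obtain ⟨j, _, rfl⟩ := hr
    have hthr' : threshold q (records w (k + 1) e) = |inner ℝ w (e j).1| := hthr
    refine hne3 j ⟨by rw [← hthr']; exact he, ?_, ?_⟩
    · rw [← countAbove_records, ← hthr']
      have := hca hf
      rw [hM] at this
      push_cast at this
      exact this
    · rw [sum_excess_records, ← hthr']
      have hpos := hca hf
      have hpos' : (0 : ℝ) < countAbove (records w (k + 1) e)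
        (threshold q (records w (k + 1) e)) := by linarith
      rw [empErr, div_le_iff₀ hpos'] at herr
      linarith
  calc P {e | ¬ GoodRule Q (lam + 3 * δ) q (w, threshold q (records w (k + 1) e))}
      ≤ (R + R) + ∑ _j : Fin (k + 1), R := by
        refine (measure_mono hsub).trans ((measure_union_le _ _).trans (add_le_add
          ((measure_union_le _ _).trans (add_le_add hA hB)) ?_))
        exact (measure_iUnion_fintype_le _ _).trans (Finset.sum_le_sum fun j _ => hC j)
    _ = ENNReal.ofReal ((M + 2) * Real.exp (1 - M * (δ ^ 2 * q / 32))) := by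
        rw [Finset.sum_const, Finset.card_univ, Fintype.card_fin, nsmul_eq_mul,
          ENNReal.ofReal_mul (by positivity), ENNReal.ofReal_add hmpos.le (by norm_num), hM,
          ENNReal.ofReal_natCast, ← hR]
        norm_num
        ring

end UniformConvergence

/-! ### The main loop as a function of the stream -/

section MainLoop

variable {d : ℕ}

/-- The initial sample misjudges whether the unclassified region is still large. -/
def Misjudged (D : Measure (Example d)) (δ : ℝ) (X : List (Vec d)) (L : DecisionList d) : Prop :=
  (δ ≤ (uncoveredCount X L : ℝ) / X.length ∧ D.real (unclassified L) < δ / 2) ∨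
    ((uncoveredCount X L : ℝ) / X.length < δ ∧ 2 * δ < D.real (unclassified L))

/-- The rule `r` covers enough of the unclassified region, with error at most `c` there. -/
def GoodStep (D : Measure (Example d)) (c q : ℝ) (L : DecisionList d) (r : Vec d × ℝ) : Prop :=
  q / 2 * D.real (unclassified L) ≤ D.real (unclassified L ∩ marginSet r.1 r.2) ∧
    D.real (unclassified L ∩ (marginSet r.1 r.2 ∩ wrongSet r.1))
      ≤ c * D.real (unclassified L ∩ marginSet r.1 r.2)

open Classical in
/-- The indicator of a proposition. -/
def ind (p : Prop) : ℝ≥0∞ := if p then 1 else 0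

theorem ind_le_one (p : Prop) : ind p ≤ 1 := by
  unfold ind; split_ifs <;> simp

theorem not_of_ind_lt_one {p : Prop} (h : ind p < 1) : ¬ p := by
  intro hp
  simp [ind, hp] at h

open Classical in
/-- An upper bound for the failure of the next `i` rounds of the main loop: it counts the misjudgments
and the bad rules, and charges `β` for every example. -/
def failCost (D : Measure (Example d)) (lam c q δ : ℝ) (β : ℝ≥0∞) (n m : ℕ) (X : List (Vec d)) :
    ℕ → DecisionList d → (ℕ → Example d) → ℝ≥0∞
  | 0, L, _ => ind (Misjudged D δ X L)
  | i + 1, L, ω => ind (Misjudged D δ X L) + if D.real (unclassified L) < δ / 2 then 0 else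
    β * (fetchCost (unclassified L) n ω
        + fetchCost (unclassified L) m (fetch (unclassified L) n ω).2)
      + ind (¬ GoodStep D c q L (nextRule lam q n m (fetch (unclassified L) n ω).1
          (fetch (unclassified L) m (fetch (unclassified L) n ω).2).1))
      + failCost D lam c q δ β n m X i
          (L ++ [nextRule lam q n m (fetch (unclassified L) n ω).1
            (fetch (unclassified L) m (fetch (unclassified L) n ω).2).1])
          (fetch (unclassified L) m (fetch (unclassified L) n ω).2).2

theorem unclassified_append (L : DecisionList d) (r : Vec d × ℝ) :
    unclassified (L ++ [r]) = unclassified L \ marginSet r.1 r.2 := by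
  ext e
  simp only [unclassified, Covered, marginSet, Set.mem_sdiff, Set.mem_ofPred_eq, List.mem_append,
    List.mem_singleton]
  constructor
  · intro h
    exact ⟨fun ⟨s, hs, h'⟩ => h ⟨s, Or.inl hs, h'⟩, fun h' => h ⟨r, Or.inr rfl, h'⟩⟩
  · rintro ⟨h1, h2⟩ ⟨s, hs | rfl, h'⟩
    · exact h1 ⟨s, hs, h'⟩
    · exact h2 h'

/-- The error of the list `R` on the region that is unclassified by `L`. -/
def ListErrorLE (D : Measure (Example d)) (L R : DecisionList d) (B : ℝ) : Prop :=
  ∀ g : Vec d → Bool, D.real {e | e ∈ unclassified L ∧ R.classify g e.1 ≠ e.2} ≤ B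

variable (D : Measure (Example d)) [IsProbabilityMeasure D]

theorem real_unclassified_append (L : DecisionList d) (r : Vec d × ℝ) :
    D.real (unclassified L ∩ marginSet r.1 r.2) + D.real (unclassified (L ++ [r]))
      = D.real (unclassified L) := by
  rw [unclassified_append]
  exact measureReal_inter_add_sdiff (measurableSet_marginSet r.1 r.2)

theorem listErrorLE_nil (L : DecisionList d) : ListErrorLE D L [] (D.real (unclassified L)) :=
  fun _ => measureReal_mono fun _ he => he.1

/-- The first rule errs on at most `c` times the mass it removes, the other rules on `c` times the
mass that remains. These masses add up, and the leftover `b` is passed on unchanged. -/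
theorem listErrorLE_cons {c q b : ℝ} {L R : DecisionList d} {r : Vec d × ℝ}
    (hr : GoodStep D c q L r)
    (hR : ListErrorLE D (L ++ [r]) R (c * D.real (unclassified (L ++ [r])) + b)) :
    ListErrorLE D L (r :: R) (c * D.real (unclassified L) + b) := by
  intro g
  have hsub : {e : Example d | e ∈ unclassified L ∧ DecisionList.classify g (r :: R) e.1 ≠ e.2} ⊆
      (unclassified L ∩ (marginSet r.1 r.2 ∩ wrongSet r.1)) ∪
        {e | e ∈ unclassified (L ++ [r]) ∧ DecisionList.classify g R e.1 ≠ e.2} := by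
    rintro e ⟨he, hne⟩
    obtain ⟨w, T⟩ := r
    rw [DecisionList.classify] at hne
    by_cases hT : T ≤ |inner ℝ w e.1|
    · rw [if_pos hT] at hne
      exact Or.inl ⟨he, hT, hne⟩
    · rw [if_neg hT] at hne
      exact Or.inr ⟨by rw [unclassified_append]; exact ⟨he, hT⟩, hne⟩
  have h1 := (measureReal_mono hsub (μ := D)).trans (measureReal_union_le _ _)
  have h2 := hR g
  have h3 := hr.2
  have h4 := real_unclassified_append D L r
  rw [← h4]
  linarith

variable {lam c q δ : ℝ} {β : ℝ≥0∞} {n m : ℕ} {X : List (Vec d)}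

theorem roundSteps_mono (d n m x : ℕ) {l l' : ℕ} (h : l ≤ l') :
    roundSteps d n m x l ≤ roundSteps d n m x l' := by
  unfold roundSteps; gcongr

theorem drawSteps_mono (d : ℕ) {l l' : ℕ} (h : l ≤ l') : drawSteps d l ≤ drawSteps d l' := by
  unfold drawSteps; gcongr

/-- The conclusion about a run of the main loop. -/
def LoopGood (D : Measure (Example d)) (lam c q δ : ℝ) (n m : ℕ) (X : List (Vec d)) (i : ℕ)
    (L : DecisionList d) (ω : ℕ → Example d) (R : DecisionList d) (j : ℕ) : Prop :=
  Yields (Comp.loop (mainBody lam q δ n m X) L) ω (L ++ R) j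
      ((i + 1) * roundSteps d n m X.length (L.length + i) + j * drawSteps d (L.length + i)) ∧
    ListErrorLE D L R (c * D.real (unclassified L) + 2 * δ)

/-- A correct decision to stop leaves mass at most `2 * δ`, so the arbitrary predictions may all be
wrong there. -/
theorem loopGood_exit (hc : 0 ≤ c) (i : ℕ) (L : DecisionList d) (ω : ℕ → Example d)
    (hfrac : ¬ δ ≤ (uncoveredCount X L : ℝ) / X.length) (hmis : ¬ Misjudged D δ X L) :
    LoopGood D lam c q δ n m X i L ω [] 0 := by
  have hmass : D.real (unclassified L) ≤ 2 * δ := by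
    by_contra! h
    exact hmis (Or.inr ⟨not_le.1 hfrac, h⟩)
  refine ⟨?_, fun g => (listErrorLE_nil D L g).trans ?_⟩
  · rw [List.append_nil]
    refine (yields_loop_exit (yields_mainBody_exit lam q δ n m X L ω hfrac)).mono ?_
    have := roundSteps_mono d n m X.length (Nat.le_add_right L.length i)
    nlinarith
  · have : 0 ≤ c * D.real (unclassified L) := mul_nonneg hc measureReal_nonneg
    linarith

/-- Below cost `1` no indicator is active. The cost continues as long as the true mass is at least
`δ / 2`, whatever the sample `X` says; without misjudgments the actual run is an initial piece of
this. The hypothesis `hmass` says that `i` good rules bring the mass below `δ / 2`, where a correct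
judgment ends the loop. -/
theorem loopGood_of_failCost_lt_one (hc : 0 ≤ c) (hβ : β ≠ 0) (hq : q ≤ 2) (i : ℕ)
    (L : DecisionList d) (ω : ℕ → Example d)
    (hF : failCost D lam c q δ β n m X i L ω < 1)
    (hmass : D.real (unclassified L) * (1 - q / 2) ^ i < δ / 2) :
    ∃ (R : DecisionList d) (j : ℕ), β * (j : ℝ≥0∞) ≤ failCost D lam c q δ β n m X i L ω ∧
      LoopGood D lam c q δ n m X i L ω R j := by
  induction i generalizing L ω with
  | zero =>
    have hmis : ¬ Misjudged D δ X L := not_of_ind_lt_one hF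
    refine ⟨[], 0, by simp, loopGood_exit D hc 0 L ω (fun h => hmis (Or.inl ⟨h, ?_⟩)) hmis⟩
    simpa using hmass
  | succ i ih =>
    have hmis : ¬ Misjudged D δ X L := by
      refine not_of_ind_lt_one (lt_of_le_of_lt ?_ hF)
      rw [failCost]
      exact le_self_add
    by_cases hfrac : δ ≤ (uncoveredCount X L : ℝ) / X.length
    swap
    · exact ⟨[], 0, by simp, loopGood_exit D hc (i + 1) L ω hfrac hmis⟩
    have hlarge : ¬ D.real (unclassified L) < δ / 2 := fun h => hmis (Or.inl ⟨hfrac, h⟩)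
    rw [failCost, if_neg hlarge] at hF ⊢
    set f₁ := fetch (unclassified L) n ω with hf₁
    set f₂ := fetch (unclassified L) m f₁.2 with hf₂
    set r := nextRule lam q n m f₁.1 f₂.1 with hr
    have hle1 : β * (fetchCost (unclassified L) n ω + fetchCost (unclassified L) m f₁.2) < 1 :=
      lt_of_le_of_lt (le_add_left (le_add_right le_self_add)) hF
    have hle2 : ind (¬ GoodStep D c q L r) < 1 :=
      lt_of_le_of_lt (le_add_left (le_add_right le_add_self)) hF
    have hle3 : failCost D lam c q δ β n m X i (L ++ [r]) f₂.2 < 1 :=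
      lt_of_le_of_lt (le_add_left le_add_self) hF
    have hgood : GoodStep D c q L r := not_not.1 (not_of_ind_lt_one hle2)
    -- The charge per draw is positive, so a cost below `1` excludes infinitely many draws; this is
    -- the termination of the round.
    have hfin : fetchCost (unclassified L) n ω + fetchCost (unclassified L) m f₁.2 < ∞ := by
      refine lt_top_iff_ne_top.2 fun htop => ?_
      rw [htop, ENNReal.mul_top hβ] at hle1
      exact absurd hle1 (by simp)
    rw [ENNReal.add_lt_top] at hfin
    obtain ⟨j, hj, hdrop, hy⟩ := yields_mainBody_next lam q δ n m X L ω hfrac hfin.1 hfin.2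
    have hmass' : D.real (unclassified (L ++ [r])) * (1 - q / 2) ^ i < δ / 2 := by
      refine lt_of_le_of_lt ?_ hmass
      have h1 := real_unclassified_append D L r
      have h2 := hgood.1
      have h3 : D.real (unclassified (L ++ [r])) ≤ D.real (unclassified L) * (1 - q / 2) := by
        linarith
      calc D.real (unclassified (L ++ [r])) * (1 - q / 2) ^ i
          ≤ D.real (unclassified L) * (1 - q / 2) * (1 - q / 2) ^ i := by
            gcongr
            exact pow_nonneg (by linarith) i
        _ = _ := by ring
    obtain ⟨R, j', hj', hyR, herr⟩ := ih (L ++ [r]) f₂.2 hle3 hmass'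
    refine ⟨r :: R, j + j', ?_, ?_, listErrorLE_cons D hgood herr⟩
    · rw [Nat.cast_add, mul_add]
      exact le_add_left (add_le_add (le_add_right (by gcongr)) hj')
    · rw [← hdrop] at hyR
      rw [List.append_assoc] at hyR
      refine (yields_loop_next hy hyR).mono ?_
      have hlen : (L ++ [r]).length + i = L.length + (i + 1) := by
        simp only [List.length_append, List.length_singleton]; omega
      rw [hlen]
      have h1 := roundSteps_mono d n m X.length (Nat.le_add_right L.length (i + 1))
      have h2 := Nat.mul_le_mul_left j (drawSteps_mono d (Nat.le_add_right L.length (i + 1)))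
      nlinarith

end MainLoop

/-! ### Measurability of the failure cost -/

section FailCostMeasurable

variable {d : ℕ} {Θ : Type} [MeasurableSpace Θ]

theorem measurable_ind {p : Θ → Prop} (hp : MeasurableSet {θ | p θ}) :
    Measurable fun θ => ind (p θ) := by
  classical
  exact Measurable.ite hp measurable_const measurable_const

theorem lintegral_ind (μ : Measure Θ) {p : Θ → Prop} (hp : MeasurableSet {θ | p θ}) :
    ∫⁻ θ, ind (p θ) ∂μ = μ {θ | p θ} := by
  rw [← lintegral_indicator_one hp]
  refine lintegral_congr fun θ => ?_
  by_cases h : p θ <;> simp [ind, h]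

theorem length_samplePoints (N : ℕ) (x : Fin N → Example d) : (samplePoints N x).length = N := by
  rw [samplePoints, length_foldFin_cons]; simp

theorem uncoveredCount_samplePoints (N : ℕ) (x : Fin N → Example d) (L : DecisionList d) :
    (uncoveredCount (samplePoints N x) L : ℝ) = ∑ i, (unclassified L).indicator 1 (x i) := by
  rw [uncoveredCount, samplePoints, foldFin_cons_eq, List.append_nil, List.countP_reverse,
    List.countP_map, countP_finRange]
  refine Finset.sum_congr rfl fun i _ => ?_
  by_cases h : Covered L (x i).1 <;> simp [unclassified, h]

variable (D : Measure (Example d)) [IsProbabilityMeasure D] {L : List (Θ → Vec d × ℝ)}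

theorem measurable_real_section {s : Set (Θ × Example d)} (hs : MeasurableSet s) :
    Measurable fun θ => D.real (Prod.mk θ ⁻¹' s) :=
  (measurable_measure_prodMk_left hs).ennreal_toReal

theorem measurable_real_unclassified (hL : ∀ f ∈ L, Measurable f) :
    Measurable fun θ => D.real (unclassified (L.map fun f => f θ)) :=
  measurable_real_section D (measurableSet_unclassified_map L hL)

theorem measurableSet_misjudged (hL : ∀ f ∈ L, Measurable f) (δ : ℝ) (N : ℕ) :
    MeasurableSet {p : Θ × (Fin N → Example d) |
      Misjudged D δ (samplePoints N p.2) (L.map fun f => f p.1)} := by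
  have h1 : Measurable fun p : Θ × (Fin N → Example d) =>
      (uncoveredCount (samplePoints N p.2) (L.map fun f => f p.1) : ℝ)
        / (samplePoints N p.2).length := by
    simp only [uncoveredCount_samplePoints, length_samplePoints]
    refine Measurable.div_const (Finset.measurable_sum _ fun i _ => ?_) _
    have h : Measurable fun p : Θ × (Fin N → Example d) => (p.1, p.2 i) :=
      measurable_fst.prodMk ((measurable_pi_apply i).comp measurable_snd)
    exact (measurable_const (a := (1 : ℝ))).indicator (h (measurableSet_unclassified_map L hL))
  have h2 : Measurable fun p : Θ × (Fin N → Example d) =>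
      D.real (unclassified (L.map fun f => f p.1)) :=
    (measurable_real_unclassified D hL).comp measurable_fst
  exact ((measurableSet_le measurable_const h1).inter (measurableSet_lt h2 measurable_const)).union
    ((measurableSet_lt h1 measurable_const).inter (measurableSet_lt measurable_const h2))

theorem measurableSet_goodStep (hL : ∀ f ∈ L, Measurable f) (c q : ℝ) {r : Θ → Vec d × ℝ}
    (hr : Measurable r) : MeasurableSet {θ | GoodStep D c q (L.map fun f => f θ) (r θ)} := by
  have hU := measurableSet_unclassified_map L hL
  have hi : Measurable fun p : Θ × Example d => |inner ℝ (r p.1).1 p.2.1| :=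
    ((hr.fst.comp measurable_fst).inner measurable_snd.fst).abs
  have hM : MeasurableSet {p : Θ × Example d | p.2 ∈ marginSet (r p.1).1 (r p.1).2} :=
    measurableSet_le (hr.snd.comp measurable_fst) hi
  have hh : Measurable fun p : Θ × Example d => (halfspace (r p.1).1 p.2.1, p.2.2) :=
    (measurable_halfspace.comp ((hr.fst.comp measurable_fst).prodMk measurable_snd.fst)).prodMk
      measurable_snd.snd
  have hW : MeasurableSet {p : Θ × Example d | p.2 ∈ wrongSet (r p.1).1} :=
    hh (MeasurableSet.of_discrete (s := {b : Bool × Bool | b.1 ≠ b.2}))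
  have h1 := measurable_real_section D hU
  have h2 := measurable_real_section D (hU.inter hM)
  have h3 := measurable_real_section D (hU.inter (hM.inter hW))
  exact (measurableSet_le (h1.const_mul (q / 2)) h2).inter (measurableSet_le h3 (h2.const_mul c))

/-- Each round enlarges the parameter space by the stopping sample and the stream, on which the new
rule is one more measurable function. The induction therefore quantifies over `Θ`. -/
theorem measurable_failCost (lam c q δ : ℝ) (β : ℝ≥0∞) (n m N : ℕ) (i : ℕ) :
    ∀ {Θ : Type} [MeasurableSpace Θ] {L : List (Θ → Vec d × ℝ)} (_ : ∀ f ∈ L, Measurable f),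
    Measurable fun p : Θ × (Fin N → Example d) × (ℕ → Example d) =>
      failCost D lam c q δ β n m (samplePoints N p.2.1) i (L.map fun f => f p.1) p.2.2 := by
  classical
  induction i with
  | zero =>
    intro Θ _ L hL
    have h : Measurable fun p : Θ × (Fin N → Example d) × (ℕ → Example d) => (p.1, p.2.1) :=
      measurable_fst.prodMk measurable_snd.fst
    exact measurable_ind (h (measurableSet_misjudged D hL δ N))
  | succ i ih =>
    intro Θ _ L hL
    let A : Θ → Set (Example d) := fun θ => unclassified (L.map fun f => f θ)
    have hU : MeasurableSet {p : Θ × Example d | p.2 ∈ A p.1} := measurableSet_unclassified_map L hL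
    have hXm : Measurable fun p : Θ × (Fin N → Example d) × (ℕ → Example d) => (p.1, p.2.1) :=
      measurable_fst.prodMk measurable_snd.fst
    have hω : Measurable fun p : Θ × (Fin N → Example d) × (ℕ → Example d) => (p.1, p.2.2) :=
      measurable_fst.prodMk measurable_snd.snd
    have hf₁ : Measurable fun p : Θ × (Fin N → Example d) × (ℕ → Example d) =>
        fetch (unclassified (L.map fun f => f p.1)) n p.2.2 :=
      (measurable_fetch (A := A) hU n).comp hω
    have hω₁ : Measurable fun p : Θ × (Fin N → Example d) × (ℕ → Example d) =>
        (p.1, (fetch (unclassified (L.map fun f => f p.1)) n p.2.2).2) :=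
      measurable_fst.prodMk hf₁.snd
    have hf₂ : Measurable fun p : Θ × (Fin N → Example d) × (ℕ → Example d) =>
        fetch (unclassified (L.map fun f => f p.1)) m
          (fetch (unclassified (L.map fun f => f p.1)) n p.2.2).2 :=
      (measurable_fetch (A := A) hU m).comp hω₁
    have hc₁ : Measurable fun p : Θ × (Fin N → Example d) × (ℕ → Example d) =>
        fetchCost (unclassified (L.map fun f => f p.1)) n p.2.2 :=
      (measurable_fetchCost (A := A) hU n).comp hω
    have hc₂ : Measurable fun p : Θ × (Fin N → Example d) × (ℕ → Example d) =>
        fetchCost (unclassified (L.map fun f => f p.1)) m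
          (fetch (unclassified (L.map fun f => f p.1)) n p.2.2).2 :=
      (measurable_fetchCost (A := A) hU m).comp hω₁
    have hr : Measurable fun p : Θ × (Fin N → Example d) × (ℕ → Example d) =>
        nextRule lam q n m (fetch (unclassified (L.map fun f => f p.1)) n p.2.2).1
          (fetch (unclassified (L.map fun f => f p.1)) m
            (fetch (unclassified (L.map fun f => f p.1)) n p.2.2).2).1 :=
      measurable_nextRule lam q n m hf₁.fst hf₂.fst
    have hmis : Measurable fun p : Θ × (Fin N → Example d) × (ℕ → Example d) =>
        ind (Misjudged D δ (samplePoints N p.2.1) (L.map fun f => f p.1)) :=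
      measurable_ind (hXm (measurableSet_misjudged D hL δ N))
    have hlt : MeasurableSet {p : Θ × (Fin N → Example d) × (ℕ → Example d) |
        D.real (unclassified (L.map fun f => f p.1)) < δ / 2} :=
      measurableSet_lt ((measurable_real_unclassified D hL).comp measurable_fst) measurable_const
    have hL' : ∀ f ∈ L.map (fun f => fun p : Θ × (Fin N → Example d) × (ℕ → Example d) => f p.1),
        Measurable f := by
      intro f hf
      obtain ⟨g, hg, rfl⟩ := List.mem_map.1 hf
      exact (hL g hg).comp measurable_fst
    have hgood := (measurableSet_goodStep D hL' c q hr).compl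
    simp only [List.map_map, Function.comp_def] at hgood
    have hL'' : ∀ f ∈ L.map (fun f => fun p : Θ × (Fin N → Example d) × (ℕ → Example d) => f p.1)
        ++ [fun p : Θ × (Fin N → Example d) × (ℕ → Example d) =>
        nextRule lam q n m (fetch (unclassified (L.map fun f => f p.1)) n p.2.2).1
          (fetch (unclassified (L.map fun f => f p.1)) m
            (fetch (unclassified (L.map fun f => f p.1)) n p.2.2).2).1], Measurable f := by
      intro f hf
      rcases List.mem_append.1 hf with hf | hf
      · exact hL' f hf
      · rw [List.mem_singleton.1 hf]
        exact hr
    have hrec := ih hL''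
    simp only [List.map_append, List.map_map, Function.comp_def, List.map_cons, List.map_nil]
      at hrec
    have hmap : Measurable fun p : Θ × (Fin N → Example d) × (ℕ → Example d) =>
        (p, p.2.1, (fetch (unclassified (L.map fun f => f p.1)) m
          (fetch (unclassified (L.map fun f => f p.1)) n p.2.2).2).2) :=
      measurable_id.prodMk (measurable_snd.fst.prodMk hf₂.snd)
    simp only [failCost]
    refine hmis.add (Measurable.ite hlt measurable_const (Measurable.add (Measurable.add
      ((hc₁.add hc₂).const_mul β) (measurable_ind hgood)) ?_))
    exact hrec.comp hmap

end FailCostMeasurable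

/-! ### The expected failure cost -/

section Expectation

variable {d : ℕ}

/-- Chernoff's bound for a fixed list: parameter `1/2` for a small region that looks large, `1/4`
for a large region that looks small, both with exponent at most `-(N * δ / 8)`. For masses between
`δ / 2` and `2 * δ` either answer is accepted. -/
theorem misjudged_le (D : Measure (Example d)) [IsProbabilityMeasure D] {δ : ℝ} (hδ : 0 < δ) {N : ℕ}
    (hN : 0 < N) (L : DecisionList d) :
    (Measure.pi fun _ : Fin N => D) {x | Misjudged D δ (samplePoints N x) L}
      ≤ ENNReal.ofReal (Real.exp (-(N * δ / 8))) := by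
  have hU := measurableSet_unclassified L
  set U := unclassified L with hUdef
  have hNpos : (0 : ℝ) < N := Nat.cast_pos.2 hN
  have hm : Measurable fun e : Example d => U.indicator (1 : Example d → ℝ) e :=
    measurable_one.indicator hU
  have hint : ∫ e, U.indicator (1 : Example d → ℝ) e ∂D = D.real U := integral_indicator_one hU
  have hint2 : ∫ e, U.indicator (1 : Example d → ℝ) e ^ 2 ∂D = D.real U := by
    simp_rw [indicator_one_sq]; exact hint
  rcases lt_or_ge (D.real U) (δ / 2) with hp | hp
  · have h := chernoff D hm (Filter.Eventually.of_forall fun e => abs_indicator_one_le U e)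
      (t := 1 / 2) (by norm_num) (by norm_num) (hint.trans_le hp.le) (hint2.trans_le hp.le) N (δ * N)
    refine (measure_mono fun x hx => ?_).trans
      (h.trans (ENNReal.ofReal_le_ofReal (Real.exp_le_exp.2 (by nlinarith))))
    rcases hx with hx | hx
    · have := hx.1
      rwa [uncoveredCount_samplePoints, length_samplePoints, le_div_iff₀ hNpos] at this
    · have := hx.2
      linarith
  rcases le_or_gt (D.real U) (2 * δ) with hp2 | hp2
  · refine le_of_eq_of_le (measure_mono_null (t := ∅) (fun x hx => ?_) measure_empty) zero_le
    rcases hx with hx | hx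
    · exact absurd hx.2 (not_lt.2 hp)
    · exact absurd hx.2 (not_lt.2 hp2)
  · have h := chernoff D (Z := fun e => -U.indicator (1 : Example d → ℝ) e) hm.neg
      (Filter.Eventually.of_forall fun e => by rw [abs_neg]; exact abs_indicator_one_le U e)
      (t := 1 / 4) (by norm_num) (by norm_num) (a := -D.real U) (b := D.real U)
      (by rw [integral_neg, hint]) (by simp_rw [neg_sq]; exact hint2.le) N (-(δ * N))
    refine (measure_mono fun x hx => ?_).trans
      (h.trans (ENNReal.ofReal_le_ofReal (Real.exp_le_exp.2 (by nlinarith))))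
    rcases hx with hx | hx
    · exact absurd hx.2 (not_lt.2 hp)
    · have := hx.1
      rw [uncoveredCount_samplePoints, length_samplePoints, div_lt_iff₀ hNpos] at this
      rw [Set.mem_ofPred_eq, Finset.sum_neg_distrib]
      linarith

theorem cond_real {E : Type} [MeasurableSpace E] (D : Measure E) {A : Set E} (hA : MeasurableSet A)
    (B : Set E) : (ProbabilityTheory.cond D A).real B = (D.real A)⁻¹ * D.real (A ∩ B) := by
  rw [Measure.real, ProbabilityTheory.cond_apply hA, ENNReal.toReal_mul, ENNReal.toReal_inv]
  rfl

theorem goodStep_of_goodRule {D : Measure (Example d)} [IsProbabilityMeasure D] {c q : ℝ}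
    {L : DecisionList d} (h0 : 0 < D.real (unclassified L)) {r : Vec d × ℝ}
    (h : GoodRule (ProbabilityTheory.cond D (unclassified L)) c q r) : GoodStep D c q L r := by
  have hU := measurableSet_unclassified L
  obtain ⟨h1, h2⟩ := h
  rw [cond_real D hU] at h1 h2
  rw [cond_real D hU] at h2
  refine ⟨?_, ?_⟩
  · rw [inv_mul_eq_div, le_div_iff₀ h0] at h1
    exact h1
  · rw [mul_left_comm, mul_le_mul_iff_right₀ (inv_pos.2 h0)] at h2
    exact h2

/-- SGD followed by the search for a threshold finds a good rule with high probability. -/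
theorem lintegral_bad_nextRule_le (Q : Measure (Example d)) [IsProbabilityMeasure Q]
    (hQ : ∀ᵐ e ∂Q, ‖e.1‖ ≤ 1) {lam δ q : ℝ} (h0 : 0 ≤ lam) (h : lam ≤ 1 / 2) (hδ0 : 0 < δ)
    (hδ1 : δ ≤ 1 / 2) (hq0 : 0 < q) (hq1 : q ≤ 1) {v : Vec d} (hv : ‖v‖ ≤ 1)
    (hrisk : risk Q lam v ≤ -q) {n m : ℕ} (hn : (40 / q) ^ 2 ≤ n) (hm : 0 < m) :
    ∫⁻ e₁, ∫⁻ e₂, ind (¬ GoodRule Q (lam + 3 * δ) q (nextRule lam q n m e₁ e₂))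
        ∂(Measure.pi fun _ => Q) ∂(Measure.pi fun _ => Q)
      ≤ ENNReal.ofReal (Real.exp (-(q ^ 2 * n / 5000)))
        + ENNReal.ofReal ((m + 2) * Real.exp (1 - m * (δ ^ 2 * q / 32))) := by
  have hnpos : 0 < n := Nat.cast_pos.1 (lt_of_lt_of_le (by positivity) hn)
  -- `B` is the failure of SGD, where the indicator is bounded by `1`. Outside of it the vector has
  -- small risk and is fixed before the examples `e₂` for the threshold come in.
  set B : Set (Fin n → Example d) := {e | -(4 / 5 * q * n) < risk Q lam (sgdState lam n e).2} with hB
  have hBm : MeasurableSet B :=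
    measurableSet_lt measurable_const ((measurable_risk Q).comp (measurable_sgdState lam n).snd)
  calc _ ≤ ∫⁻ e₁, (B.indicator 1 e₁
          + ENNReal.ofReal ((m + 2) * Real.exp (1 - m * (δ ^ 2 * q / 32)))) ∂(Measure.pi fun _ => Q) := by
        refine lintegral_mono fun e₁ => ?_
        by_cases he : e₁ ∈ B
        · rw [Set.indicator_of_mem he]
          refine le_add_right ((lintegral_mono fun e₂ => ind_le_one _).trans ?_)
          simp
        · obtain ⟨h1, h2⟩ := risk_sgdVec_le Q h hq0 hnpos e₁ (not_lt.1 he)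
          rw [lintegral_ind]
          · exact le_add_left (threshold_bad_le Q hQ h0 h hδ0 hδ1 hq0 hq1 h2 h1 hm)
          · have ht : Measurable fun e₂ : Fin m → Example d =>
                threshold q (records (sgdVec lam n e₁) m e₂) :=
              measurable_threshold_records q m measurable_const measurable_id
            exact ht (measurableSet_goodRule Q (lam + 3 * δ) q (sgdVec lam n e₁)).compl
    _ = (Measure.pi fun _ => Q) B
          + ENNReal.ofReal ((m + 2) * Real.exp (1 - m * (δ ^ 2 * q / 32))) := by
        rw [lintegral_add_right _ measurable_const, lintegral_indicator_one hBm]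
        simp
    _ ≤ _ := by
        gcongr
        exact sgdState_risk_bound Q hQ h0 h hv hq0 hq1 hrisk hn

theorem lintegral_bad_step_le {D : Measure (Example d)} [IsProbabilityMeasure D] {wstar : Vec d}
    {η γ δ : ℝ} (hη : 0 ≤ η) (hγ : 0 < γ) (hγ1 : γ ≤ 1) (hδ : 0 < δ) (hlam : η + δ ≤ 1 / 2)
    (hnorm : ‖wstar‖ = 1) (hmargin : HasMargin D wstar γ) (hD : IsMassart D (halfspace wstar) η)
    {n m : ℕ} (hn : (40 / (γ * δ)) ^ 2 ≤ n) (hm : 0 < m) {L : DecisionList d}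
    (h0 : 0 < D.real (unclassified L)) :
    ∫⁻ e₁, ∫⁻ e₂, ind (¬ GoodStep D (η + δ + 3 * δ) (γ * δ) L
          (nextRule (η + δ) (γ * δ) n m e₁ e₂))
        ∂(Measure.pi fun _ => ProbabilityTheory.cond D (unclassified L))
        ∂(Measure.pi fun _ => ProbabilityTheory.cond D (unclassified L))
      ≤ ENNReal.ofReal (Real.exp (-((γ * δ) ^ 2 * n / 5000)))
        + ENNReal.ofReal ((m + 2) * Real.exp (1 - m * (δ ^ 2 * (γ * δ) / 32))) := by
  have h0' : D (unclassified L) ≠ 0 := fun h => by simp [Measure.real, h] at h0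
  have := ProbabilityTheory.cond_isProbabilityMeasure h0'
  set Q := ProbabilityTheory.cond D (unclassified L) with hQdef
  have hQ : ∀ᵐ e ∂Q, ‖e.1‖ ≤ 1 :=
    ProbabilityTheory.cond_absolutelyContinuous.ae_le (hmargin.mono fun _ h => h.1)
  -- The unclassified region is the preimage of a set of points; its slice at the label `true` shows
  -- that this set is measurable.
  have hS : MeasurableSet {x : Vec d | ¬ Covered L x} :=
    (measurable_id.prodMk (measurable_const (a := true))) (measurableSet_unclassified L)
  have hrisk : risk Q (η + δ) wstar ≤ -(γ * δ) :=
    risk_cond_le hη hγ hδ hlam hnorm hmargin hD hS h0'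
  refine le_trans (lintegral_mono fun e₁ => lintegral_mono fun e₂ => ?_)
    (lintegral_bad_nextRule_le Q hQ (by linarith) hlam hδ (by linarith) (mul_pos hγ hδ)
      (by nlinarith) hnorm.le hrisk hn hm)
  by_cases h : GoodRule Q (η + δ + 3 * δ) (γ * δ) (nextRule (η + δ) (γ * δ) n m e₁ e₂)
  · simp [ind, goodStep_of_goodRule h0 h]
  · simp only [ind, h, not_false_eq_true, if_true]
    exact ind_le_one _

theorem lintegral_fetch_fetch {E : Type} [MeasurableSpace E] (D : Measure E) [IsProbabilityMeasure D]
    {A : Set E} (hA : MeasurableSet A) (h0 : D A ≠ 0) (n m : ℕ)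
    {f : (Fin n → E) → (Fin m → E) → (ℕ → E) → ℝ≥0∞}
    (hf : Measurable fun p : (Fin n → E) × (Fin m → E) × (ℕ → E) => f p.1 p.2.1 p.2.2) :
    ∫⁻ ω, f (fetch A n ω).1 (fetch A m (fetch A n ω).2).1 (fetch A m (fetch A n ω).2).2 ∂(streamLaw D)
      = ∫⁻ e₁, ∫⁻ e₂, ∫⁻ ω, f e₁ e₂ ω ∂(streamLaw D)
          ∂(Measure.pi fun _ => ProbabilityTheory.cond D A)
          ∂(Measure.pi fun _ => ProbabilityTheory.cond D A) := by
  have hm := measurable_fetch_const hA m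
  have hg : Measurable fun p : (Fin n → E) × (ℕ → E) =>
      (p.1, (fetch A m p.2).1, (fetch A m p.2).2) :=
    measurable_fst.prodMk (hm.comp measurable_snd)
  rw [lintegral_fetch D hA h0 n (f := fun p => f p.1 (fetch A m p.2).1 (fetch A m p.2).2)
    (hf.comp hg)]
  refine lintegral_congr fun e₁ => ?_
  exact lintegral_fetch D hA h0 m (f := fun p => f e₁ p.1 p.2)
    (hf.comp (measurable_const.prodMk measurable_id))

theorem lintegral_fetch_pair {E : Type} [MeasurableSpace E] (D : Measure E) [IsProbabilityMeasure D]
    {A : Set E} (hA : MeasurableSet A) (h0 : D A ≠ 0) (n m : ℕ)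
    {f : (Fin n → E) × (Fin m → E) → ℝ≥0∞} (hf : Measurable f) :
    ∫⁻ ω, f ((fetch A n ω).1, (fetch A m (fetch A n ω).2).1) ∂(streamLaw D)
      = ∫⁻ e₁, ∫⁻ e₂, f (e₁, e₂) ∂(Measure.pi fun _ => ProbabilityTheory.cond D A)
          ∂(Measure.pi fun _ => ProbabilityTheory.cond D A) := by
  have hg : Measurable fun p : (Fin n → E) × (Fin m → E) × (ℕ → E) => f (p.1, p.2.1) :=
    hf.comp (measurable_fst.prodMk measurable_snd.fst)
  rw [lintegral_fetch_fetch D hA h0 n m (f := fun e₁ e₂ _ => f (e₁, e₂)) hg]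
  simp only [lintegral_const, measure_univ, mul_one]

/-- The examples `p` of a round are independent of the stopping sample `x` and of the rest of the
stream. After an exchange of integrals, a bound for every fixed `p` holds for the random one; this
is how the induction hypothesis for an extended list is applied to a random rule. -/
theorem lintegral_fetch_fetch_le {E F : Type} [MeasurableSpace E] [MeasurableSpace F] (D : Measure E)
    [IsProbabilityMeasure D] (P : Measure F) [IsProbabilityMeasure P] {A : Set E}
    (hA : MeasurableSet A) (h0 : D A ≠ 0) (n m : ℕ)
    {f : (Fin n → E) × (Fin m → E) → F → (ℕ → E) → ℝ≥0∞}
    (hf : Measurable fun p : ((Fin n → E) × (Fin m → E)) × F × (ℕ → E) => f p.1 p.2.1 p.2.2)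
    {B : ℝ≥0∞} (hB : ∀ p, ∫⁻ x, ∫⁻ ω, f p x ω ∂(streamLaw D) ∂P ≤ B) :
    ∫⁻ x, ∫⁻ ω, f ((fetch A n ω).1, (fetch A m (fetch A n ω).2).1) x (fetch A m (fetch A n ω).2).2
      ∂(streamLaw D) ∂P ≤ B := by
  have := ProbabilityTheory.cond_isProbabilityMeasure h0
  have hx : ∀ x : F,
      ∫⁻ ω, f ((fetch A n ω).1, (fetch A m (fetch A n ω).2).1) x (fetch A m (fetch A n ω).2).2
        ∂(streamLaw D)
      = ∫⁻ p, ∫⁻ ω, f p x ω ∂(streamLaw D)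
        ∂((Measure.pi fun _ : Fin n => ProbabilityTheory.cond D A).prod
          (Measure.pi fun _ : Fin m => ProbabilityTheory.cond D A)) := by
    intro x
    have h1 : Measurable fun p : (Fin n → E) × (Fin m → E) × (ℕ → E) => f (p.1, p.2.1) x p.2.2 :=
      hf.comp ((measurable_fst.prodMk measurable_snd.fst).prodMk
        (measurable_const.prodMk measurable_snd.snd))
    have h2 : Measurable fun p : ((Fin n → E) × (Fin m → E)) × (ℕ → E) => f p.1 x p.2 :=
      hf.comp (measurable_fst.prodMk (measurable_const.prodMk measurable_snd))
    rw [lintegral_fetch_fetch D hA h0 n m (f := fun e₁ e₂ ω => f (e₁, e₂) x ω) h1,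
      lintegral_prod _ h2.lintegral_prod_right'.aemeasurable]
  simp only [hx]
  have h3 : Measurable fun z : (F × ((Fin n → E) × (Fin m → E))) × (ℕ → E) => f z.1.2 z.1.1 z.2 :=
    hf.comp (measurable_fst.snd.prodMk (measurable_fst.fst.prodMk measurable_snd))
  have h4 : Measurable fun z : F × ((Fin n → E) × (Fin m → E)) =>
      ∫⁻ ω, f z.2 z.1 ω ∂(streamLaw D) := h3.lintegral_prod_right'
  rw [lintegral_lintegral_swap h4.aemeasurable]
  refine (lintegral_mono hB).trans ?_
  simp

theorem lintegral_fetchCost_pair_le {E : Type} [MeasurableSpace E] (D : Measure E)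
    [IsProbabilityMeasure D] {A : Set E} (hA : MeasurableSet A) {b : ℝ} (hb : 0 < b)
    (h : b ≤ D.real A) (n m : ℕ) :
    ∫⁻ ω, (fetchCost A n ω + fetchCost A m (fetch A n ω).2) ∂(streamLaw D)
      ≤ (n + m) * ENNReal.ofReal b⁻¹ := by
  have hpos : 0 < D.real A := hb.trans_le h
  have h0 : D A ≠ 0 := fun h => by simp [Measure.real, h] at hpos
  have := ProbabilityTheory.cond_isProbabilityMeasure h0
  rw [lintegral_add_left (measurable_fetchCost_const hA n), lintegral_fetchCost D hA h0,
    lintegral_fetch D hA h0 n (f := fun p => fetchCost A m p.2)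
      ((measurable_fetchCost_const hA m).comp measurable_snd)]
  simp only [lintegral_fetchCost D hA h0, lintegral_const, measure_univ, mul_one]
  rw [← add_mul, ENNReal.ofReal_inv_of_pos hb]
  gcongr
  exact (ENNReal.ofReal_le_iff_le_toReal (measure_ne_top D A)).2 h

theorem lintegral_lintegral_add_add {Ω F : Type} [MeasurableSpace Ω] [MeasurableSpace F] {μ : Measure Ω}
    [IsProbabilityMeasure μ] {P : Measure F} [IsProbabilityMeasure P] {M : F → ℝ≥0∞} {G G' : Ω → ℝ≥0∞}
    {H : F → Ω → ℝ≥0∞} (hM : Measurable M) (hG : Measurable G) (hG' : Measurable G') :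
    ∫⁻ x, ∫⁻ ω, (M x + (G ω + G' ω + H x ω)) ∂μ ∂P
      = ∫⁻ x, M x ∂P + (∫⁻ ω, G ω ∂μ + ∫⁻ ω, G' ω ∂μ + ∫⁻ x, ∫⁻ ω, H x ω ∂μ ∂P) := by
  have hGG : Measurable fun ω => G ω + G' ω := hG.add hG'
  simp only [lintegral_add_left measurable_const, lintegral_add_left hGG, lintegral_add_left hG,
    lintegral_const, measure_univ, mul_one]
  rw [lintegral_add_left hM, lintegral_add_left measurable_const, lintegral_const, measure_univ,
    mul_one]

theorem measurable_of_mem_map_const {Θ α : Type} [MeasurableSpace Θ] [MeasurableSpace α] (L : List α) :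
    ∀ f ∈ L.map (fun s => fun _ : Θ => s), Measurable f := by
  intro f hf
  obtain ⟨s, -, rfl⟩ := List.mem_map.1 hf
  exact measurable_const

theorem measurable_failCost_append (D : Measure (Example d)) [IsProbabilityMeasure D]
    (lam c q δ : ℝ) (β : ℝ≥0∞) (n m N i : ℕ) (L : DecisionList d) {Θ : Type} [MeasurableSpace Θ]
    {r : Θ → Vec d × ℝ} (hr : Measurable r) :
    Measurable fun p : Θ × (Fin N → Example d) × (ℕ → Example d) =>
      failCost D lam c q δ β n m (samplePoints N p.2.1) i (L ++ [r p.1]) p.2.2 := by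
  have hL : ∀ f ∈ L.map (fun s => fun _ : Θ => s) ++ [r], Measurable f := by
    intro f hf
    rcases List.mem_append.1 hf with hf | hf
    · exact measurable_of_mem_map_const L f hf
    · rwa [List.mem_singleton.1 hf]
  have := measurable_failCost D lam c q δ β n m N i hL
  simpa only [List.map_append, List.map_map, Function.comp_def, List.map_id', List.map_cons,
    List.map_nil] using this

/-- Linearity of the integral over rounds: `i + 1` judgments, and at most `i` rounds, each with its
draws and one possibly bad rule. The bound `hmis` for fixed lists suffices because `failCost` never
uses the stopping sample to choose a rule or to continue. -/
theorem lintegral_failCost_le (D : Measure (Example d)) [IsProbabilityMeasure D] {lam c q δ : ℝ}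
    (hδ : 0 < δ) (β : ℝ≥0∞) {n m N : ℕ} {δ₁ δ₂ : ℝ≥0∞}
    (hmis : ∀ L, (Measure.pi fun _ : Fin N => D) {x | Misjudged D δ (samplePoints N x) L} ≤ δ₁)
    (hbad : ∀ L, 0 < D.real (unclassified L) →
      ∫⁻ e₁, ∫⁻ e₂, ind (¬ GoodStep D c q L (nextRule lam q n m e₁ e₂))
        ∂(Measure.pi fun _ => ProbabilityTheory.cond D (unclassified L))
        ∂(Measure.pi fun _ => ProbabilityTheory.cond D (unclassified L)) ≤ δ₂)
    (i : ℕ) (L : DecisionList d) :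
    ∫⁻ x, ∫⁻ ω, failCost D lam c q δ β n m (samplePoints N x) i L ω ∂(streamLaw D)
        ∂(Measure.pi fun _ : Fin N => D)
      ≤ (i + 1) * δ₁ + i * (β * ((n + m) * ENNReal.ofReal (2 / δ)) + δ₂) := by
  have hmismeas : ∀ L,
      MeasurableSet {x : Fin N → Example d | Misjudged D δ (samplePoints N x) L} := by
    intro L
    have h := measurableSet_misjudged (Θ := Unit) D (L := L.map fun s _ => s)
      (measurable_of_mem_map_const L) δ N
    simp only [List.map_map, Function.comp_def, List.map_id'] at h
    exact (measurable_const (a := ()).prodMk measurable_id) h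
  have hmisj : ∀ L, ∫⁻ x, ind (Misjudged D δ (samplePoints N x) L) ∂(Measure.pi fun _ : Fin N => D)
      ≤ δ₁ := fun L => (lintegral_ind _ (hmismeas L)).trans_le (hmis L)
  induction i generalizing L with
  | zero => simpa [failCost] using hmisj L
  | succ i ih =>
    -- Below this mass no further cost arises, so every round that is charged has mass at least `δ /
    -- 2` and needs at most `2 / δ` draws per accepted example on average.
    by_cases hlt : D.real (unclassified L) < δ / 2
    · simp only [failCost, if_pos hlt, add_zero, lintegral_const, measure_univ, mul_one]
      refine (hmisj L).trans (le_add_right ?_)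
      calc δ₁ = 1 * δ₁ := (one_mul _).symm
        _ ≤ _ := by gcongr; exact le_add_self
    have hpos : 0 < D.real (unclassified L) := lt_of_lt_of_le (by positivity) (not_lt.1 hlt)
    have h0 : D (unclassified L) ≠ 0 := fun h => by simp [Measure.real, h] at hpos
    have hU := measurableSet_unclassified L
    have hr : Measurable fun p : (Fin n → Example d) × (Fin m → Example d) =>
        nextRule lam q n m p.1 p.2 := measurable_nextRule lam q n m measurable_fst measurable_snd
    have hF := measurable_failCost_append D lam c q δ β n m N i L hr
    have hgood : Measurable fun p : (Fin n → Example d) × (Fin m → Example d) =>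
        ind (¬ GoodStep D c q L (nextRule lam q n m p.1 p.2)) := by
      have h := measurableSet_goodStep D (L := L.map fun s _ => s)
        (measurable_of_mem_map_const L) c q hr
      simp only [List.map_map, Function.comp_def, List.map_id'] at h
      exact measurable_ind h.compl
    have hcost := lintegral_fetchCost_pair_le D hU (b := δ / 2) (by positivity) (not_lt.1 hlt) n m
    have hb := (lintegral_fetch_pair D hU h0 n m hgood).trans_le (hbad L hpos)
    have hrec := lintegral_fetch_fetch_le D (Measure.pi fun _ : Fin N => D) hU h0 n m
      (f := fun p x ω => failCost D lam c q δ β n m (samplePoints N x) i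
        (L ++ [nextRule lam q n m p.1 p.2]) ω) hF fun p => ih (L ++ [nextRule lam q n m p.1 p.2])
    have hf₁ := measurable_fetch_const hU n
    have hf₂ : Measurable fun ω => fetch (unclassified L) m (fetch (unclassified L) n ω).2 :=
      (measurable_fetch_const hU m).comp hf₁.snd
    have hc : Measurable fun ω => fetchCost (unclassified L) n ω
        + fetchCost (unclassified L) m (fetch (unclassified L) n ω).2 :=
      (measurable_fetchCost_const hU n).add ((measurable_fetchCost_const hU m).comp hf₁.snd)
    have hbm : Measurable fun ω => ind (¬ GoodStep D c q L (nextRule lam q n m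
        (fetch (unclassified L) n ω).1
        (fetch (unclassified L) m (fetch (unclassified L) n ω).2).1)) := by
      have h := hgood.comp (hf₁.fst.prodMk hf₂.fst)
      simpa only [Function.comp_def] using h
    simp only [failCost, if_neg hlt]
    rw [lintegral_lintegral_add_add (measurable_ind (hmismeas L)) (hc.const_mul β) hbm,
      lintegral_const_mul β hc]
    have hcost' := mul_le_mul_right hcost β
    rw [inv_div] at hcost'
    refine (add_le_add (hmisj L) (add_le_add (add_le_add hcost' hb) hrec)).trans (le_of_eq ?_)
    push_cast
    ring

end Expectation

/-! ### The run of the algorithm -/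

section Run

variable {d : ℕ}

theorem drawCount_univ {E : Type} (ω : ℕ → E) : drawCount Set.univ ω = 1 := by
  rw [drawCount, tsum_eq_single 0]
  · simp [avoid]
  · intro t ht
    have : avoid (Set.univ : Set E) t = ∅ := by
      ext ω
      simp only [avoid, Set.mem_ofPred_eq, Set.mem_empty_iff_false, iff_false]
      exact fun h => h 0 (Nat.pos_of_ne_zero ht) (Set.mem_univ _)
    simp [this]

theorem fetchCost_univ {E : Type} (k : ℕ) (ω : ℕ → E) : fetchCost Set.univ k ω = k := by
  induction k generalizing ω with
  | zero => simp [fetchCost]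
  | succ k ih =>
    rw [fetchCost, drawCount_univ, ih, Nat.cast_succ, add_comm]

theorem unclassified_nil : unclassified ([] : DecisionList d) = Set.univ := by
  ext e
  simp [unclassified, Covered]

/-- The guarantee of the algorithm for any parameters: it fails with probability at most `1 / 3` as
soon as the failure probabilities of its parts add up to at most `1 / 3`. -/
theorem learner_guarantee {D : Measure (Example d)} [IsProbabilityMeasure D] {wstar : Vec d}
    {η γ δ : ℝ} (hη : 0 ≤ η) (hγ : 0 < γ) (hγ1 : γ ≤ 1) (hδ : 0 < δ) (hlam : η + δ ≤ 1 / 2)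
    (hnorm : ‖wstar‖ = 1) (hmargin : HasMargin D wstar γ) (hD : IsMassart D (halfspace wstar) η)
    {N n m I : ℕ} (hN : 0 < N) (hn : (40 / (γ * δ)) ^ 2 ≤ n) (hm : 0 < m)
    (hI : (1 - γ * δ / 2) ^ I < δ / 2) {b : ℝ} (hb : 0 < b)
    (hprob : (I + 1) * Real.exp (-(N * δ / 8)) + I * (b * ((n + m) * (2 / δ))
      + (Real.exp (-((γ * δ) ^ 2 * n / 5000))
        + (m + 2) * Real.exp (1 - m * (δ ^ 2 * (γ * δ) / 32)))) ≤ 1 / 3) :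
    Measure.infinitePi (fun _ : ℕ => D)
      {ω | ¬ ∃ (L : DecisionList d) (u : Usage),
        (learner d η γ δ N n m).exec ω = some (L, u) ∧ (u.samples : ℝ) ≤ N + b⁻¹ ∧
        (u.steps : ℝ) ≤ N + N * (d + 1) + 2
          + ((I + 1) * roundSteps d n m N I + b⁻¹ * drawSteps d I) ∧
        ∀ g : Vec d → Bool, err D (L.classify g) ≤ η + 6 * δ} ≤ 1 / 3 := by
  set F : (ℕ → Example d) → ℝ≥0∞ := fun ω =>
    failCost D (η + δ) (η + δ + 3 * δ) (γ * δ) δ (ENNReal.ofReal b) n m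
      (samplePoints N (fetch Set.univ N ω).1) I [] (fetch Set.univ N ω).2 with hF
  have hG : Measurable fun p : (Fin N → Example d) × (ℕ → Example d) =>
      failCost D (η + δ) (η + δ + 3 * δ) (γ * δ) δ (ENNReal.ofReal b) n m
        (samplePoints N p.1) I [] p.2 := by
    have h := measurable_failCost D (Θ := Unit) (L := []) (η + δ) (η + δ + 3 * δ) (γ * δ) δ
      (ENNReal.ofReal b) n m N I (by simp)
    simp only [List.map_nil] at h
    exact h.comp ((measurable_const (a := ())).prodMk measurable_id)
  have hFm : Measurable F := hG.comp (measurable_fetch_const MeasurableSet.univ N)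
  have hint : ∫⁻ ω, F ω ∂(streamLaw D) ≤ 1 / 3 := by
    have h := lintegral_fetch D MeasurableSet.univ (by simp) N hG
    rw [ProbabilityTheory.cond_univ] at h
    rw [hF, h]
    refine (lintegral_failCost_le D hδ (ENNReal.ofReal b)
      (misjudged_le D hδ hN)
      (fun L h0 => lintegral_bad_step_le hη hγ hγ1 hδ hlam hnorm hmargin hD hn hm h0) I []).trans ?_
    have h3 : (1 / 3 : ℝ≥0∞) = ENNReal.ofReal (1 / 3) := by
      rw [ENNReal.ofReal_div_of_pos (by norm_num)]; simp
    rw [h3]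
    refine le_trans (le_of_eq ?_) (ENNReal.ofReal_le_ofReal hprob)
    have e1 : ((I : ℝ≥0∞) + 1) = ENNReal.ofReal (I + 1) := by
      rw [ENNReal.ofReal_add (by positivity) (by norm_num)]; simp
    have e2 : ((n : ℝ≥0∞) + m) = ENNReal.ofReal (n + m) := by
      rw [ENNReal.ofReal_add (by positivity) (by positivity)]; simp
    rw [e1, e2, ← ENNReal.ofReal_natCast I, ← ENNReal.ofReal_mul (by positivity),
      ← ENNReal.ofReal_mul (by positivity), ← ENNReal.ofReal_mul (by positivity),
      ← ENNReal.ofReal_add (by positivity) (by positivity),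
      ← ENNReal.ofReal_add (by positivity) (by positivity),
      ← ENNReal.ofReal_mul (by positivity), ← ENNReal.ofReal_add (by positivity) (by positivity)]
  -- Markov's inequality: it remains to see that cost below `1` implies success.
  refine (measure_mono (t := {ω | 1 ≤ F ω}) fun ω hω => ?_).trans
    (le_trans ?_ hint)
  swap
  · have := mul_meas_ge_le_lintegral (μ := streamLaw D) hFm 1
    rwa [one_mul] at this
  by_contra hlt
  have hlt : F ω < 1 := not_le.1 hlt
  refine hω ?_
  have hq1 : γ * δ ≤ 2 := by nlinarith
  obtain ⟨R, j, hj, hy, herr⟩ := loopGood_of_failCost_lt_one D (by linarith)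
    (ENNReal.ofReal_pos.2 hb).ne' hq1 I [] _ hlt (by
      rw [unclassified_nil]; simpa using hI)
  have hfin : fetchCost (Set.univ : Set (Example d)) N ω < ∞ := by
    rw [fetchCost_univ]; exact ENNReal.natCast_lt_top N
  obtain ⟨j₀, hj₀, hyl⟩ := yields_learner η γ δ N n m ω hfin hy
  rw [fetchCost_univ, Nat.cast_le] at hj₀
  obtain ⟨u, hu, hs, ht⟩ := exec_of_yields hyl
  have hjb : (j : ℝ) ≤ b⁻¹ := by
    have h1 : ENNReal.ofReal (b * j) < 1 := by
      rw [ENNReal.ofReal_mul hb.le, ENNReal.ofReal_natCast]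
      exact hj.trans_lt hlt
    rw [ENNReal.ofReal_lt_one] at h1
    rw [← one_div, le_div_iff₀ hb]
    linarith
  have hj₀' : (j₀ : ℝ) ≤ N := Nat.cast_le.2 hj₀
  refine ⟨[] ++ R, u, hu, ?_, ?_, fun g => ?_⟩
  · rw [hs]; push_cast; linarith
  · refine (Nat.cast_le.2 ht).trans ?_
    rw [length_samplePoints, List.length_nil, Nat.zero_add]
    push_cast
    gcongr
  -- The rules contribute error at most `η + 4 * δ` and the leftover region `2 * δ`.
  · have h := herr g
    simp only [unclassified_nil, Set.mem_univ, true_and, probReal_univ, mul_one] at h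
    rw [List.nil_append, err]
    linarith

end Run

/-! ### The parameters -/

section Parameters

/-- The number of examples for the stopping rule. -/
def stoppingSize (γ δ : ℝ) : ℕ := ⌈32 * Real.log (2 / (γ * δ)) / δ⌉₊

/-- The number of iterations of SGD. -/
def sgdSize (γ δ : ℝ) : ℕ := ⌈20000 * Real.log (2 / (γ * δ)) / (γ * δ) ^ 2⌉₊

/-- The number of examples for the choice of a threshold. -/
def thresholdSize (γ δ : ℝ) : ℕ := ⌈320 * Real.log (2 / (γ * δ)) / (δ ^ 2 * (γ * δ))⌉₊

/-- A bound for the number of rounds of the main loop. -/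
def roundBound (γ δ : ℝ) : ℕ := ⌈2 * Real.log (2 / (γ * δ)) / (γ * δ)⌉₊ + 1

theorem half_le_log {q : ℝ} (hq0 : 0 < q) (hq1 : q ≤ 1) : 1 / 2 ≤ Real.log (2 / q) := by
  have h1 := Real.log_two_gt_d9
  have h2 : Real.log 2 ≤ Real.log (2 / q) :=
    Real.log_le_log (by norm_num) (by rw [le_div_iff₀ hq0]; linarith)
  linarith

/-- Since `l / u ≥ 1/2`, the `1` lost in rounding up is at most `2 * l / u`. -/
theorem ceil_mul_div_le {a l u : ℝ} (ha : 0 ≤ a) (hl : 1 / 2 ≤ l) (hu0 : 0 < u) (hu1 : u ≤ 1) :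
    (⌈a * l / u⌉₊ : ℝ) ≤ (a + 2) * l / u := by
  have h1 : (⌈a * l / u⌉₊ : ℝ) < a * l / u + 1 := Nat.ceil_lt_add_one (by positivity)
  have h2 : 1 ≤ 2 * l / u := by rw [le_div_iff₀ hu0]; linarith
  have h3 : (a + 2) * l / u = a * l / u + 2 * l / u := by ring
  linarith

variable {γ δ : ℝ}

theorem stoppingSize_le (hγ : 0 < γ) (hγ1 : γ ≤ 1) (hδ : 0 < δ) (hδ1 : δ ≤ 1) :
    (stoppingSize γ δ : ℝ) ≤ 34 * Real.log (2 / (γ * δ)) / δ :=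
  (ceil_mul_div_le (by norm_num) (half_le_log (by positivity) (by nlinarith)) hδ hδ1).trans
    (le_of_eq (by norm_num))

theorem sgdSize_le (hγ : 0 < γ) (hγ1 : γ ≤ 1) (hδ : 0 < δ) (hδ1 : δ ≤ 1) :
    (sgdSize γ δ : ℝ) ≤ 20002 * Real.log (2 / (γ * δ)) / (γ * δ) ^ 2 :=
  (ceil_mul_div_le (by norm_num) (half_le_log (by positivity) (by nlinarith)) (by positivity)
    (pow_le_one₀ (by positivity) (by nlinarith))).trans (le_of_eq (by norm_num))

theorem thresholdSize_le (hγ : 0 < γ) (hγ1 : γ ≤ 1) (hδ : 0 < δ) (hδ1 : δ ≤ 1) :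
    (thresholdSize γ δ : ℝ) ≤ 322 * Real.log (2 / (γ * δ)) / (δ ^ 2 * (γ * δ)) :=
  (ceil_mul_div_le (by norm_num) (half_le_log (by positivity) (by nlinarith)) (by positivity)
    (mul_le_one₀ (pow_le_one₀ hδ.le hδ1) (by positivity) (by nlinarith))).trans
      (le_of_eq (by norm_num))

theorem roundBound_le (hγ : 0 < γ) (hγ1 : γ ≤ 1) (hδ : 0 < δ) (hδ1 : δ ≤ 1) :
    (roundBound γ δ : ℝ) ≤ 6 * Real.log (2 / (γ * δ)) / (γ * δ) := by
  have hq : γ * δ ≤ 1 := by nlinarith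
  have hq0 : 0 < γ * δ := by positivity
  have hl := half_le_log hq0 hq
  have h1 := ceil_mul_div_le (a := 2) (by norm_num) hl hq0 hq
  have h2 : 1 ≤ 2 * Real.log (2 / (γ * δ)) / (γ * δ) := by rw [le_div_iff₀ hq0]; linarith
  have h3 : 6 * Real.log (2 / (γ * δ)) / (γ * δ) = (2 + 2) * Real.log (2 / (γ * δ)) / (γ * δ)
    + 2 * Real.log (2 / (γ * δ)) / (γ * δ) := by ring
  rw [roundBound]
  push_cast
  linarith

theorem exp_neg_mul_log {x : ℝ} (hx : 0 < x) (k : ℕ) : Real.exp (-(k * Real.log x)) = (x ^ k)⁻¹ := by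
  rw [Real.exp_neg, ← Real.log_pow, Real.exp_log (by positivity)]

theorem sgdSize_ge (hγ : 0 < γ) (hγ1 : γ ≤ 1) (hδ : 0 < δ) (hδ1 : δ ≤ 1) :
    (40 / (γ * δ)) ^ 2 ≤ sgdSize γ δ := by
  have hl := half_le_log (q := γ * δ) (by positivity) (by nlinarith)
  refine le_trans ?_ (Nat.le_ceil _)
  rw [div_pow]
  gcongr
  linarith

/-- From `1 - t ≤ exp (-t)`; the summand `+ 1` in `roundBound` makes the inequality strict. -/
theorem roundBound_pow_lt (hγ : 0 < γ) (hγ1 : γ ≤ 1) (hδ : 0 < δ) (hδ1 : δ ≤ 1) :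
    (1 - γ * δ / 2) ^ roundBound γ δ < δ / 2 := by
  have hq : γ * δ ≤ 1 := by nlinarith
  have hq0 : 0 < γ * δ := by positivity
  have h1 : 2 * Real.log (2 / (γ * δ)) / (γ * δ) < roundBound γ δ := by
    rw [roundBound, Nat.cast_succ]
    have := Nat.le_ceil (2 * Real.log (2 / (γ * δ)) / (γ * δ))
    linarith
  rw [div_lt_iff₀ hq0] at h1
  calc (1 - γ * δ / 2) ^ roundBound γ δ ≤ Real.exp (-(γ * δ / 2)) ^ roundBound γ δ := by
        gcongr
        · linarith
        · have := Real.add_one_le_exp (-(γ * δ / 2)); linarith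
    _ = Real.exp (-(roundBound γ δ * (γ * δ / 2))) := by rw [← Real.exp_nat_mul]; ring_nf
    _ < Real.exp (-((1 : ℕ) * Real.log (2 / (γ * δ)))) := by
        rw [Real.exp_lt_exp, Nat.cast_one]; linarith
    _ = γ * δ / 2 := by rw [exp_neg_mul_log (by positivity), pow_one, inv_div]
    _ ≤ δ / 2 := by nlinarith

/-- Everything is measured in `x = 2 / (γ * δ) ≥ 20`. There are `O(x ^ 2)` rounds; the sizes make a
misjudgment and a failure of SGD cost at most `x ^ (-4)`, and the union bound over `O(x ^ 4)`
records is beaten by `x ^ (-10)`. The total is of order `x ^ (-2)`. -/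
theorem failure_sum_le (hγ : 0 < γ) (hγ1 : γ ≤ 1) (hδ : 0 < δ) (hδ1 : δ ≤ 1 / 10) :
    (roundBound γ δ + 1) * Real.exp (-(stoppingSize γ δ * δ / 8))
      + roundBound γ δ * (Real.exp (-((γ * δ) ^ 2 * sgdSize γ δ / 5000))
        + (thresholdSize γ δ + 2) * Real.exp (1 - thresholdSize γ δ * (δ ^ 2 * (γ * δ) / 32)))
      ≤ 1 / 12 := by
  have hδ1' : δ ≤ 1 := by linarith
  have hq : γ * δ ≤ 1 / 10 := by nlinarith
  have hq0 : 0 < γ * δ := by positivity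
  have hm := thresholdSize_le hγ hγ1 hδ hδ1'
  have hI := roundBound_le hγ hγ1 hδ hδ1'
  set x := 2 / (γ * δ) with hx
  set l := Real.log x with hl
  have hx20 : 20 ≤ x := by rw [hx, le_div_iff₀ hq0]; linarith
  have hx0 : 0 < x := by linarith
  have hlx : l ≤ x := (Real.log_le_sub_one_of_pos hx0).trans (by linarith)
  have hqx : γ * δ = 2 / x := by rw [hx]; field_simp
  have hI' : (roundBound γ δ : ℝ) + 1 ≤ 4 * x ^ 2 := by
    have : 6 * l / (γ * δ) ≤ 3 * x ^ 2 := by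
      rw [hqx, div_le_iff₀ (by positivity)]
      have : 3 * x ^ 2 * (2 / x) = 6 * x := by field_simp; norm_num
      rw [this]; linarith
    nlinarith
  have hm' : (thresholdSize γ δ : ℝ) + 2 ≤ 42 * x ^ 4 := by
    have h3 : (γ * δ) ^ 3 ≤ δ ^ 2 * (γ * δ) := by
      have : (γ * δ) ^ 2 ≤ δ ^ 2 := pow_le_pow_left₀ hq0.le (by nlinarith) 2
      calc (γ * δ) ^ 3 = (γ * δ) ^ 2 * (γ * δ) := by ring
        _ ≤ _ := by gcongr
    have h4 : 322 * l / (δ ^ 2 * (γ * δ)) ≤ 41 * x ^ 4 := by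
      rw [div_le_iff₀ (by positivity)]
      calc 322 * l ≤ 41 * x ^ 4 * (2 / x) ^ 3 := by
            have : 41 * x ^ 4 * (2 / x) ^ 3 = 328 * x := by field_simp; norm_num
            rw [this]; linarith
        _ ≤ _ := by rw [← hqx]; gcongr
    have : 20 ^ 4 ≤ x ^ 4 := by gcongr
    linarith
  have hN : Real.exp (-(stoppingSize γ δ * δ / 8)) ≤ (x ^ 4)⁻¹ := by
    rw [← exp_neg_mul_log hx0, Real.exp_le_exp]
    have := Nat.le_ceil (32 * l / δ)
    rw [div_le_iff₀ hδ] at this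
    change 32 * l ≤ stoppingSize γ δ * δ at this
    push_cast
    linarith
  have hn : Real.exp (-((γ * δ) ^ 2 * sgdSize γ δ / 5000)) ≤ (x ^ 4)⁻¹ := by
    rw [← exp_neg_mul_log hx0, Real.exp_le_exp]
    have := Nat.le_ceil (20000 * l / (γ * δ) ^ 2)
    rw [div_le_iff₀ (by positivity)] at this
    change 20000 * l ≤ sgdSize γ δ * (γ * δ) ^ 2 at this
    push_cast
    linarith
  have hme : Real.exp (1 - thresholdSize γ δ * (δ ^ 2 * (γ * δ) / 32)) ≤ 3 * (x ^ 10)⁻¹ := by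
    rw [← exp_neg_mul_log hx0]
    have := Nat.le_ceil (320 * l / (δ ^ 2 * (γ * δ)))
    rw [div_le_iff₀ (by positivity)] at this
    change 320 * l ≤ thresholdSize γ δ * (δ ^ 2 * (γ * δ)) at this
    calc _ ≤ Real.exp (1 + -((10 : ℕ) * l)) := by
          rw [Real.exp_le_exp]; push_cast; linarith
      _ ≤ _ := by
          rw [Real.exp_add]
          gcongr
          have := Real.exp_one_lt_d9
          linarith
  have hx2 : (x ^ 2)⁻¹ ≤ 1 / 400 := by
    rw [← one_div]
    exact one_div_le_one_div_of_le (by norm_num) (by nlinarith)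
  calc _ ≤ 4 * x ^ 2 * (x ^ 4)⁻¹ + 4 * x ^ 2 * ((x ^ 4)⁻¹ + 42 * x ^ 4 * (3 * (x ^ 10)⁻¹)) := by
        gcongr
        linarith
    _ = 8 * (x ^ 2)⁻¹ + 504 * ((x ^ 2)⁻¹ * (x ^ 2)⁻¹) := by field_simp; ring
    _ ≤ 8 * (1 / 400) + 504 * (1 / 400 * (1 / 400)) := by gcongr
    _ ≤ 1 / 12 := by norm_num

end Parameters

/-! ### The bounds for the usage -/

section UsageBounds

variable {γ δ : ℝ}

/-- The number of examples that suffices, up to the ones for the stopping rule. -/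
def drawBound (γ δ : ℝ) : ℝ :=
  8 * roundBound γ δ * (sgdSize γ δ + thresholdSize γ δ) / δ

/-- Up to logarithms: `1 / (γ * δ)` rounds, at most `1 / (γ ^ 2 * δ ^ 3)` accepted examples in each,
and `1 / δ` draws for an accepted example. -/
theorem drawBound_le (hγ : 0 < γ) (hγ1 : γ ≤ 1) (hδ : 0 < δ) (hδ1 : δ ≤ 1) :
    drawBound γ δ ≤ 48 * 20324 * Real.log (2 / (γ * δ)) ^ 2 / (γ ^ 3 * δ ^ 5) := by
  have hl := half_le_log (q := γ * δ) (by positivity) (by nlinarith)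
  have hI := roundBound_le hγ hγ1 hδ hδ1
  have hn := sgdSize_le hγ hγ1 hδ hδ1
  have hm := thresholdSize_le hγ hγ1 hδ hδ1
  set l := Real.log (2 / (γ * δ))
  have hn' : (sgdSize γ δ : ℝ) ≤ 20002 * l / (γ ^ 2 * δ ^ 3) := by
    refine hn.trans (div_le_div_of_nonneg_left (by linarith) (by positivity) ?_)
    calc γ ^ 2 * δ ^ 3 = (γ * δ) ^ 2 * δ := by ring
      _ ≤ (γ * δ) ^ 2 * 1 := by gcongr
      _ = _ := mul_one _
  have hm' : (thresholdSize γ δ : ℝ) ≤ 322 * l / (γ ^ 2 * δ ^ 3) := by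
    refine hm.trans (div_le_div_of_nonneg_left (by linarith) (by positivity) ?_)
    calc γ ^ 2 * δ ^ 3 = γ * (δ ^ 2 * (γ * δ)) := by ring
      _ ≤ 1 * (δ ^ 2 * (γ * δ)) := by gcongr
      _ = _ := one_mul _
  calc drawBound γ δ ≤ 8 * (6 * l / (γ * δ)) * (20002 * l / (γ ^ 2 * δ ^ 3)
        + 322 * l / (γ ^ 2 * δ ^ 3)) / δ := by unfold drawBound; gcongr
    _ = _ := by field_simp; ring

theorem samples_le (hγ : 0 < γ) (hγ1 : γ ≤ 1) (hδ : 0 < δ) (hδ1 : δ ≤ 1) :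
    stoppingSize γ δ + drawBound γ δ
      ≤ 10 ^ 6 * Real.log (2 / (γ * δ)) ^ 2 / (γ ^ 3 * δ ^ 5) := by
  have hl := half_le_log (q := γ * δ) (by positivity) (by nlinarith)
  have hN := stoppingSize_le hγ hγ1 hδ hδ1
  have hS := drawBound_le hγ hγ1 hδ hδ1
  set l := Real.log (2 / (γ * δ))
  have hN' : (stoppingSize γ δ : ℝ) ≤ 68 * l ^ 2 / (γ ^ 3 * δ ^ 5) := by
    refine hN.trans (div_le_div₀ (by positivity) (by nlinarith) (by positivity) ?_)
    calc γ ^ 3 * δ ^ 5 = γ ^ 3 * δ ^ 4 * δ := by ring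
      _ ≤ 1 * 1 * δ := by
        gcongr
        · exact pow_le_one₀ hγ.le hγ1
        · exact pow_le_one₀ hδ.le hδ1
      _ = δ := by ring
  refine (add_le_add hN' hS).trans ?_
  rw [← add_div]
  gcongr
  nlinarith [sq_nonneg l]

/-- A crude count with every size at most `M` and at most `M ^ 2` draws: a round costs `O(M ^ 3)`
besides drawing, and the examination of a draw `O(M ^ 2)`. -/
theorem steps_le_of_le {d N n m I : ℕ} {M S : ℝ} (hM : 1 ≤ M) (hd : (d : ℝ) ≤ M) (hN : (N : ℝ) ≤ M)
    (hn : (n : ℝ) ≤ M) (hm : (m : ℝ) ≤ M) (hI : (I : ℝ) + 1 ≤ M) (_hS0 : 0 ≤ S) (hS : S ≤ M ^ 2) :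
    N + N * (d + 1) + 2 + ((I + 1) * roundSteps d n m N I + S * drawSteps d I) ≤ 75 * M ^ 4 := by
  have h0 : 0 ≤ M := by linarith
  have hI' : (I : ℝ) ≤ M := by linarith
  have h2 : M ≤ M ^ 2 := le_self_pow₀ hM (by norm_num)
  have h3 : M ^ 2 ≤ M ^ 3 := pow_le_pow_right₀ hM (by norm_num)
  have h4 : M ^ 3 ≤ M ^ 4 := pow_le_pow_right₀ hM (by norm_num)
  have hr : (roundSteps d n m N I : ℝ) ≤ 60 * M ^ 3 := by
    unfold roundSteps
    push_cast
    calc _ ≤ M * (M * (2 * M + 2) + 2) + 2 + (M * (12 * M + 7) + (8 * M + 4)) + M * (2 * M + 4)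
          + (M * (M * 3 + 4) + 1) + M := by gcongr
      _ ≤ _ := by nlinarith
  have hdr : (drawSteps d I : ℝ) ≤ 7 * M ^ 2 := by
    unfold drawSteps
    push_cast
    calc _ ≤ M + 1 + (M * (2 * M + 2) + 1) := by gcongr
      _ ≤ _ := by nlinarith
  calc _ ≤ M + M * (M + 1) + 2 + (M * (60 * M ^ 3) + M ^ 2 * (7 * M ^ 2)) := by gcongr
    _ ≤ _ := by nlinarith

theorem steps_le {d : ℕ} (hd : 0 < d) (hγ : 0 < γ) (hγ1 : γ ≤ 1) (hδ : 0 < δ) (hδ1 : δ ≤ 1) :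
    stoppingSize γ δ + stoppingSize γ δ * (d + 1) + 2
        + ((roundBound γ δ + 1) * roundSteps d (sgdSize γ δ) (thresholdSize γ δ) (stoppingSize γ δ)
            (roundBound γ δ) + drawBound γ δ * drawSteps d (roundBound γ δ))
      ≤ 75 * (40004 * (d / (γ * δ)) ^ 4) ^ 4 := by
  have hl := half_le_log (q := γ * δ) (by positivity) (by nlinarith)
  have hq : γ * δ ≤ 1 := by nlinarith
  have hq0 : 0 < γ * δ := by positivity
  have hI := roundBound_le hγ hγ1 hδ hδ1
  have hn := sgdSize_le hγ hγ1 hδ hδ1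
  have hm := thresholdSize_le hγ hγ1 hδ hδ1
  have hN := stoppingSize_le hγ hγ1 hδ hδ1
  have hS : drawBound γ δ ≤ _ := le_rfl
  -- Logarithms are at most `2 * y`, so all sizes are polynomials in `y` of degree at most `4`; `z =
  -- d * y` also dominates the dimension, and `40004 * z ^ 4` serves as the common bound `M`.
  set y := 1 / (γ * δ) with hy
  set z := (d : ℝ) / (γ * δ) with hz
  have hy1 : 1 ≤ y := by rw [hy, le_div_iff₀ hq0]; linarith
  have hd1 : (1 : ℝ) ≤ d := by exact_mod_cast hd
  have hyz : y ≤ z := by rw [hy, hz]; gcongr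
  have hdz : (d : ℝ) ≤ z := by rw [hz, le_div_iff₀ hq0]; nlinarith
  have hly : Real.log (2 / (γ * δ)) ≤ 2 * y := by
    refine (Real.log_le_sub_one_of_pos (by positivity)).trans ?_
    rw [hy]
    have : 2 / (γ * δ) = 2 * (1 / (γ * δ)) := by ring
    linarith
  set l := Real.log (2 / (γ * δ)) with hldef
  have hδy : 1 / δ ≤ y := one_div_le_one_div_of_le hq0 (by nlinarith)
  have hδy0 : 0 ≤ 1 / δ := by positivity
  have hz1 : 1 ≤ z := hy1.trans hyz
  have p1 : z ≤ z ^ 4 := le_self_pow₀ hz1 (by norm_num)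
  have p2 : y ^ 2 ≤ z ^ 4 := (pow_le_pow_left₀ (by linarith) hyz 2).trans
    (pow_le_pow_right₀ hz1 (by norm_num))
  have p3 : y ^ 3 ≤ z ^ 4 := (pow_le_pow_left₀ (by linarith) hyz 3).trans
    (pow_le_pow_right₀ hz1 (by norm_num))
  have p4 : y ^ 4 ≤ z ^ 4 := pow_le_pow_left₀ (by linarith) hyz 4
  have hN' : (stoppingSize γ δ : ℝ) ≤ 68 * y ^ 2 := by
    calc _ ≤ 34 * l / δ := hN
      _ = 34 * l * (1 / δ) := by ring
      _ ≤ 34 * (2 * y) * y := by gcongr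
      _ = _ := by ring
  have hn' : (sgdSize γ δ : ℝ) ≤ 40004 * y ^ 3 := by
    calc _ ≤ 20002 * l / (γ * δ) ^ 2 := hn
      _ = 20002 * l * y ^ 2 := by rw [hy]; field_simp
      _ ≤ 20002 * (2 * y) * y ^ 2 := by gcongr
      _ = _ := by ring
  have hm' : (thresholdSize γ δ : ℝ) ≤ 644 * y ^ 4 := by
    calc _ ≤ 322 * l / (δ ^ 2 * (γ * δ)) := hm
      _ = 322 * l * (1 / δ) ^ 2 * y := by rw [hy]; field_simp
      _ ≤ 322 * (2 * y) * y ^ 2 * y := by gcongr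
      _ = _ := by ring
  have hI' : (roundBound γ δ : ℝ) ≤ 12 * y ^ 2 := by
    calc _ ≤ 6 * l / (γ * δ) := hI
      _ = 6 * l * y := by rw [hy]; field_simp
      _ ≤ 6 * (2 * y) * y := by gcongr
      _ = _ := by ring
  have hz4 : 1 ≤ z ^ 4 := one_le_pow₀ hz1
  refine steps_le_of_le (by linarith) (by linarith) (by linarith) (by linarith) (by linarith)
    (by linarith) (by unfold drawBound; positivity) ?_
  calc drawBound γ δ = 8 * roundBound γ δ * (sgdSize γ δ + thresholdSize γ δ) * (1 / δ) := by
        unfold drawBound; ring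
    _ ≤ 8 * (12 * y ^ 2) * (40004 * y ^ 4 + 644 * y ^ 4) * y := by
        have : y ^ 3 ≤ y ^ 4 := pow_le_pow_right₀ hy1 (by norm_num)
        gcongr
        linarith
    _ = 3902208 * y ^ 7 := by ring
    _ ≤ 3902208 * z ^ 8 := by
        have : y ^ 7 ≤ z ^ 8 := (pow_le_pow_left₀ (by linarith) hyz 7).trans
          (pow_le_pow_right₀ hz1 (by norm_num))
        linarith
    _ ≤ _ := by
        have : 0 ≤ z ^ 8 := by positivity
        nlinarith

end UsageBounds

/-! ### Comparison of powers and arguments of logarithms. -/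

section Logarithms

/-- The logarithm may be smaller than `1`, so each additional power of it costs a factor `2`. -/
theorem le_mul_pow_of_half_le {l : ℝ} (hl : 1 / 2 ≤ l) {i k : ℕ} (hik : i ≤ k) :
    l ^ i ≤ 2 ^ (k - i) * l ^ k := by
  have h : 1 ≤ (2 * l) ^ (k - i) := one_le_pow₀ (by linarith)
  calc l ^ i ≤ l ^ i * (2 * l) ^ (k - i) := le_mul_of_one_le_right (by positivity) h
    _ = 2 ^ (k - i) * (l ^ (k - i) * l ^ i) := by rw [mul_pow]; ring
    _ = _ := by rw [← pow_add, Nat.sub_add_cancel hik]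

theorem log_div_ten_le {q : ℝ} (hq0 : 0 < q) (hq1 : q ≤ 1) :
    Real.log (2 / (q / 10)) ≤ 5 * Real.log (2 / q) := by
  have h2 : Real.log 2 ≤ Real.log (2 / q) :=
    Real.log_le_log (by norm_num) (by rw [le_div_iff₀ hq0]; linarith)
  have h10 : Real.log 10 ≤ 4 * Real.log 2 := by
    rw [show (4 : ℝ) = (4 : ℕ) by norm_num, ← Real.log_pow]
    exact Real.log_le_log (by norm_num) (by norm_num)
  rw [show 2 / (q / 10) = 10 * (2 / q) by field_simp, Real.log_mul (by norm_num) (by positivity)]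
  linarith

end Logarithms

/-- Some example satisfies both almost sure bounds, and Cauchy–Schwarz compares them. This supplies
`γ ≤ 1` for all the estimates of sizes. -/
theorem HasMargin.le_one {d : ℕ} {D : Measure (Example d)} [IsProbabilityMeasure D] {w : Vec d}
    {γ : ℝ} (hw : ‖w‖ = 1) (h : HasMargin D w γ) : γ ≤ 1 := by
  obtain ⟨p, hp1, hp2⟩ := h.exists
  refine hp2.trans ((abs_real_inner_le_norm w p.1).trans ?_)
  rw [hw, one_mul]
  exact hp1

end MassartMargin

end

/-! ### The theorem: choice of the absolute constants. -/

open MassartMargin in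
theorem theorem2p1 :
    -- absolute constants, and the parameters that the algorithm leaves inside `O` and `Õ`
    ∃ (c C : ℝ) (k : ℕ) (N n m : ℝ → ℝ → ℕ), 0 < c ∧ c ≤ 1 ∧
      (∀ γ ε : ℝ, 0 < γ → γ ≤ 1 → 0 < ε → ε ≤ 1 →
        (N γ ε : ℝ) ≤ C * Real.log (2 / (γ * ε)) / ε ^ 2 ∧
        (n γ ε : ℝ) ≤ C * Real.log (2 / (γ * ε)) ^ k / (γ ^ 2 * ε ^ 2) ∧
        (m γ ε : ℝ) ≤ C * Real.log (2 / (γ * ε)) ^ k / (γ ^ 2 * ε ^ 4)) ∧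
      ∀ (d : ℕ) (η γ ε : ℝ) (wstar : Vec d) (D : Measure (Example d)) [IsProbabilityMeasure D],
        0 ≤ η → η < 1 / 2 → 0 < γ → 0 < ε → ε ≤ 1 →
        -- the leakage is at most `1 / 2`, so that the loss is convex
        η + c * ε ≤ 1 / 2 →
        ‖wstar‖ = 1 → HasMargin D wstar γ → IsMassart D (halfspace wstar) η →
        -- the failure event has probability at most `1 / 3`
        Measure.infinitePi (fun _ : ℕ => D)
          {ω | ¬ ∃ (L : DecisionList d) (u : Usage),
            (learner d η γ (c * ε) (N γ (c * ε)) (n γ (c * ε)) (m γ (c * ε))).exec ω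
              = some (L, u) ∧
            (u.samples : ℝ) ≤ C * Real.log (2 / (γ * ε)) ^ k / (γ ^ 3 * ε ^ 5) ∧
            (u.steps : ℝ) ≤ C * (d * (1 / ε) * (1 / γ)) ^ k ∧
            ∀ g : Vec d → Bool, err D (L.classify g) ≤ η + ε} ≤ 1 / 3 := by
  -- With `c = 1 / 10` the error `6 * δ` is below `ε`, and `δ ≤ 1 / 10` as `failure_sum_le` needs.
  -- The exponent `16` is that of the step bound, a fourth power of a quantity of degree `4`; `10 ^
  -- 40` is generous.
  refine ⟨1 / 10, 10 ^ 40, 16, stoppingSize, sgdSize, thresholdSize, by norm_num, by norm_num, ?_, ?_⟩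
  · intro γ ε hγ hγ1 hε hε1
    have hl := half_le_log (q := γ * ε) (by positivity) (by nlinarith)
    have hN := stoppingSize_le hγ hγ1 hε hε1
    have hn := sgdSize_le hγ hγ1 hε hε1
    have hm := thresholdSize_le hγ hγ1 hε hε1
    set l := Real.log (2 / (γ * ε))
    have hl16 := le_mul_pow_of_half_le hl (show 1 ≤ 16 by norm_num)
    have hl0 : 0 ≤ l ^ 16 := by positivity
    norm_num at hl16
    refine ⟨hN.trans ?_, hn.trans ?_, hm.trans ?_⟩
    · refine div_le_div₀ (by positivity) (by linarith) (by positivity) ?_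
      nlinarith
    · rw [← mul_pow]
      gcongr ?_ / _
      linarith
    · refine div_le_div₀ (by positivity) (by linarith) (by positivity) ?_
      calc γ ^ 2 * ε ^ 4 = γ * ε * (ε ^ 2 * (γ * ε)) := by ring
        _ ≤ 1 * (ε ^ 2 * (γ * ε)) := by gcongr; nlinarith
        _ = _ := one_mul _
  · intro d η γ ε wstar D _ hη _ hγ hε hε1 hlam hnorm hmargin hD
    have hγ1 := hmargin.le_one hnorm
    -- There is no unit vector in dimension `0`; this matters because the claimed step bound
    -- vanishes at `d = 0`.
    have hd : 0 < d := by
      rcases Nat.eq_zero_or_pos d with rfl | hd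
      · rw [Subsingleton.elim wstar 0, norm_zero] at hnorm
        exact absurd hnorm (by norm_num)
      · exact hd
    set δ := 1 / 10 * ε with hδdef
    have hδ : 0 < δ := by positivity
    have hδ10 : δ ≤ 1 / 10 := by linarith
    have hδ1 : δ ≤ 1 := by linarith
    have hl := half_le_log (q := γ * δ) (by positivity) (by nlinarith)
    have hN : 0 < stoppingSize γ δ := Nat.ceil_pos.2 (by positivity)
    have hm : 0 < thresholdSize γ δ := Nat.ceil_pos.2 (by positivity)
    have hI : 0 < roundBound γ δ := Nat.succ_pos _
    have hmR : (0 : ℝ) < thresholdSize γ δ := Nat.cast_pos.2 hm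
    have hIR : (0 : ℝ) < roundBound γ δ := Nat.cast_pos.2 hI
    have hS : 0 < drawBound γ δ := by unfold drawBound; positivity
    -- The factor `8` in `drawBound` makes the expected charge for draws `1/4`, and `failure_sum_le`
    -- uses the remaining `1/12` of the budget `1/3`.
    have hcost : roundBound γ δ * ((drawBound γ δ)⁻¹ * ((sgdSize γ δ + thresholdSize γ δ) * (2 / δ)))
        = 1 / 4 := by
      unfold drawBound; field_simp; norm_num
    have hfail := failure_sum_le hγ hγ1 hδ hδ10
    have hguarantee := learner_guarantee hη hγ hγ1 hδ hlam hnorm hmargin hD hN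
      (sgdSize_ge hγ hγ1 hδ hδ1) hm (roundBound_pow_lt hγ hγ1 hδ hδ1) (inv_pos.2 hS)
      (by rw [mul_add, hcost]; linarith)
    refine (measure_mono fun ω hω => ?_).trans hguarantee
    refine fun hex => hω ?_
    obtain ⟨L, u, hexec, hs, ht, herr⟩ := hex
    rw [inv_inv] at hs ht
    refine ⟨L, u, hexec, ?_, ?_, fun g => (herr g).trans (by linarith)⟩
    · have hl' := half_le_log (q := γ * ε) (by positivity) (by nlinarith)
      have hlog : Real.log (2 / (γ * δ)) ≤ 5 * Real.log (2 / (γ * ε)) := by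
        rw [show γ * δ = γ * ε / 10 by rw [hδdef]; ring]
        exact log_div_ten_le (by positivity) (by nlinarith)
      have hl16 := le_mul_pow_of_half_le hl' (show 2 ≤ 16 by norm_num)
      norm_num at hl16
      refine hs.trans ((samples_le hγ hγ1 hδ hδ1).trans ?_)
      set l := Real.log (2 / (γ * δ))
      set l' := Real.log (2 / (γ * ε))
      have hl0 : 0 ≤ l' ^ 16 := by positivity
      have hsq : l ^ 2 ≤ 25 * l' ^ 2 := by
        calc l ^ 2 ≤ (5 * l') ^ 2 := by gcongr
          _ = _ := by ring
      calc 10 ^ 6 * l ^ 2 / (γ ^ 3 * δ ^ 5) = 10 ^ 11 * l ^ 2 / (γ ^ 3 * ε ^ 5) := by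
            rw [hδdef]; field_simp
        _ ≤ _ := by
            gcongr ?_ / _
            linarith
    -- Replacing `δ` by `ε / 10` produces `10 ^ 16`, of which `10 ^ 4` is absorbed in `400040 ^ 4 =
    -- (10 * 40004) ^ 4`.
    · refine ht.trans ((steps_le hd hγ hγ1 hδ hδ1).trans (le_of_eq_of_le (b :=
        75 * 400040 ^ 4 * 10 ^ 12 * (d * (1 / ε) * (1 / γ)) ^ 16) ?_ ?_))
      · rw [hδdef]; field_simp; norm_num
      · gcongr
        norm_num
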